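/- A \emph{skew-symmetric digraph} is a finite digraph $D=(V,A)$ (parallel arcs allowed) with an involution $\sigma$ on $V\cup A$ that maps $V$ to $V$ and $A$ to $A$, has no fixed point, and maps every arc from $v$ to $w$ to an arc from $\sigma(w)$ to $\sigma(v)$. An instance of \emph{$d$-Skew-Symmetric Multicut}, $d\ge 1$, consists of a skew-symmetric digraph $(D,\sigma)$, a finite family $\mathcal T$ of $d$-element sets of vertices, and an integer $k\ge 0$. A \emph{skew-symmetric multicut of size at most $2k$} is a set $S\subseteq A$ with $\sigma(S)=S$ and $|S|\le 2k$ such that every set in $\mathcal T$ contains a vertex $v$ for which $v$ and $\sigma(v)$ lie in distinct strongly connected components of $D\setminus S$. Let $n=|V|$, $m=|A|$ and $\ell=d\cdot|\mathcal T|$. \textbf{Theorem.} There is an algorithm (on a word RAM whose words have $O(\log(n+m+\ell+d+k+2))$ bits and which adds, subtracts, compares and accesses memory in unit time) that, given an instance of $d$-Skew-Symmetric Multicut, with $d$ part of the input, runs in time $O\big((4d)^k\,k^4\,(\ell+m+n)\big)$ with an absolute constant, and either returns a skew-symmetric multicut of size at most $2k$ or correctly concludes that no such set exists. (In the time bound,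 $k^4$ is read as $1$ if $k=0$, and $\ell+m+n$ is read as $\ell+m+n+1$.) -/

import Mathlib

/-! ### Skew-symmetric digraphs and multicuts -/

/-- A skew-symmetric digraph with vertex type `V` and arc type `A` (parallel arcs are allowed): a
digraph with a fixed-point-free involution on vertices and arcs (`σV` and `σA` are its two parts)
that sends an arc from `v` to `w` to an arc from `σV w` to `σV v`. -/
structure SkewSymmDigraph (V A : Type*) where
  /-- the start vertex of an arc -/
  tail : A → V
  /-- the end vertex of an arc -/
  head : A → V
  /-- the involution on vertices -/
  σV : V → V
  /-- the involution on arcs -/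
  σA : A → A
  σV_σV : ∀ v, σV (σV v) = v
  σV_ne : ∀ v, σV v ≠ v
  σA_σA : ∀ a, σA (σA a) = a
  σA_ne : ∀ a, σA a ≠ a
  tail_σA : ∀ a, tail (σA a) = σV (head a)
  head_σA : ∀ a, head (σA a) = σV (tail a)

namespace SkewSymmDigraph

variable {V A : Type*} (D : SkewSymmDigraph V A)

/-- There is a directed path (possibly of length zero) from `u` to `v` in `D` after the arcs in `S`
have been deleted. -/
def Reach (S : Finset A) (u v : V) : Prop :=
  Relation.ReflTransGen (fun x y => ∃ a, a ∉ S ∧ D.tail a = x ∧ D.head a = y) u v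

/-- `u` and `v` lie in the same strongly connected component of `D` minus the arcs in `S`. -/
def SameSCC (S : Finset A) (u v : V) : Prop :=
  D.Reach S u v ∧ D.Reach S v u

end SkewSymmDigraph

/-- An instance of `d`-Skew-Symmetric Multicut, for all `d` at once: the vertices are
`0, …, n - 1`, the arcs are `0, …, m - 1`, and the family consists of `t` sets of `d` vertices, each
given by an enumeration of its `d` distinct members. -/
structure MulticutInstance where
  /-- number of vertices -/
  n : ℕ
  /-- number of arcs -/
  m : ℕ
  /-- size of each set in the family -/
  d : ℕ
  /-- number of sets in the family -/
  t : ℕ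
  /-- the parameter -/
  k : ℕ
  /-- the skew-symmetric digraph -/
  D : SkewSymmDigraph (Fin n) (Fin m)
  /-- the family of `d`-sets of vertices -/
  family : Fin t → Fin d ↪ Fin n

namespace MulticutInstance

variable (I : MulticutInstance)

/-- The length of the family of sets. -/
def len : ℕ := I.d * I.t

/-- `S` is a skew-symmetric multicut for `I` (of size at most `2k`): it is self-conjugate, has at
most `2k` arcs, and every set of the family has a member `v` such that `v` and its conjugate lie in
distinct strongly connected components once `S` is deleted. -/
def IsMulticut (S : Finset (Fin I.m)) : Prop :=
  S.image I.D.σA = S ∧ S.card ≤ 2 * I.k ∧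
    ∀ i : Fin I.t, ∃ j : Fin I.d,
      ¬ I.D.SameSCC S (I.family i j) (I.D.σV (I.family i j))

end MulticutInstance

/-! ### A word RAM

Programs are while-programs over registers and random-access arrays that hold natural numbers. All
registers and array cells initially contain `0` unless they hold input. Every operation (constant,
register access, array access, arithmetic, comparison, assignment, test) costs one step. The only
arithmetic is addition and truncated subtraction. Words are bounded: an operation whose result
exceeds the bound `W` has no result, and the run is stuck. -/

namespace WordRAM

/-- The state of the machine. -/
structure State where
  /-- the contents of register `x` -/
  reg : ℕ → ℕ
  /-- the contents of cell `i` of array `a` -/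
  arr : ℕ → ℕ → ℕ

/-- Expressions. -/
inductive Expr where
  /-- a constant -/
  | const (c : ℕ)
  /-- the contents of register `x` -/
  | reg (x : ℕ)
  /-- the contents of the cell of array `a` whose index is the value of `e` -/
  | get (a : ℕ) (e : Expr)
  /-- addition -/
  | add (e f : Expr)
  /-- truncated subtraction -/
  | sub (e f : Expr)
  /-- `1` if `e < f` and `0` otherwise -/
  | lt (e f : Expr)
  /-- `1` if `e = f` and `0` otherwise -/
  | eq (e f : Expr)

/-- A value, provided that it fits into a word. -/
def fit (W x : ℕ) : Option ℕ := if x ≤ W then some x else none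

/-- The value of an expression; `none` if a word overflows during the evaluation. -/
def Expr.eval (W : ℕ) (s : State) : Expr → Option ℕ
  | .const c => fit W c
  | .reg x => fit W (s.reg x)
  | .get a e => (e.eval W s).bind fun i => fit W (s.arr a i)
  | .add e f => (e.eval W s).bind fun x => (f.eval W s).bind fun y => fit W (x + y)
  | .sub e f => (e.eval W s).bind fun x => (f.eval W s).bind fun y => fit W (x - y)
  | .lt e f => (e.eval W s).bind fun x => (f.eval W s).bind fun y => fit W (if x < y then 1 else 0)
  | .eq e f => (e.eval W s).bind fun x => (f.eval W s).bind fun y => fit W (if x = y then 1 else 0)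

/-- The number of steps needed to evaluate an expression: one for each operation in it. -/
def Expr.cost : Expr → ℕ
  | .const _ => 1
  | .reg _ => 1
  | .get _ e => e.cost + 1
  | .add e f => e.cost + f.cost + 1
  | .sub e f => e.cost + f.cost + 1
  | .lt e f => e.cost + f.cost + 1
  | .eq e f => e.cost + f.cost + 1

/-- Programs. -/
inductive Prog where
  /-- do nothing -/
  | skip
  /-- put the value of `e` into register `x` -/
  | set (x : ℕ) (e : Expr)
  /-- put the value of `e` into the cell of array `a` whose index is the value of `i` -/
  | put (a : ℕ) (i e : Expr)
  /-- run `p`, then `q` -/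
  | seq (p q : Prog)
  /-- run `p` if the value of `e` is nonzero and `q` otherwise -/
  | cond (e : Expr) (p q : Prog)
  /-- run `p` again and again, as long as the value of `e` is nonzero -/
  | loop (e : Expr) (p : Prog)

/-- Overwrite register `x`. -/
def State.setReg (s : State) (x v : ℕ) : State :=
  { s with reg := Function.update s.reg x v }

/-- Overwrite cell `i` of array `a`. -/
def State.setArr (s : State) (a i v : ℕ) : State :=
  { s with arr := Function.update s.arr a (Function.update (s.arr a) i v) }

/-- `Run W p s T s'`: started in state `s` with words bounded by `W`, the program `p` halts in
state `s'` after exactly `T` steps. -/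
inductive Run (W : ℕ) : Prog → State → ℕ → State → Prop
  | skip (s : State) : Run W .skip s 1 s
  | set {s : State} {x v : ℕ} {e : Expr} (he : e.eval W s = some v) :
      Run W (.set x e) s (e.cost + 1) (s.setReg x v)
  | put {s : State} {a j v : ℕ} {i e : Expr}
      (hi : i.eval W s = some j) (he : e.eval W s = some v) :
      Run W (.put a i e) s (i.cost + e.cost + 1) (s.setArr a j v)
  | seq {s s' s'' : State} {T T' : ℕ} {p q : Prog}
      (hp : Run W p s T s') (hq : Run W q s' T' s'') :
      Run W (.seq p q) s (T + T') s''
  | cond_true {s s' : State} {T v : ℕ} {e : Expr} {p q : Prog}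
      (he : e.eval W s = some v) (hv : v ≠ 0) (hp : Run W p s T s') :
      Run W (.cond e p q) s (e.cost + 1 + T) s'
  | cond_false {s s' : State} {T : ℕ} {e : Expr} {p q : Prog}
      (he : e.eval W s = some 0) (hq : Run W q s T s') :
      Run W (.cond e p q) s (e.cost + 1 + T) s'
  | loop_true {s s' s'' : State} {T T' v : ℕ} {e : Expr} {p : Prog}
      (he : e.eval W s = some v) (hv : v ≠ 0)
      (hp : Run W p s T s') (hl : Run W (.loop e p) s' T' s'') :
      Run W (.loop e p) s (e.cost + 1 + T + T') s''
  | loop_false {s : State} {e : Expr} {p : Prog} (he : e.eval W s = some 0) :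
      Run W (.loop e p) s (e.cost + 1) s

/-- Execution is deterministic. -/
theorem Run.deterministic {W : ℕ} {p : Prog} {s s₁ s₂ : State} {T T' : ℕ}
    (h : Run W p s T s₁) (h' : Run W p s T' s₂) : T = T' ∧ s₁ = s₂ := by
  induction h generalizing T' s₂ with
  | skip s => cases h'; simp
  | set he => cases h' with | set h2 => simp_all
  | put hi he => cases h' with | put h2 h3 => simp_all
  | seq hp hq i1 i2 =>
    cases h' with | seq a b =>
    obtain ⟨rfl, rfl⟩ := i1 a; obtain ⟨rfl, rfl⟩ := i2 b; simp
  | cond_true he hv hp ih =>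
    cases h' with
    | cond_true a b c => obtain ⟨rfl, rfl⟩ := ih c; simp
    | cond_false a c => simp_all
  | cond_false he hp ih =>
    cases h' with
    | cond_true a b c => simp_all
    | cond_false a c => obtain ⟨rfl, rfl⟩ := ih c; simp
  | loop_true he hv hp hl i1 i2 =>
    cases h' with
    | loop_true a b c d => obtain ⟨rfl, rfl⟩ := i1 c; obtain ⟨rfl, rfl⟩ := i2 d; simp
    | loop_false a => simp_all
  | loop_false he =>
    cases h' with
    | loop_true a b c d => simp_all
    | loop_false a => simp

end WordRAM

/-! ### Input and output of an algorithm for the multicut problem -/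

namespace MulticutInstance

variable (I : MulticutInstance)

/-- The initial state on input `I`: registers `0, …, 4` hold `n`, `m`, `d`, the number `t` of sets,
and `k`; arrays `0, …, 4` hold the involution on vertices, the involution on arcs, the tails of
the arcs, the heads of the arcs, and the members of the first, second, … set of the family, listed
one set after the other; everything else is `0`. -/
def input : WordRAM.State where
  reg x :=
    match x with
    | 0 => I.n
    | 1 => I.m
    | 2 => I.d
    | 3 => I.t
    | 4 => I.k
    | _ => 0
  arr a i :=
    match a with
    | 0 => if h : i < I.n then I.D.σV ⟨i, h⟩ else 0
    | 1 => if h : i < I.m then I.D.σA ⟨i, h⟩ else 0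
    | 2 => if h : i < I.m then I.D.tail ⟨i, h⟩ else 0
    | 3 => if h : i < I.m then I.D.head ⟨i, h⟩ else 0
    | 4 => if h : i < I.t * I.d then
        I.family (Fin.divNat (⟨i, h⟩ : Fin (I.t * I.d))) (Fin.modNat (⟨i, h⟩ : Fin (I.t * I.d)))
        else 0
    | _ => 0

/-- The set of arcs that a final state presents as output: array `5` is its indicator function. -/
def outputSet (s : WordRAM.State) : Finset (Fin I.m) :=
  Finset.univ.filter fun a : Fin I.m => s.arr 5 a ≠ 0

/-- The final state `s` is a correct answer on input `I`. Register `5` says whether a set is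
returned. If it is nonzero, then the returned set is a skew-symmetric multicut of size at most
`2k`; if it is zero, then there is no such set. -/
def Correct (s : WordRAM.State) : Prop :=
  (s.reg 5 ≠ 0 → I.IsMulticut (I.outputSet s)) ∧
  (s.reg 5 = 0 → ¬ ∃ S : Finset (Fin I.m), I.IsMulticut S)

/-- The magnitude of the input, which bounds its length and all numbers in it up to a constant
factor: words that can hold all numbers up to `I.size ^ c` have length `O(log I.size)`. -/
def size : ℕ := I.n + I.m + I.len + I.d + I.k + 2

end MulticutInstance

/-!
The program explores a search tree with a stack of pending nodes. A node consists of a set `S` of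
deleted arcs, closed under conjugation, and a set `L` of vertices that are committed to a labelling:
by `exists_labelling`, a self-conjugate arc set `R` is a multicut if and only if some vertex set `X`
without conjugate pairs, closed under the arcs outside `R`, contains a member of each set of the
family or the conjugate of a member. `Sol S L` says that some multicut within the budget contains
`S` and has such an `X` that contains `L`.

At a node, the program computes a minimum cut between `L` and its conjugate, by augmenting paths, or
finds that it exceeds the budget. By `Sol.persist`, `L` may be replaced by any consistent minimum
cut; the program takes a maximal one, `Z` (`IsMaxCut`). It is found in linear time: outside the
smallest minimum cut and its conjugate, the residual graph is invariant under conjugation, and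
Kosaraju's algorithm labels its strongly connected components in topological order; the vertices
with a larger label than their conjugates form `Z` (`FlowInv.isMaxCut`, `DfsInv.kosaraju`). By
maximality, every further commitment makes the minimum cut larger.

* If the head `w` of an arc that leaves `Z` is undecided, either the arc is kept, `w` joins `L` and
  the minimum cut grows, or the arc and its conjugate are deleted; then the budget drops by two, and
  the minimum cut by at most one (`IsMaxCut.le_of_delete`).
* Otherwise all arcs that leave `Z` have to be deleted (`Sol.forced`), and their number `l` is even.
  Now `S` is a multicut, or some set of the family has no decided member. Then one of its `d`
  members or their conjugates joins `L`, and the minimum cut becomes positive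
  (`IsMaxCut.pos_of_forced`).

A node with budget `K` and minimum cut `l` gets the weight `2 ^ (K + 1 - l) * d ^ (K / 2 - 1)` if
`l ≥ 1`, and `2 * (4 * d) ^ (K / 2)` if `l = 0`. The first kind of branching yields two children
with at most half of the weight each (`weight_succ`, `weight_sub_two`), and the second yields
`2 * d` children whose weights add up to at most the weight of the node (`weight_sub`). Hence the
weight of the root bounds the number of leaves, and the tree has size `O((4d)^k)`.
A node takes time `O((k + 1) * (ℓ + m + n + 1))`, apart from the copies made for its children, which
are charged to the children. The length of the stack of pending nodes is `O(d * k)`, so that all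
addresses fit into words of logarithmic length.

Running times are derived in a Hoare logic for the machine (`Tri`): loop-free code is executed
symbolically, and loops have an invariant and a decreasing measure.
-/

set_option linter.unusedSimpArgs false

/-! ### Straight-line programs and time-bounded triples for the word RAM -/

namespace WordRAM

/-- The value of an expression when words are unbounded. -/
def Expr.val (s : State) : Expr → ℕ
  | .const c => c
  | .reg x => s.reg x
  | .get a e => s.arr a (e.val s)
  | .add e f => e.val s + f.val s
  | .sub e f => e.val s - f.val s
  | .lt e f => if e.val s < f.val s then 1 else 0
  | .eq e f => if e.val s = f.val s then 1 else 0

/-- If all cells of a state are at most `M`, then every intermediate result in the evaluation of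
`e` is at most `e.wt * M`. -/
def Expr.wt : Expr → ℕ
  | .const c => c
  | .reg _ => 1
  | .get _ e => max 1 e.wt
  | .add e f => e.wt + f.wt
  | .sub e f => max e.wt f.wt
  | .lt e f => max 1 (max e.wt f.wt)
  | .eq e f => max 1 (max e.wt f.wt)

/-- All cells of the state `s` are at most `M`. -/
structure Bdd (M : ℕ) (s : State) : Prop where
  pos : 1 ≤ M
  reg : ∀ x, s.reg x ≤ M
  arr : ∀ a i, s.arr a i ≤ M

theorem Expr.val_le_wt {M : ℕ} {s : State} (hs : Bdd M s) (e : Expr) : e.val s ≤ e.wt * M := by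
  have h1 := hs.pos
  induction e with
  | const c => exact Nat.le_mul_of_pos_right _ h1
  | reg x => simpa [val, wt] using hs.reg x
  | get a e ih =>
    exact (hs.arr _ _).trans (Nat.le_mul_of_pos_left _ (by simp [wt]))
  | add e f ihe ihf => simp only [val, wt, add_mul]; omega
  | sub e f ihe ihf =>
    have := Nat.mul_le_mul_right M (le_max_left e.wt f.wt)
    simp only [val, wt]; omega
  | lt e f ihe ihf =>
    have : 1 * M ≤ (Expr.lt e f).wt * M := Nat.mul_le_mul_right M (le_max_left _ _)
    simp only [val]; split <;> omega
  | eq e f ihe ihf =>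
    have : 1 * M ≤ (Expr.eq e f).wt * M := Nat.mul_le_mul_right M (le_max_left _ _)
    simp only [val]; split <;> omega

theorem Expr.eval_eq_val {M W : ℕ} {s : State} (hs : Bdd M s) (e : Expr) (hW : e.wt * M ≤ W) :
    e.eval W s = some (e.val s) := by
  have fitle : ∀ x, x ≤ W → fit W x = some x := fun x hx => if_pos hx
  have hv := (e.val_le_wt hs).trans hW
  have mono : ∀ {a b : ℕ}, a ≤ b → b * M ≤ W → a * M ≤ W :=
    fun h h' => (Nat.mul_le_mul_right M h).trans h'
  induction e with
  | const c => exact fitle _ hv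
  | reg x => exact fitle _ hv
  | get a e ih =>
    have h := mono (le_max_right 1 e.wt) hW
    simp only [eval, ih h ((e.val_le_wt hs).trans h), Option.bind_some]
    exact fitle _ hv
  | add e f ihe ihf =>
    have h := mono (Nat.le_add_right e.wt f.wt) hW
    have h' := mono (Nat.le_add_left f.wt e.wt) hW
    simp only [eval, ihe h ((e.val_le_wt hs).trans h), ihf h' ((f.val_le_wt hs).trans h'),
      Option.bind_some]
    exact fitle _ hv
  | sub e f ihe ihf =>
    have h := mono (le_max_left e.wt f.wt) hW
    have h' := mono (le_max_right e.wt f.wt) hW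
    simp only [eval, ihe h ((e.val_le_wt hs).trans h), ihf h' ((f.val_le_wt hs).trans h'),
      Option.bind_some]
    exact fitle _ hv
  | lt e f ihe ihf =>
    have h := mono ((le_max_left e.wt f.wt).trans (le_max_right 1 _)) hW
    have h' := mono ((le_max_right e.wt f.wt).trans (le_max_right 1 _)) hW
    simp only [eval, ihe h ((e.val_le_wt hs).trans h), ihf h' ((f.val_le_wt hs).trans h'),
      Option.bind_some]
    exact fitle _ hv
  | eq e f ihe ihf =>
    have h := mono ((le_max_left e.wt f.wt).trans (le_max_right 1 _)) hW
    have h' := mono ((le_max_right e.wt f.wt).trans (le_max_right 1 _)) hW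
    simp only [eval, ihe h ((e.val_le_wt hs).trans h), ihf h' ((f.val_le_wt hs).trans h'),
      Option.bind_some]
    exact fitle _ hv

@[simp] theorem State.setReg_reg (s : State) (x v y : ℕ) :
    (s.setReg x v).reg y = if y = x then v else s.reg y := by
  simp [State.setReg, Function.update_apply]

@[simp] theorem State.setReg_arr (s : State) (x v : ℕ) : (s.setReg x v).arr = s.arr := rfl

@[simp] theorem State.setArr_reg (s : State) (a i v : ℕ) : (s.setArr a i v).reg = s.reg := rfl

@[simp] theorem State.setArr_arr (s : State) (a i v b : ℕ) :
    (s.setArr a i v).arr b = if b = a then Function.update (s.arr a) i v else s.arr b := by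
  simp [State.setArr, Function.update_apply]

theorem Bdd.setReg {M : ℕ} {s : State} (hs : Bdd M s) {x v : ℕ} (hv : v ≤ M) :
    Bdd M (s.setReg x v) := by
  refine ⟨hs.pos, fun y => ?_, hs.arr⟩
  rw [State.setReg_reg]; split
  · exact hv
  · exact hs.reg y

theorem Bdd.setArr {M : ℕ} {s : State} (hs : Bdd M s) {a i v : ℕ} (hv : v ≤ M) :
    Bdd M (s.setArr a i v) := by
  refine ⟨hs.pos, hs.reg, fun b j => ?_⟩
  rw [State.setArr_arr]; split
  · rw [Function.update_apply]; split
    · exact hv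
    · exact hs.arr _ _
  · exact hs.arr _ _

namespace Prog

/-- The program is free of loops and all its expressions have weight at most `16`. -/
def straight : Prog → Bool
  | .skip => true
  | .set _ e => decide (e.wt ≤ 16)
  | .put _ i e => decide (i.wt ≤ 16) && decide (e.wt ≤ 16)
  | .seq p q => p.straight && q.straight
  | .cond e p q => decide (e.wt ≤ 16) && (p.straight && q.straight)
  | .loop _ _ => false

/-- The effect of a loop-free program when words are unbounded. -/
def exec : Prog → State → State
  | .skip, s => s
  | .set x e, s => s.setReg x (e.val s)
  | .put a i e, s => s.setArr a (i.val s) (e.val s)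
  | .seq p q, s => q.exec (p.exec s)
  | .cond e p q, s => if e.val s = 0 then q.exec s else p.exec s
  | .loop _ _, s => s

/-- All values stored by a loop-free program are at most `M`. -/
def Safe (M : ℕ) : Prog → State → Prop
  | .skip, _ => True
  | .set _ e, s => e.val s ≤ M
  | .put _ _ e, s => e.val s ≤ M
  | .seq p q, s => p.Safe M s ∧ q.Safe M (p.exec s)
  | .cond e p q, s => if e.val s = 0 then q.Safe M s else p.Safe M s
  | .loop _ _, _ => True

/-- An upper bound for the running time of a loop-free program. -/
def cst : Prog → ℕ
  | .skip => 1
  | .set _ e => e.cost + 1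
  | .put _ i e => i.cost + e.cost + 1
  | .seq p q => p.cst + q.cst
  | .cond e p q => e.cost + 1 + max p.cst q.cst
  | .loop _ _ => 0

/-- The program contains an assignment to register `x`. -/
def wr (x : ℕ) : Prog → Bool
  | .skip => false
  | .set y _ => decide (x = y)
  | .put _ _ _ => false
  | .seq p q => p.wr x || q.wr x
  | .cond _ p q => p.wr x || q.wr x
  | .loop _ p => p.wr x

/-- The program contains an assignment to a cell of array `a`. -/
def wa (a : ℕ) : Prog → Bool
  | .skip => false
  | .set _ _ => false
  | .put b _ _ => decide (a = b)
  | .seq p q => p.wa a || q.wa a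
  | .cond _ p q => p.wa a || q.wa a
  | .loop _ p => p.wa a

end Prog

/-- `s` and `s'` agree on all registers and arrays to which `p` does not assign. -/
structure Frame (p : Prog) (s s' : State) : Prop where
  reg : ∀ x, p.wr x = false → s'.reg x = s.reg x
  arr : ∀ a, p.wa a = false → s'.arr a = s.arr a

theorem Frame.refl (p : Prog) (s : State) : Frame p s s := ⟨fun _ _ => rfl, fun _ _ => rfl⟩

theorem Frame.trans {p : Prog} {s s' s'' : State} (h : Frame p s s') (h' : Frame p s' s'') :
    Frame p s s'' :=
  ⟨fun x hx => (h'.reg x hx).trans (h.reg x hx), fun a ha => (h'.arr a ha).trans (h.arr a ha)⟩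

theorem Frame.mono {p q : Prog} {s s' : State} (h : Frame p s s')
    (hr : ∀ x, q.wr x = false → p.wr x = false) (ha : ∀ a, q.wa a = false → p.wa a = false) :
    Frame q s s' :=
  ⟨fun x hx => h.reg x (hr x hx), fun a h' => h.arr a (ha a h')⟩

/-- A program changes only what it assigns to. -/
theorem Run.frame {W : ℕ} {p : Prog} {s s' : State} {T : ℕ} (h : Run W p s T s') :
    Frame p s s' := by
  induction h with
  | skip s => exact Frame.refl _ _
  | set he => exact ⟨fun x hx => by simp_all [Prog.wr], fun _ _ => rfl⟩
  | put hi he => exact ⟨fun _ _ => rfl, fun a ha => by simp_all [Prog.wa]⟩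
  | seq hp hq i1 i2 =>
    exact (i1.mono (by simp +contextual [Prog.wr]) (by simp +contextual [Prog.wa])).trans
      (i2.mono (by simp +contextual [Prog.wr]) (by simp +contextual [Prog.wa]))
  | cond_true he hv hp ih =>
    exact ih.mono (by simp +contextual [Prog.wr]) (by simp +contextual [Prog.wa])
  | cond_false he hp ih =>
    exact ih.mono (by simp +contextual [Prog.wr]) (by simp +contextual [Prog.wa])
  | loop_true he hv hp hl i1 i2 =>
    exact Frame.trans (i1.mono (by simp [Prog.wr]) (by simp [Prog.wa])) i2
  | loop_false he => exact Frame.refl _ _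

/-- A loop-free program whose stored values stay below `M` runs as if words were unbounded. -/
theorem Prog.run_exec {M W : ℕ} (hW : 16 * M ≤ W) (p : Prog) (hp : p.straight = true) (s : State)
    (hs : Bdd M s) (hsafe : p.Safe M s) :
    ∃ T, Run W p s T (p.exec s) ∧ T ≤ p.cst ∧ Bdd M (p.exec s) := by
  have ev : ∀ (s : State) (e : Expr), Bdd M s → e.wt ≤ 16 → e.eval W s = some (e.val s) :=
    fun s e h h' => Expr.eval_eq_val h e ((Nat.mul_le_mul_right M h').trans hW)
  induction p generalizing s with
  | skip => exact ⟨1, .skip s, le_rfl, hs⟩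
  | set x e =>
    simp only [straight, decide_eq_true_eq] at hp
    exact ⟨_, .set (ev s e hs hp), le_rfl, hs.setReg hsafe⟩
  | put a i e =>
    simp only [straight, Bool.and_eq_true, decide_eq_true_eq] at hp
    exact ⟨_, .put (ev s i hs hp.1) (ev s e hs hp.2), le_rfl, hs.setArr hsafe⟩
  | seq p q ihp ihq =>
    simp only [straight, Bool.and_eq_true] at hp
    obtain ⟨T, h, hT, hb⟩ := ihp hp.1 s hs hsafe.1
    obtain ⟨T', h', hT', hb'⟩ := ihq hp.2 _ hb hsafe.2
    exact ⟨_, .seq h h', Nat.add_le_add hT hT', hb'⟩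
  | cond e p q ihp ihq =>
    simp only [straight, Bool.and_eq_true, decide_eq_true_eq] at hp
    have he := ev s e hs hp.1
    simp only [Safe] at hsafe
    simp only [exec, cst]
    split at hsafe
    · next h0 =>
      obtain ⟨T, h, hT, hb⟩ := ihq hp.2.2 s hs hsafe
      rw [if_pos h0]
      exact ⟨_, .cond_false (h0 ▸ he) h, by omega, hb⟩
    · next h0 =>
      obtain ⟨T, h, hT, hb⟩ := ihp hp.2.1 s hs hsafe
      rw [if_neg h0]
      exact ⟨_, .cond_true he h0 h, by omega, hb⟩
  | loop e p ih => simp [straight] at hp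

/-- From a state whose cells are at most `M`, and with words that can hold `16 * M`, the program
`p` halts after some number `T` of steps in a state `s'` whose cells are at most `M` again, and
`Q T s'` holds. -/
def TriT (M : ℕ) (p : Prog) (s : State) (Q : ℕ → State → Prop) : Prop :=
  Bdd M s → ∀ W, 16 * M ≤ W → ∃ T s', Run W p s T s' ∧ Bdd M s' ∧ Q T s'

/-- The program `p` halts after at most `B` steps in a state that satisfies `Q`; see `TriT`. -/
def Tri (M : ℕ) (p : Prog) (s : State) (B : ℕ) (Q : State → Prop) : Prop :=
  TriT M p s fun T s' => T ≤ B ∧ Q s'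

theorem TriT.mono {M : ℕ} {p : Prog} {s : State} {Q Q' : ℕ → State → Prop} (h : TriT M p s Q)
    (hQ : ∀ T s', Bdd M s' → Frame p s s' → Q T s' → Q' T s') : TriT M p s Q' := by
  intro hs W hW
  obtain ⟨T, s', h1, h2, h3⟩ := h hs W hW
  exact ⟨T, s', h1, h2, hQ T s' h2 h1.frame h3⟩

theorem Tri.mono {M B B' : ℕ} {p : Prog} {s : State} {Q Q' : State → Prop} (h : Tri M p s B Q)
    (hB : B ≤ B') (hQ : ∀ s', Bdd M s' → Frame p s s' → Q s' → Q' s') : Tri M p s B' Q' :=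
  TriT.mono h fun _ s' hb hf hq => ⟨hq.1.trans hB, hQ s' hb hf hq.2⟩

theorem Tri.of_bdd {M B : ℕ} {p : Prog} {s : State} {Q : State → Prop}
    (h : Bdd M s → Tri M p s B Q) : Tri M p s B Q := fun hs => h hs hs

theorem TriT.seq {M : ℕ} {p q : Prog} {s : State} {Q : ℕ → State → Prop}
    (h : TriT M p s fun T s' => TriT M q s' fun T' s'' => Q (T + T') s'') :
    TriT M (.seq p q) s Q := by
  intro hs W hW
  obtain ⟨T, s', h1, h2, h3⟩ := h hs W hW
  obtain ⟨T', s'', h4, h5, h6⟩ := h3 h2 W hW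
  exact ⟨_, s'', .seq h1 h4, h5, h6⟩

theorem Tri.seq {M B : ℕ} {p q : Prog} {s : State} {Q : State → Prop} (B₁ B₂ : ℕ)
    (h : Tri M p s B₁ fun s' => Frame p s s' → Bdd M s' → Tri M q s' B₂ Q) (hB : B₁ + B₂ ≤ B) :
    Tri M (.seq p q) s B Q :=
  TriT.seq (TriT.mono h fun _ _ hb hf h' =>
    TriT.mono (h'.2 hf hb) fun _ _ _ _ h'' => ⟨by omega, h''.2⟩)

theorem Tri.straight {M B : ℕ} {p : Prog} {s : State} {Q : State → Prop}
    (hp : p.straight = true) (hB : p.cst ≤ B) (h : Bdd M s → p.Safe M s ∧ Q (p.exec s)) :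
    Tri M p s B Q := by
  intro hs W hW
  obtain ⟨T, h1, h2, h3⟩ := p.run_exec hW hp s hs (h hs).1
  exact ⟨T, _, h1, h3, h2.trans hB, (h hs).2⟩

theorem TriT.cond {M : ℕ} {e : Expr} {p q : Prog} {s : State} {Q : ℕ → State → Prop}
    (he : e.wt ≤ 16) (h1 : e.val s ≠ 0 → TriT M p s fun T s' => Q (e.cost + 1 + T) s')
    (h2 : e.val s = 0 → TriT M q s fun T s' => Q (e.cost + 1 + T) s') :
    TriT M (.cond e p q) s Q := by
  intro hs W hW
  have ev := Expr.eval_eq_val hs e ((Nat.mul_le_mul_right M he).trans hW)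
  by_cases h0 : e.val s = 0
  · obtain ⟨T, s', a, b, c⟩ := h2 h0 hs W hW
    exact ⟨_, s', .cond_false (h0 ▸ ev) a, b, c⟩
  · obtain ⟨T, s', a, b, c⟩ := h1 h0 hs W hW
    exact ⟨_, s', .cond_true ev h0 a, b, c⟩

theorem Tri.cond {M B : ℕ} {e : Expr} {p q : Prog} {s : State} {Q : State → Prop} (B' : ℕ)
    (he : e.wt ≤ 16) (h1 : e.val s ≠ 0 → Tri M p s B' Q) (h2 : e.val s = 0 → Tri M q s B' Q)
    (hB : e.cost + 1 + B' ≤ B) : Tri M (.cond e p q) s B Q :=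
  TriT.cond he (fun h => TriT.mono (h1 h) fun _ _ _ _ h' => ⟨by omega, h'.2⟩)
    (fun h => TriT.mono (h2 h) fun _ _ _ _ h' => ⟨by omega, h'.2⟩)

/-- The rule for loops with an invariant `Inv r` that holds a time budget `r`, from which the
steps of every iteration are paid. -/
theorem TriT.loop {M : ℕ} {e : Expr} {p : Prog} {s : State} {Q : State → Prop}
    (Inv : ℕ → State → Prop) (he : e.wt ≤ 16) (r : ℕ) (h0 : Inv r s)
    (hstep : ∀ r s', Frame p s s' → Bdd M s' → Inv r s' → e.val s' ≠ 0 →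
      TriT M p s' fun T s'' => ∃ r', r' + T + e.cost + 1 ≤ r ∧ Inv r' s'')
    (hexit : ∀ r s', Frame p s s' → Bdd M s' → Inv r s' → e.val s' = 0 → Q s') :
    Tri M (.loop e p) s (r + e.cost + 1) Q := by
  intro hs W hW
  suffices H : ∀ r s', Frame p s s' → Bdd M s' → Inv r s' →
      ∃ T s'', Run W (.loop e p) s' T s'' ∧ Bdd M s'' ∧ T ≤ r + e.cost + 1 ∧ Q s'' by
    exact H r s (Frame.refl _ _) hs h0
  intro r
  induction r using Nat.strong_induction_on with
  | _ r ih =>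
    intro s' hf hb hi
    have ev := Expr.eval_eq_val hb e ((Nat.mul_le_mul_right M he).trans hW)
    by_cases hv : e.val s' = 0
    · exact ⟨_, s', .loop_false (hv ▸ ev), hb, by omega, hexit r s' hf hb hi hv⟩
    · obtain ⟨T, s₁, h1, h2, r', h3, h4⟩ := hstep r s' hf hb hi hv hb W hW
      obtain ⟨T', s₂, h5, h6, h7, h8⟩ := ih r' (by omega) s₁ (hf.trans h1.frame) h2 h4
      exact ⟨_, s₂, .loop_true ev hv h1 h5, h6, by omega, h8⟩

/-- The rule for loops in which every iteration takes at most `c` steps and decreases `φ`. -/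
theorem Tri.loop {M B : ℕ} {e : Expr} {p : Prog} {s : State} {Q : State → Prop}
    (Inv : State → Prop) (φ : State → ℕ) (c : ℕ) (he : e.wt ≤ 16) (h0 : Inv s)
    (hstep : ∀ s', Frame p s s' → Bdd M s' → Inv s' → e.val s' ≠ 0 →
      Tri M p s' c fun s'' => Inv s'' ∧ φ s'' < φ s')
    (hexit : ∀ s', Frame p s s' → Bdd M s' → Inv s' → e.val s' = 0 → Q s')
    (hB : (φ s + 1) * (c + e.cost + 1) ≤ B) :
    Tri M (.loop e p) s B Q := by
  refine Tri.mono (TriT.loop (Q := Q)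
    (fun r s' => Inv s' ∧ φ s' * (c + e.cost + 1) = r) he _ ⟨h0, rfl⟩ ?_ ?_) ?_ (fun _ _ _ h => h)
  · rintro r s' hf hb ⟨hi, rfl⟩ hv
    refine TriT.mono (hstep s' hf hb hi hv) fun T s'' _ _ h => ⟨_, ?_, h.2.1, rfl⟩
    have := Nat.mul_le_mul_right (c + e.cost + 1) (Nat.succ_le_of_lt h.2.2)
    rw [Nat.succ_mul] at this
    have := h.1
    omega
  · exact fun r s' hf hb hi hv => hexit s' hf hb hi.1 hv
  · rw [Nat.succ_mul] at hB; omega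

/-- The rule for loops in which every iteration takes at most `c` steps and decreases the measure
`ψ` of an auxiliary value on which the invariant depends. -/
theorem Tri.loop_ghost {α : Type*} {M B : ℕ} {e : Expr} {p : Prog} {s : State} {Q : State → Prop}
    (Inv : α → State → Prop) (ψ : α → ℕ) (c : ℕ) (he : e.wt ≤ 16) (x₀ : α) (h0 : Inv x₀ s)
    (hstep : ∀ x s', Frame p s s' → Bdd M s' → Inv x s' → e.val s' ≠ 0 →
      ∃ y, ψ y < ψ x ∧ Tri M p s' c (Inv y))
    (hexit : ∀ x s', Frame p s s' → Bdd M s' → Inv x s' → e.val s' = 0 → Q s')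
    (hB : (ψ x₀ + 1) * (c + e.cost + 1) ≤ B) :
    Tri M (.loop e p) s B Q := by
  refine Tri.mono (TriT.loop (Q := Q)
    (fun r s' => ∃ x, Inv x s' ∧ ψ x * (c + e.cost + 1) = r) he _ ⟨x₀, h0, rfl⟩ ?_ ?_) ?_
    (fun _ _ _ h => h)
  · rintro r s' hf hb ⟨x, hi, rfl⟩ hv
    obtain ⟨y, hy, ht⟩ := hstep x s' hf hb hi hv
    refine TriT.mono ht fun T s'' _ _ h => ⟨_, ?_, y, h.2, rfl⟩
    have := Nat.mul_le_mul_right (c + e.cost + 1) (Nat.succ_le_of_lt hy)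
    rw [Nat.succ_mul] at this
    have := h.1
    omega
  · rintro r s' hf hb ⟨x, hi, -⟩ hv
    exact hexit x s' hf hb hi hv
  · rw [Nat.succ_mul] at hB; omega

/-- `for x := 0, …, N - 1 do p`, where `x` and `N` are registers. -/
def Prog.for (x N : ℕ) (p : Prog) : Prog :=
  .seq (.set x (.const 0))
    (.loop (.lt (.reg x) (.reg N)) (.seq p (.set x (.add (.reg x) (.const 1)))))

theorem Tri.for {M B : ℕ} {x N : ℕ} {p : Prog} {s : State} {Q : State → Prop}
    (Inv : ℕ → State → Prop) (c : ℕ) (hx : p.wr x = false) (hN : p.wr N = false)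
    (hxN : N ≠ x) (h0 : Inv 0 (s.setReg x 0))
    (hstep : ∀ i s', Frame (.for x N p) s s' → Bdd M s' → i < s.reg N → s'.reg x = i →
      Inv i s' → Tri M p s' c fun s'' => Frame p s' s'' → Inv (i + 1) (s''.setReg x (i + 1)))
    (hQ : ∀ s', Frame (.for x N p) s s' → Bdd M s' → Inv (s.reg N) s' → Q s')
    (hB : (s.reg N + 1) * (c + 8) + 2 ≤ B) : Tri M (.for x N p) s B Q := by
  have hfr : ∀ s', Frame (.seq p (.set x (.add (.reg x) (.const 1)))) (s.setReg x 0) s' →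
      Frame (.for x N p) s s' := by
    refine fun s' hf => ⟨fun y hy => ?_, fun a ha => ?_⟩
    · simp only [Prog.for, Prog.wr, Bool.or_eq_false_iff, decide_eq_false_iff_not] at hy
      rw [hf.reg y (by simpa [Prog.wr] using hy.2)]
      simp [hy.1]
    · simp only [Prog.for, Prog.wa, Bool.or_eq_false_iff] at ha
      rw [hf.arr a (by simpa [Prog.wa] using ha.2)]
      simp
  have hNf : ∀ s', Frame (.for x N p) s s' → s'.reg N = s.reg N := fun s' hf =>
    hf.reg N (by simp [Prog.for, Prog.wr, hN, hxN])
  refine Tri.seq 2 ((s.reg N + 1) * (c + 8)) ?_ (by omega)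
  refine Tri.straight rfl le_rfl fun _ => ⟨Nat.zero_le _, fun _ _ => ?_⟩
  refine Tri.loop (fun s' => s'.reg x ≤ s.reg N ∧ Inv (s'.reg x) s')
    (fun s' => s.reg N - s'.reg x) (c + 4) (by simp [Expr.wt]) ⟨by simp [Prog.exec, Expr.val],
      by simpa [Prog.exec, Expr.val] using h0⟩ ?_ ?_ ?_
  · rintro s' hf hb ⟨hi, hI⟩ hv
    have hf' := hfr s' hf
    have hlt : s'.reg x < s.reg N := by
      by_contra h
      simp [Expr.val, hNf s' hf'] at hv
      exact h hv
    refine Tri.seq c 4 (Tri.mono (hstep _ s' hf' hb hlt rfl hI) le_rfl ?_) le_rfl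
    intro s₁ hb₁ hf₁ hQ₁ _ _
    have hx₁ := hf₁.reg x hx
    refine Tri.straight rfl le_rfl fun _ => ⟨?_, ⟨?_, ?_⟩, ?_⟩
    · simp only [Prog.Safe, Expr.val, hx₁]
      have := hb₁.reg N
      rw [hf₁.reg N hN, hNf s' hf'] at this
      omega
    · simp only [Prog.exec, Expr.val, hx₁, State.setReg_reg, if_pos]
      omega
    · simpa [Prog.exec, Expr.val, hx₁] using hQ₁ hf₁
    · simp only [Prog.exec, Expr.val, hx₁, State.setReg_reg, if_pos]
      omega
  · rintro s' hf hb ⟨hi, hI⟩ hv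
    have hf' := hfr s' hf
    have : s'.reg x = s.reg N := by
      simp [Expr.val, hNf s' hf'] at hv
      omega
    exact hQ s' hf' hb (this ▸ hI)
  · simp [Prog.exec, Expr.val, Expr.cost]

/-- The rule for loops that fill the cells `o, …, o + N - 1` of array `a` with the values of `f`. -/
theorem Tri.fill {M B : ℕ} {x N a : ℕ} {ix e : Expr} {s : State} (o : ℕ) (f : ℕ → ℕ)
    (hxN : N ≠ x) (hix : ix.wt ≤ 16) (he : e.wt ≤ 16)
    (hval : ∀ i s', Frame (.for x N (.put a ix e)) s s' → Bdd M s' → i < s.reg N → s'.reg x = i →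
      ix.val s' = o + i ∧ e.val s' = f i) (hfM : Bdd M s → ∀ i < s.reg N, f i ≤ M)
    (hB : (s.reg N + 1) * (ix.cost + e.cost + 9) + 2 ≤ B) :
    Tri M (.for x N (.put a ix e)) s B fun s' => (∀ i < s.reg N, s'.arr a (o + i) = f i) ∧
      ∀ j, (j < o ∨ o + s.reg N ≤ j) → s'.arr a j = s.arr a j := by
  refine Tri.of_bdd fun hb0 => ?_
  refine Tri.for (fun n s' => (∀ i < n, s'.arr a (o + i) = f i) ∧
    ∀ j, (j < o ∨ o + n ≤ j) → s'.arr a j = s.arr a j) (ix.cost + e.cost + 1) rfl rfl hxN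
    (by simp) ?_ (fun s' _ _ h => h) hB
  rintro i s' hf hb hi hx ⟨h1, h2⟩
  obtain ⟨e1, e2⟩ := hval i s' hf hb hi hx
  refine Tri.straight (by simp [Prog.straight, hix, he]) le_rfl fun _ => ?_
  simp only [Prog.Safe, Prog.exec, e1, e2, State.setReg_arr, State.setArr_arr, if_pos]
  refine ⟨hfM hb0 i hi, fun _ => ⟨fun j hj => ?_, fun j hj => ?_⟩⟩
  · rcases Nat.lt_succ_iff_lt_or_eq.1 hj with hj | rfl
    · rw [Function.update_of_ne (by omega)]; exact h1 j hj
    · simp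
  · rw [Function.update_of_ne (by omega)]; exact h2 j (by omega)

end WordRAM

/-! ### Depth-first search -/

/-- A digraph on `0, …, n - 1` with arcs `1, …, H`, in adjacency-list form: `first v` is the last
arc that starts in `v`, and `nxt h` is the last arc before `h` with the same start as `h` (`0` if
there is none). -/
structure AdjGraph where
  n : ℕ
  H : ℕ
  src : ℕ → ℕ
  tgt : ℕ → ℕ
  first : ℕ → ℕ
  nxt : ℕ → ℕ
  src_lt : ∀ h, 1 ≤ h → h ≤ H → src h < n
  tgt_lt : ∀ h, 1 ≤ h → h ≤ H → tgt h < n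
  first_le : ∀ v, v < n → first v ≤ H
  src_first : ∀ v, v < n → first v ≠ 0 → src (first v) = v
  first_max : ∀ v, v < n → ∀ r, first v < r → r ≤ H → src r ≠ v
  nxt_lt : ∀ h, 1 ≤ h → h ≤ H → nxt h < h
  src_nxt : ∀ h, 1 ≤ h → h ≤ H → nxt h ≠ 0 → src (nxt h) = src h
  nxt_max : ∀ h, 1 ≤ h → h ≤ H → ∀ r, nxt h < r → r < h → src r ≠ src h

/-- `h` is an arc with nonzero capacity. -/
def AdjGraph.Live (G : AdjGraph) (cap : ℕ → ℕ) (h : ℕ) : Prop := 1 ≤ h ∧ h ≤ G.H ∧ cap h ≠ 0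

/-- There is an arc of nonzero capacity from `v` to `w`, and `w` is not blocked by `blk`. -/
def AdjGraph.Step (G : AdjGraph) (cap blk : ℕ → ℕ) (v w : ℕ) : Prop :=
  (∃ h, G.Live cap h ∧ G.src h = v ∧ G.tgt h = w) ∧ blk w = 0

/-- `w` can be reached from `v` along arcs of nonzero capacity and through vertices that are not
blocked. -/
def AdjGraph.Conn (G : AdjGraph) (cap blk : ℕ → ℕ) (v w : ℕ) : Prop :=
  Relation.ReflTransGen (G.Step cap blk) v w

/-- The data of a depth-first search: labels of the visited vertices, arcs along which the vertices
were visited, next arcs to be explored, the stack, the list of the finished vertices, the sizes of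
the stack and of the list, and the number of roots used up. -/
structure DfsState where
  vis : ℕ → ℕ
  par : ℕ → ℕ
  cur : ℕ → ℕ
  stk : ℕ → ℕ
  ord : ℕ → ℕ
  sp : ℕ
  cnt : ℕ
  i : ℕ

/-- The invariant of a depth-first search from the roots `rt 0, …, rt (nr - 1)` in the subgraph of
the vertices that are not blocked by `blk`. Vertices visited from `rt j` get the label
`lb + j + 1`. Arcs are explored in decreasing order: `cur v` is the largest arc that starts in `v`
and is unexplored. The parent arcs (`par_stk`, `par_ord`) yield augmenting paths. For Kosaraju's
algorithm, `nest` says that what was finished while a vertex `v` is on the stack is reachable from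
`v`, and that what was finished before leads only to finished vertices and to the stack below `v`;
and `last` says that a path whose end is its last finished vertex can be traced back: its end reaches
its start. -/
structure DfsInv (G : AdjGraph) (cap blk rt : ℕ → ℕ) (nr lb : ℕ) (s : DfsState) : Prop where
  i_le : s.i ≤ nr
  old : ∀ v, blk v ≠ 0 → s.vis v = blk v
  new_iff : ∀ v, v < G.n → blk v = 0 →
    (s.vis v ≠ 0 ↔ (∃ j < s.sp, s.stk j = v) ∨ ∃ j < s.cnt, s.ord j = v)
  stk_lt : ∀ j < s.sp, s.stk j < G.n ∧ blk (s.stk j) = 0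
  ord_lt : ∀ j < s.cnt, s.ord j < G.n ∧ blk (s.ord j) = 0
  stk_inj : ∀ j < s.sp, ∀ k < s.sp, s.stk j = s.stk k → j = k
  ord_inj : ∀ j < s.cnt, ∀ k < s.cnt, s.ord j = s.ord k → j = k
  disj : ∀ j < s.sp, ∀ k < s.cnt, s.stk j ≠ s.ord k
  stk_lab : ∀ j < s.sp, s.vis (s.stk j) = lb + s.i ∧ 0 < s.i
  lab : ∀ v, v < G.n → blk v = 0 → s.vis v ≠ 0 → ∃ j < s.i, s.vis v = lb + j + 1 ∧
    blk (rt j) = 0 ∧ G.Conn cap blk (rt j) v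
  root : ∀ j < s.i, s.vis (rt j) ≠ 0 ∧ (blk (rt j) = 0 → s.vis (rt j) ≤ lb + j + 1)
  cur_src : ∀ v, v < G.n → blk v = 0 → s.vis v ≠ 0 →
    s.cur v ≤ G.H ∧ (s.cur v ≠ 0 → G.src (s.cur v) = v)
  cur_max : ∀ v, v < G.n → blk v = 0 → s.vis v ≠ 0 → ∀ r, s.cur v < r → G.Live cap r →
    G.src r = v → s.vis (G.tgt r) ≠ 0 ∧ (blk (G.tgt r) = 0 → s.vis (G.tgt r) ≤ s.vis v)
  done : ∀ j < s.cnt, s.cur (s.ord j) = 0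
  par_zero : 0 < s.sp → s.par (s.stk 0) = 0 ∧ s.stk 0 = rt (s.i - 1)
  par_stk : ∀ j, j + 1 < s.sp → G.Live cap (s.par (s.stk (j + 1))) ∧
    G.tgt (s.par (s.stk (j + 1))) = s.stk (j + 1) ∧ G.src (s.par (s.stk (j + 1))) = s.stk j
  par_ord : ∀ j < s.cnt, (s.par (s.ord j) = 0 ∧ ∃ k < s.i, s.ord j = rt k) ∨
    (G.Live cap (s.par (s.ord j)) ∧ G.tgt (s.par (s.ord j)) = s.ord j ∧
      ((∃ k < s.cnt, j < k ∧ G.src (s.par (s.ord j)) = s.ord k) ∨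
        ∃ k < s.sp, G.src (s.par (s.ord j)) = s.stk k))
  nest : ∃ b : ℕ → ℕ, ∀ p < s.sp, b p ≤ s.cnt ∧
    (∀ k < b p, ∀ w, G.Step cap blk (s.ord k) w →
      (∃ j < b p, s.ord j = w) ∨ ∃ j < p, s.stk j = w) ∧
    (∀ k, b p ≤ k → k < s.cnt → G.Conn cap blk (s.stk p) (s.ord k))
  last : ∀ k < s.cnt, ∀ j ≤ k,
    Relation.ReflTransGen (fun v w => G.Step cap blk v w ∧ ∃ l ≤ k, s.ord l = w)
      (s.ord j) (s.ord k) → G.Conn cap blk (s.ord k) (s.ord j)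

namespace DfsInv

variable {G : AdjGraph} {cap blk rt : ℕ → ℕ} {nr lb : ℕ} {s : DfsState}

theorem start {s : DfsState} (hv : s.vis = blk) (hsp : s.sp = 0) (hcnt : s.cnt = 0)
    (hi : s.i = 0) : DfsInv G cap blk rt nr lb s := by
  subst hv
  constructor <;> simp +contextual [hsp, hcnt, hi]

theorem skip_root (h : DfsInv G cap blk rt nr lb s) (hrt : ∀ j < nr, rt j < G.n)
    (hsp : s.sp = 0) (hi : s.i < nr) (hr : s.vis (rt s.i) ≠ 0) :
    DfsInv G cap blk rt nr lb { s with i := s.i + 1 } where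
  i_le := hi
  old := h.old
  new_iff := h.new_iff
  stk_lt := h.stk_lt
  ord_lt := h.ord_lt
  stk_inj := h.stk_inj
  ord_inj := h.ord_inj
  disj := h.disj
  stk_lab := by simp [hsp]
  lab v hv hb hvis := by
    obtain ⟨j, hj, e⟩ := h.lab v hv hb hvis
    exact ⟨j, Nat.lt_succ_of_lt hj, e⟩
  root j hj := by
    rcases Nat.lt_succ_iff_lt_or_eq.1 hj with hj | rfl
    · exact h.root j hj
    · refine ⟨hr, fun hb => ?_⟩
      obtain ⟨k, hk, e, -⟩ := h.lab _ (hrt _ hi) hb hr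
      simp only; omega
  cur_src := h.cur_src
  cur_max := h.cur_max
  done := h.done
  par_zero := by simp [hsp]
  par_stk := h.par_stk
  par_ord j hj := by
    rcases h.par_ord j hj with ⟨h1, k, hk, e⟩ | h1
    · exact .inl ⟨h1, k, Nat.lt_succ_of_lt hk, e⟩
    · exact .inr h1
  nest := h.nest
  last := h.last

theorem push_root (h : DfsInv G cap blk rt nr lb s) (hrt : ∀ j < nr, rt j < G.n)
    (hsp : s.sp = 0) (hi : s.i < nr) (hr : s.vis (rt s.i) = 0) :
    DfsInv G cap blk rt nr lb
      { vis := Function.update s.vis (rt s.i) (lb + s.i + 1)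
        par := Function.update s.par (rt s.i) 0
        cur := Function.update s.cur (rt s.i) (G.first (rt s.i))
        stk := Function.update s.stk 0 (rt s.i)
        ord := s.ord
        sp := 1
        cnt := s.cnt
        i := s.i + 1 } := by
  have hn := hrt _ hi
  have hblk : blk (rt s.i) = 0 := by
    by_contra hb
    exact hb (h.old _ hb ▸ hr)
  have hord : ∀ j < s.cnt, s.ord j ≠ rt s.i := fun j hj e =>
    (h.new_iff _ hn hblk).2 (.inr ⟨j, hj, e⟩) hr
  have hlab : ∀ v, v < G.n → blk v = 0 → s.vis v ≠ 0 → s.vis v ≤ lb + s.i := by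
    intro v hv hb hvis
    obtain ⟨k, hk, e, -⟩ := h.lab _ hv hb hvis
    omega
  refine ⟨hi, ?_, ?_, ?_, h.ord_lt, ?_, h.ord_inj, ?_, ?_, ?_, ?_, ?_, ?_, ?_, ?_, ?_, ?_, ?_,
    h.last⟩ <;> simp only
  · intro v hv
    rw [Function.update_of_ne (by rintro rfl; exact hv hblk)]
    exact h.old v hv
  · intro v hv hb
    have := h.new_iff v hv hb
    rcases eq_or_ne v (rt s.i) with rfl | hne
    · simp
    · simp only [Function.update_of_ne hne, this, hsp, Nat.lt_one_iff]
      simp [hne.symm]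
  · intro j hj
    simp [Nat.lt_one_iff.1 hj, hn, hblk]
  · omega
  · intro j hj k hk
    obtain rfl := Nat.lt_one_iff.1 hj
    simpa using (hord k hk).symm
  · intro j hj
    obtain rfl := Nat.lt_one_iff.1 hj
    simp [add_assoc]
  · intro v hv hb hvis
    rcases eq_or_ne v (rt s.i) with rfl | hne
    · exact ⟨s.i, Nat.lt_succ_self _, by simp, hblk, .refl⟩
    · rw [Function.update_of_ne hne] at hvis ⊢
      obtain ⟨j, hj, e⟩ := h.lab v hv hb hvis
      exact ⟨j, Nat.lt_succ_of_lt hj, e⟩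
  · intro j hj
    rcases Nat.lt_succ_iff_lt_or_eq.1 hj with hj | rfl
    · have := h.root j hj
      rwa [Function.update_of_ne (by intro e; exact this.1 (e ▸ hr))]
    · simp
  · intro v hv hb hvis
    rcases eq_or_ne v (rt s.i) with rfl | hne
    · simpa using ⟨G.first_le _ hn, G.src_first _ hn⟩
    · rw [Function.update_of_ne hne] at hvis ⊢
      exact h.cur_src v hv hb hvis
  · intro v hv hb hvis r hr1 hr2 hr3
    rcases eq_or_ne v (rt s.i) with rfl | hne
    · rw [Function.update_self] at hr1
      exact absurd hr3 (G.first_max _ hn r hr1 hr2.2.1)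
    · rw [Function.update_of_ne hne] at hvis hr1 ⊢
      have := h.cur_max v hv hb hvis r hr1 hr2 hr3
      rwa [Function.update_of_ne (by intro e; exact this.1 (e ▸ hr))]
  · intro j hj
    rw [Function.update_of_ne (hord j hj)]
    exact h.done j hj
  · simp
  · omega
  · intro j hj
    rw [Function.update_of_ne (hord j hj)]
    rcases h.par_ord j hj with ⟨h1, k, hk, e⟩ | ⟨h1, h2, h3⟩
    · exact .inl ⟨h1, k, Nat.lt_succ_of_lt hk, e⟩
    · refine .inr ⟨h1, h2, .inl (h3.resolve_right ?_)⟩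
      simp [hsp]
  · refine ⟨fun _ => s.cnt, fun p hp => ⟨le_rfl, fun k hk w hw => .inl ?_, fun k h1 h2 => absurd h2 (by simpa using h1)⟩⟩
    obtain ⟨⟨r, hr1, hr2, rfl⟩, hw⟩ := hw
    have hk' := h.ord_lt k hk
    have := (h.cur_max (s.ord k) hk'.1 hk'.2 ((h.new_iff _ hk'.1 hk'.2).2 (.inr ⟨k, hk, rfl⟩)) r
      (by rw [h.done k hk]; exact hr1.1) hr1 hr2).1
    have := (h.new_iff _ (G.tgt_lt _ hr1.1 hr1.2.1) hw).1 this
    simpa [hsp] using this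

theorem advance_aux (h : DfsInv G cap blk rt nr lb s) (hsp : 0 < s.sp)
    (hc : s.cur (s.stk (s.sp - 1)) ≠ 0)
    (hseen : cap (s.cur (s.stk (s.sp - 1))) ≠ 0 →
      s.vis (G.tgt (s.cur (s.stk (s.sp - 1)))) ≠ 0) :
    DfsInv G cap blk rt nr lb { s with
      cur := Function.update s.cur (s.stk (s.sp - 1)) (G.nxt (s.cur (s.stk (s.sp - 1)))) } := by
  set v := s.stk (s.sp - 1) with hv
  have hvn := h.stk_lt (s.sp - 1) (by omega)
  rw [← hv] at hvn
  have hvis : s.vis v ≠ 0 := (h.new_iff v hvn.1 hvn.2).2 (.inl ⟨_, by omega, hv.symm⟩)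
  have hcs := h.cur_src v hvn.1 hvn.2 hvis
  have hc1 : 1 ≤ s.cur v := Nat.one_le_iff_ne_zero.2 hc
  have hord : ∀ j < s.cnt, s.ord j ≠ v := fun j hj e =>
    h.disj (s.sp - 1) (by omega) j hj (hv.symm.trans e.symm)
  refine ⟨h.i_le, h.old, h.new_iff, h.stk_lt, h.ord_lt, h.stk_inj, h.ord_inj, h.disj, h.stk_lab,
    h.lab, h.root, ?_, ?_, ?_, h.par_zero, h.par_stk, h.par_ord, h.nest, h.last⟩ <;> simp only
  · intro w hw hb hwv
    rcases eq_or_ne w v with rfl | hne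
    · have := G.nxt_lt _ hc1 hcs.1
      simp only [Function.update_self]
      exact ⟨by omega, fun h' => (G.src_nxt _ hc1 hcs.1 h').trans (hcs.2 hc)⟩
    · rw [Function.update_of_ne hne]
      exact h.cur_src w hw hb hwv
  · intro w hw hb hwv r hr1 hr2 hr3
    rcases eq_or_ne w v with rfl | hne
    · rw [Function.update_self] at hr1
      rcases lt_trichotomy r (s.cur v) with hlt | rfl | hgt
      · exact absurd (hr3.trans (hcs.2 hc).symm) (G.nxt_max _ hc1 hcs.1 r hr1 hlt)
      · have h2 := hseen hr2.2.2
        refine ⟨h2, fun h3 => ?_⟩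
        obtain ⟨j, hj, e, -⟩ := h.lab _ (G.tgt_lt _ hr2.1 hr2.2.1) h3 h2
        have := (h.stk_lab (s.sp - 1) (by omega)).1
        rw [← hv] at this
        omega
      · exact h.cur_max v hw hb hwv r hgt hr2 hr3
    · rw [Function.update_of_ne hne] at hr1
      exact h.cur_max w hw hb hwv r hr1 hr2 hr3
  · intro j hj
    rw [Function.update_of_ne (hord j hj)]
    exact h.done j hj

theorem push (h : DfsInv G cap blk rt nr lb s) (hsp : 0 < s.sp)
    (hc : s.cur (s.stk (s.sp - 1)) ≠ 0) {h₀ w : ℕ} (hh : s.cur (s.stk (s.sp - 1)) = h₀)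
    (hcap : cap h₀ ≠ 0) (hw : G.tgt h₀ = w) (hseen : s.vis w = 0) :
    DfsInv G cap blk rt nr lb
      { vis := Function.update s.vis w (lb + s.i)
        par := Function.update s.par w h₀
        cur := Function.update (Function.update s.cur (s.stk (s.sp - 1)) (G.nxt h₀)) w (G.first w)
        stk := Function.update s.stk s.sp w
        ord := s.ord
        sp := s.sp + 1
        cnt := s.cnt
        i := s.i } := by
  set v := s.stk (s.sp - 1) with hv
  have hvn := h.stk_lt (s.sp - 1) (by omega)
  rw [← hv] at hvn
  have hvis : s.vis v ≠ 0 := (h.new_iff v hvn.1 hvn.2).2 (.inl ⟨_, by omega, hv.symm⟩)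
  have hcs := h.cur_src v hvn.1 hvn.2 hvis
  have hc1 : 1 ≤ s.cur v := Nat.one_le_iff_ne_zero.2 hc
  have hlive : G.Live cap h₀ := ⟨by omega, by omega, hcap⟩
  have hsrc : G.src h₀ = v := by rw [← hh]; exact hcs.2 hc
  have hwn : w < G.n := hw ▸ G.tgt_lt _ hlive.1 hlive.2.1
  have hwb : blk w = 0 := by
    by_contra hb
    exact hb (h.old _ hb ▸ hseen)
  have hwv : w ≠ v := by rintro e; exact hvis (e ▸ hseen)
  have hord : ∀ j < s.cnt, s.ord j ≠ w := fun j hj e =>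
    (h.new_iff _ hwn hwb).2 (.inr ⟨j, hj, e⟩) hseen
  have hstk : ∀ j < s.sp, s.stk j ≠ w := fun j hj e =>
    (h.new_iff _ hwn hwb).2 (.inl ⟨j, hj, e⟩) hseen
  have hordv : ∀ j < s.cnt, s.ord j ≠ v := fun j hj e =>
    h.disj (s.sp - 1) (by omega) j hj (hv.symm.trans e.symm)
  have hstep : G.Step cap blk v w := ⟨⟨h₀, hlive, hsrc, hw⟩, hwb⟩
  have hlabv : s.vis v = lb + s.i ∧ 0 < s.i := h.stk_lab (s.sp - 1) (by omega)
  have hstk' : ∀ j < s.sp, Function.update s.stk s.sp w j = s.stk j := fun j hj =>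
    Function.update_of_ne (by omega) _ _
  refine ⟨h.i_le, ?_, ?_, ?_, h.ord_lt, ?_, h.ord_inj, ?_, ?_, ?_, ?_, ?_, ?_, ?_, ?_, ?_, ?_, ?_,
    h.last⟩ <;> simp only
  · intro u hu
    rw [Function.update_of_ne (by rintro rfl; exact hu hwb)]
    exact h.old u hu
  · intro u hu hb
    have := h.new_iff u hu hb
    rcases eq_or_ne u w with rfl | hne
    · simp only [Function.update_self]
      refine iff_of_true (by omega) (.inl ⟨s.sp, by omega, by simp⟩)
    · rw [Function.update_of_ne hne, this]
      refine or_congr_left ⟨fun ⟨j, hj, e⟩ => ⟨j, by omega, (hstk' j hj).trans e⟩, ?_⟩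
      rintro ⟨j, hj, e⟩
      rcases Nat.lt_succ_iff_lt_or_eq.1 hj with hj | rfl
      · exact ⟨j, hj, (hstk' j hj).symm.trans e⟩
      · simp at e; exact absurd e.symm hne
  · intro j hj
    rcases Nat.lt_succ_iff_lt_or_eq.1 hj with hj | rfl
    · rw [hstk' j hj]; exact h.stk_lt j hj
    · simpa using ⟨hwn, hwb⟩
  · intro j hj k hk e
    rcases Nat.lt_succ_iff_lt_or_eq.1 hj with hj | rfl <;>
      rcases Nat.lt_succ_iff_lt_or_eq.1 hk with hk | rfl
    · rw [hstk' j hj, hstk' k hk] at e; exact h.stk_inj j hj k hk e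
    · rw [hstk' j hj, Function.update_self] at e; exact absurd e (hstk j hj)
    · rw [hstk' k hk, Function.update_self] at e; exact absurd e.symm (hstk k hk)
    · rfl
  · intro j hj k hk
    rcases Nat.lt_succ_iff_lt_or_eq.1 hj with hj | rfl
    · rw [hstk' j hj]; exact h.disj j hj k hk
    · rw [Function.update_self]; exact (hord k hk).symm
  · intro j hj
    refine ⟨?_, hlabv.2⟩
    rcases Nat.lt_succ_iff_lt_or_eq.1 hj with hj | rfl
    · rw [hstk' j hj, Function.update_of_ne (hstk j hj)]; exact (h.stk_lab j hj).1
    · simp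
  · intro u hu hb huv
    rcases eq_or_ne u w with rfl | hne
    · obtain ⟨j, hj, e, e1, e2⟩ := h.lab v hvn.1 hvn.2 hvis
      refine ⟨j, hj, ?_, e1, e2.tail hstep⟩
      simp only [Function.update_self]; omega
    · rw [Function.update_of_ne hne] at huv ⊢
      exact h.lab u hu hb huv
  · intro j hj
    have := h.root j hj
    rwa [Function.update_of_ne (by intro e; exact this.1 (e ▸ hseen))]
  · intro u hu hb huv
    rcases eq_or_ne u w with rfl | hne
    · simpa using ⟨G.first_le _ hwn, G.src_first _ hwn⟩
    · rw [Function.update_of_ne hne] at huv ⊢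
      rcases eq_or_ne u v with rfl | hne'
      · have := G.nxt_lt _ hc1 hcs.1
        simp only [Function.update_self, ← hh]
        exact ⟨by omega, fun h' => (G.src_nxt _ hc1 hcs.1 h').trans (hcs.2 hc)⟩
      · rw [Function.update_of_ne hne']
        exact h.cur_src u hu hb huv
  · intro u hu hb huv r hr1 hr2 hr3
    rcases eq_or_ne u w with rfl | hne
    · rw [Function.update_self] at hr1
      exact absurd hr3 (G.first_max _ hwn r hr1 hr2.2.1)
    · rw [Function.update_of_ne hne] at huv hr1 ⊢
      rcases eq_or_ne (G.tgt r) w with htw | htw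
      · rw [htw, Function.update_self]
        refine ⟨by omega, fun _ => ?_⟩
        rcases eq_or_ne u v with rfl | hne'
        · exact hlabv.1.ge
        · rw [Function.update_of_ne hne'] at hr1
          exact absurd (htw ▸ hseen) (h.cur_max u hu hb huv r hr1 hr2 hr3).1
      · rw [Function.update_of_ne htw]
        rcases eq_or_ne u v with rfl | hne'
        · rw [Function.update_self, ← hh] at hr1
          rcases lt_trichotomy r (s.cur v) with hlt | rfl | hgt
          · exact absurd (hr3.trans (hcs.2 hc).symm) (G.nxt_max _ hc1 hcs.1 r hr1 hlt)
          · exact absurd (by rw [hh]; exact hw) htw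
          · exact h.cur_max v hu hb huv r hgt hr2 hr3
        · rw [Function.update_of_ne hne'] at hr1
          exact h.cur_max u hu hb huv r hr1 hr2 hr3
  · intro j hj
    rw [Function.update_of_ne (hord j hj), Function.update_of_ne (hordv j hj)]
    exact h.done j hj
  · intro _
    rw [hstk' 0 hsp, Function.update_of_ne (hstk 0 hsp)]
    exact h.par_zero hsp
  · intro j hj
    rw [hstk' j (by omega)]
    rcases Nat.lt_succ_iff_lt_or_eq.1 hj with hj | hj
    · rw [hstk' _ hj, Function.update_of_ne (hstk _ hj)]
      exact h.par_stk j hj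
    · rw [hj, Function.update_self, Function.update_self]
      exact ⟨hlive, hw, by rw [hsrc, hv, ← hj]; rfl⟩
  · intro j hj
    rw [Function.update_of_ne (hord j hj)]
    rcases h.par_ord j hj with h1 | ⟨h1, h2, h3⟩
    · exact .inl h1
    · refine .inr ⟨h1, h2, h3.imp_right ?_⟩
      rintro ⟨k, hk, e⟩
      exact ⟨k, by omega, by rw [hstk' k hk]; exact e⟩
  · obtain ⟨b, hb⟩ := h.nest
    refine ⟨Function.update b s.sp s.cnt, fun p hp => ?_⟩
    rcases Nat.lt_succ_iff_lt_or_eq.1 hp with hp | rfl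
    · rw [Function.update_of_ne (by omega), hstk' p hp]
      obtain ⟨h1, h2, h3⟩ := hb p hp
      refine ⟨h1, fun k hk u hu => ?_, h3⟩
      rcases h2 k hk u hu with h4 | ⟨j, hj, e⟩
      · exact .inl h4
      · exact .inr ⟨j, hj, by rw [hstk' j (by omega)]; exact e⟩
    · rw [Function.update_self]
      refine ⟨le_rfl, fun k hk u hu => ?_, fun k h1 h2 => by omega⟩
      obtain ⟨⟨r, hr1, hr2, rfl⟩, hub⟩ := hu
      have hk' := h.ord_lt k hk
      have := (h.cur_max (s.ord k) hk'.1 hk'.2 ((h.new_iff _ hk'.1 hk'.2).2 (.inr ⟨k, hk, rfl⟩)) r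
        (by rw [h.done k hk]; exact hr1.1) hr1 hr2).1
      rcases (h.new_iff _ (G.tgt_lt _ hr1.1 hr1.2.1) hub).1 this with ⟨j, hj, e⟩ | h4
      · exact .inr ⟨j, hj, by rw [hstk' j hj]; exact e⟩
      · exact .inl h4

theorem conn_stk (h : DfsInv G cap blk rt nr lb s) {j : ℕ} :
    ∀ {k : ℕ}, j ≤ k → k < s.sp → G.Conn cap blk (s.stk j) (s.stk k)
  | 0, hj, _ => by obtain rfl := Nat.le_zero.1 hj; exact .refl
  | k + 1, hj, hk => by
    rcases Nat.le_succ_iff.1 hj with hj | rfl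
    · have := h.par_stk k hk
      exact (h.conn_stk hj (by omega)).tail ⟨⟨_, this.1, this.2.2, this.2.1⟩, (h.stk_lt _ hk).2⟩
    · exact .refl

theorem pop (h : DfsInv G cap blk rt nr lb s) (hsp : 0 < s.sp)
    (hc : s.cur (s.stk (s.sp - 1)) = 0) :
    DfsInv G cap blk rt nr lb { s with
      ord := Function.update s.ord s.cnt (s.stk (s.sp - 1))
      sp := s.sp - 1
      cnt := s.cnt + 1 } := by
  have hlast := Nat.sub_lt hsp one_pos
  have hvn := h.stk_lt (s.sp - 1) hlast
  set v := s.stk (s.sp - 1) with hv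
  have hord' : ∀ j < s.cnt, Function.update s.ord s.cnt v j = s.ord j := fun j hj =>
    Function.update_of_ne (by omega) _ _
  refine ⟨h.i_le, h.old, ?_, fun j hj => h.stk_lt j (by simp only at hj; omega), ?_,
    fun j hj k hk => h.stk_inj j (by simp only at hj; omega) k (by simp only at hk; omega), ?_, ?_,
    fun j hj => h.stk_lab j (by simp only at hj; omega), h.lab, h.root, h.cur_src, h.cur_max, ?_,
    fun hs => h.par_zero hsp, fun j hj => h.par_stk j (by simp only at hj; omega), ?_, ?_, ?_⟩ <;>
    simp only
  · intro u hu hb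
    rw [h.new_iff u hu hb]
    constructor
    · rintro (⟨j, hj, e⟩ | ⟨j, hj, e⟩)
      · rcases eq_or_ne j (s.sp - 1) with rfl | hne
        · exact .inr ⟨s.cnt, by omega, by simpa using e⟩
        · exact .inl ⟨j, by omega, e⟩
      · exact .inr ⟨j, by omega, (hord' j hj).trans e⟩
    · rintro (⟨j, hj, e⟩ | ⟨j, hj, e⟩)
      · exact .inl ⟨j, by omega, e⟩
      · rcases Nat.lt_succ_iff_lt_or_eq.1 hj with hj | rfl
        · exact .inr ⟨j, hj, (hord' j hj).symm.trans e⟩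
        · exact .inl ⟨s.sp - 1, hlast, by simpa using e⟩
  · intro j hj
    rcases Nat.lt_succ_iff_lt_or_eq.1 hj with hj | rfl
    · rw [hord' j hj]; exact h.ord_lt j hj
    · simpa using hvn
  · intro j hj k hk e
    rcases Nat.lt_succ_iff_lt_or_eq.1 hj with hj | rfl <;>
      rcases Nat.lt_succ_iff_lt_or_eq.1 hk with hk | rfl
    · rw [hord' j hj, hord' k hk] at e; exact h.ord_inj j hj k hk e
    · rw [hord' j hj, Function.update_self] at e; exact absurd e.symm (h.disj _ hlast j hj)
    · rw [hord' k hk, Function.update_self] at e; exact absurd e (h.disj _ hlast k hk)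
    · rfl
  · intro j hj k hk
    rcases Nat.lt_succ_iff_lt_or_eq.1 hk with hk | rfl
    · rw [hord' k hk]; exact h.disj j (by omega) k hk
    · rw [Function.update_self]
      intro e
      have := h.stk_inj j (by omega) _ hlast e
      omega
  · intro j hj
    rcases Nat.lt_succ_iff_lt_or_eq.1 hj with hj | rfl
    · rw [hord' j hj]; exact h.done j hj
    · simpa using hc
  · intro j hj
    rcases Nat.lt_succ_iff_lt_or_eq.1 hj with hj | rfl
    · rw [hord' j hj]
      rcases h.par_ord j hj with h1 | ⟨h1, h2, h3⟩
      · exact .inl h1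
      · refine .inr ⟨h1, h2, ?_⟩
        rcases h3 with ⟨k, hk, hjk, e⟩ | ⟨k, hk, e⟩
        · exact .inl ⟨k, by omega, hjk, by rw [hord' k hk]; exact e⟩
        · rcases eq_or_ne k (s.sp - 1) with rfl | hne
          · exact .inl ⟨s.cnt, by omega, hj, by rw [Function.update_self]; exact e⟩
          · exact .inr ⟨k, by omega, e⟩
    · rw [Function.update_self]
      rcases Nat.eq_zero_or_pos (s.sp - 1) with h0 | h0
      · have h1 := h.par_zero hsp
        have h2 := (h.stk_lab 0 hsp).2
        rw [hv, h0]
        exact .inl ⟨h1.1, s.i - 1, by omega, h1.2⟩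
      · have h1 := h.par_stk (s.sp - 2) (by omega)
        rw [show s.sp - 2 + 1 = s.sp - 1 by omega] at h1
        exact .inr ⟨h1.1, h1.2.1, .inr ⟨s.sp - 2, by omega, h1.2.2⟩⟩
  · obtain ⟨b, hb⟩ := h.nest
    refine ⟨b, fun p hp => ?_⟩
    obtain ⟨h1, h2, h3⟩ := hb p (by omega)
    refine ⟨by omega, fun k hk w hw => ?_, fun k hk1 hk2 => ?_⟩
    · rw [hord' k (by omega)] at hw
      refine (h2 k hk w hw).imp_left ?_
      rintro ⟨j, hj, e⟩
      exact ⟨j, hj, by rw [hord' j (by omega)]; exact e⟩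
    · rcases Nat.lt_succ_iff_lt_or_eq.1 hk2 with hk2 | rfl
      · rw [hord' k hk2]; exact h3 k hk1 hk2
      · rw [Function.update_self]
        exact h.conn_stk (by omega) hlast
  · intro k hk j hjk hpath
    rcases Nat.lt_succ_iff_lt_or_eq.1 hk with hk | rfl
    · rw [hord' k hk, hord' j (by omega)] at hpath ⊢
      refine h.last k hk j hjk (Relation.ReflTransGen.mono ?_ _ _ hpath)
      rintro x y ⟨h1, l, hl, e⟩
      exact ⟨h1, l, hl, (hord' l (by omega)).symm.trans e⟩
    · rw [Function.update_self] at hpath ⊢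
      rcases Nat.le_iff_lt_or_eq.1 hjk with hj | rfl
      · rw [hord' j hj] at hpath ⊢
        obtain ⟨b, hb⟩ := h.nest
        obtain ⟨h1, h2, h3⟩ := hb (s.sp - 1) hlast
        by_cases hjb : b (s.sp - 1) ≤ j
        · exact h3 j hjb hj
        · -- the vertices finished before `v` was visited cannot lead to `v` within the list
          have key : ∀ y, Relation.ReflTransGen (fun v' w => G.Step cap blk v' w ∧
              ∃ l ≤ s.cnt, Function.update s.ord s.cnt v l = w) (s.ord j) y →
              ∃ l < b (s.sp - 1), s.ord l = y := by
            intro y hy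
            induction hy with
            | refl => exact ⟨j, by omega, rfl⟩
            | tail _ hstep ih =>
              obtain ⟨l, hl, rfl⟩ := ih
              obtain ⟨hs, l', hl', e'⟩ := hstep
              refine (h2 l hl _ hs).resolve_right ?_
              rintro ⟨p, hp, e⟩
              rcases Nat.le_iff_lt_or_eq.1 hl' with hl' | rfl
              · rw [hord' l' hl'] at e'
                exact h.disj p (by omega) l' hl' (e.trans e'.symm)
              · rw [Function.update_self] at e'
                have := h.stk_inj p (by omega) _ hlast (e.trans e'.symm)
                omega
          obtain ⟨l, hl, e⟩ := key v hpath
          exact absurd e.symm (h.disj _ hlast l (by omega))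
      · rw [Function.update_self]; exact .refl

end DfsInv

/-- The number of steps that are still ahead of a depth-first search, up to a constant factor:
unexplored arcs, unvisited vertices, vertices on the stack, and unused roots. -/
def DfsState.work (G : AdjGraph) (nr : ℕ) (s : DfsState) : ℕ :=
  ((Finset.Icc 1 G.H).filter fun r => s.vis (G.src r) = 0 ∨ r ≤ s.cur (G.src r)).card +
    ((Finset.range G.n).filter fun v => s.vis v = 0).card + s.sp + (nr - s.i)

theorem DfsState.work_le (G : AdjGraph) (nr : ℕ) (s : DfsState) :
    s.work G nr ≤ G.H + G.n + s.sp + nr := by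
  have h1 := (Finset.Icc 1 G.H).card_filter_le
    (fun r => s.vis (G.src r) = 0 ∨ r ≤ s.cur (G.src r))
  have h2 := (Finset.range G.n).card_filter_le (fun v => s.vis v = 0)
  simp only [Nat.card_Icc, Finset.card_range] at h1 h2
  unfold work
  omega

namespace DfsInv

variable {G : AdjGraph} {cap blk rt : ℕ → ℕ} {nr lb : ℕ} {s : DfsState}

theorem sp_le (h : DfsInv G cap blk rt nr lb s) : s.sp ≤ G.n := by
  simpa using Finset.card_le_card_of_injOn (s := Finset.range s.sp) (t := Finset.range G.n) s.stk
    (fun j hj => by simpa using (h.stk_lt j (by simpa using hj)).1)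
    (fun j hj k hk e => h.stk_inj j (by simpa using hj) k (by simpa using hk) e)

theorem cnt_le (h : DfsInv G cap blk rt nr lb s) : s.cnt ≤ G.n := by
  simpa using Finset.card_le_card_of_injOn (s := Finset.range s.cnt) (t := Finset.range G.n) s.ord
    (fun j hj => by simpa using (h.ord_lt j (by simpa using hj)).1)
    (fun j hj k hk e => h.ord_inj j (by simpa using hj) k (by simpa using hk) e)

theorem vis_top (h : DfsInv G cap blk rt nr lb s) (hsp : 0 < s.sp) :
    s.vis (s.stk (s.sp - 1)) ≠ 0 :=
  have hl := Nat.sub_lt hsp one_pos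
  (h.new_iff _ (h.stk_lt _ hl).1 (h.stk_lt _ hl).2).2 (.inl ⟨_, hl, rfl⟩)

/-- Visiting one more vertex does not increase the number of unexplored arcs. -/
theorem card_unexplored_visit (G : AdjGraph) {vis cur : ℕ → ℕ} {w l : ℕ} (hw : vis w = 0) :
    ((Finset.Icc 1 G.H).filter fun r => Function.update vis w l (G.src r) = 0 ∨
      r ≤ Function.update cur w (G.first w) (G.src r)).card ≤
    ((Finset.Icc 1 G.H).filter fun r => vis (G.src r) = 0 ∨ r ≤ cur (G.src r)).card := by
  refine Finset.card_le_card fun r hr => ?_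
  simp only [Finset.mem_filter] at hr ⊢
  refine ⟨hr.1, ?_⟩
  rcases eq_or_ne (G.src r) w with e | e
  · rw [e]; exact .inl hw
  · simpa [Function.update_of_ne e] using hr.2

theorem card_unvisited_visit {n : ℕ} {vis : ℕ → ℕ} {w l : ℕ} (hwn : w < n) (hw : vis w = 0)
    (hl : l ≠ 0) : ((Finset.range n).filter fun v => Function.update vis w l v = 0).card <
      ((Finset.range n).filter fun v => vis v = 0).card := by
  refine Finset.card_lt_card (Finset.ssubset_iff_of_subset (fun v hv => ?_) |>.2 ⟨w, ?_, ?_⟩)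
  · simp only [Finset.mem_filter] at hv ⊢
    refine ⟨hv.1, ?_⟩
    rcases eq_or_ne v w with e | e
    · rw [e]; exact hw
    · simpa [Function.update_of_ne e] using hv.2
  · simpa using ⟨hwn, hw⟩
  · simp [hl]

theorem card_unexplored_advance (h : DfsInv G cap blk rt nr lb s) (hsp : 0 < s.sp)
    (hc : s.cur (s.stk (s.sp - 1)) ≠ 0) :
    ((Finset.Icc 1 G.H).filter fun r => s.vis (G.src r) = 0 ∨
      r ≤ Function.update s.cur (s.stk (s.sp - 1)) (G.nxt (s.cur (s.stk (s.sp - 1))))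
        (G.src r)).card <
    ((Finset.Icc 1 G.H).filter fun r => s.vis (G.src r) = 0 ∨ r ≤ s.cur (G.src r)).card := by
  have hl := Nat.sub_lt hsp one_pos
  have hv := h.stk_lt _ hl
  have hvis := h.vis_top hsp
  have hcs := h.cur_src _ hv.1 hv.2 hvis
  set v := s.stk (s.sp - 1)
  have h1 : 1 ≤ s.cur v := Nat.one_le_iff_ne_zero.2 hc
  have hlt := G.nxt_lt _ h1 hcs.1
  refine Finset.card_lt_card (Finset.ssubset_iff_of_subset (fun r hr => ?_) |>.2 ⟨s.cur v, ?_, ?_⟩)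
  · simp only [Finset.mem_filter] at hr ⊢
    refine ⟨hr.1, hr.2.imp_right fun hr' => ?_⟩
    rcases eq_or_ne (G.src r) v with e | e
    · rw [e, Function.update_self] at hr'
      rw [e]; omega
    · rwa [Function.update_of_ne e] at hr'
  · simp only [Finset.mem_filter, Finset.mem_Icc]
    exact ⟨⟨h1, hcs.1⟩, .inr (by rw [hcs.2 hc])⟩
  · simp only [Finset.mem_filter, hcs.2 hc, Function.update_self]
    rintro ⟨-, h2 | h2⟩
    · exact hvis h2
    · omega

theorem work_skip_root {nr : ℕ} (hi : s.i < nr) :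
    ({ s with i := s.i + 1 } : DfsState).work G nr < s.work G nr := by
  unfold DfsState.work; simp only; omega

theorem work_push_root {nr r l : ℕ} (hsp : s.sp = 0) (hi : s.i < nr) (hn : r < G.n)
    (hr : s.vis r = 0) (hl : l ≠ 0) :
    ({ vis := Function.update s.vis r l
       par := Function.update s.par r 0
       cur := Function.update s.cur r (G.first r)
       stk := Function.update s.stk 0 r
       ord := s.ord
       sp := 1
       cnt := s.cnt
       i := s.i + 1 } : DfsState).work G nr < s.work G nr := by
  have h1 := card_unvisited_visit hn hr hl
  have h2 := card_unexplored_visit G (cur := s.cur) (l := l) hr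
  unfold DfsState.work; simp only; omega

theorem work_pop {nr : ℕ} {f : ℕ → ℕ} (hsp : 0 < s.sp) :
    ({ s with ord := f, sp := s.sp - 1, cnt := s.cnt + 1 } : DfsState).work G nr <
      s.work G nr := by
  unfold DfsState.work; simp only; omega

theorem work_advance (h : DfsInv G cap blk rt nr lb s) (hsp : 0 < s.sp)
    (hc : s.cur (s.stk (s.sp - 1)) ≠ 0) :
    ({ s with
        cur := Function.update s.cur (s.stk (s.sp - 1)) (G.nxt (s.cur (s.stk (s.sp - 1)))) } :
      DfsState).work G nr < s.work G nr := by
  have h1 := h.card_unexplored_advance hsp hc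
  unfold DfsState.work; simp only; omega

theorem work_push (h : DfsInv G cap blk rt nr lb s) (hsp : 0 < s.sp)
    (hc : s.cur (s.stk (s.sp - 1)) ≠ 0) {h₀ w : ℕ} (hh : s.cur (s.stk (s.sp - 1)) = h₀)
    (hw : w < G.n) (hseen : s.vis w = 0) :
    ({ vis := Function.update s.vis w (lb + s.i)
       par := Function.update s.par w h₀
       cur := Function.update (Function.update s.cur (s.stk (s.sp - 1)) (G.nxt h₀)) w (G.first w)
       stk := Function.update s.stk s.sp w
       ord := s.ord
       sp := s.sp + 1
       cnt := s.cnt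
       i := s.i } : DfsState).work G nr < s.work G nr := by
  have hl := h.stk_lab _ (Nat.sub_lt hsp one_pos)
  have h1 := card_unvisited_visit (l := lb + s.i) hw hseen (by omega)
  have h2 := card_unexplored_visit G (cur := Function.update s.cur (s.stk (s.sp - 1))
    (G.nxt h₀)) (l := lb + s.i) hseen
  have h3 := h.card_unexplored_advance hsp hc
  rw [hh] at h3
  unfold DfsState.work; simp only; omega

end DfsInv

/-! ### Depth-first search on the word RAM -/

/- Registers: the input, the answer, and the number of arcs in the adjacency lists. -/
notation "rN" => 0
notation "rM" => 1
notation "rD" => 2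
notation "rT" => 3
notation "rK" => 4
notation "rAns" => 5
notation "rH" => 6

/- Registers of the depth-first search: the sizes of the stack and of the list of the finished
vertices, the number of roots used up (`rI`, also the counter of outer loops), the number of roots, and the
current label. -/
notation "rSp" => 7
notation "rCnt" => 8
notation "rI" => 9
notation "rNr" => 10
notation "rLb" => 11

/- Registers for vertices, arcs, and the counter of the innermost loop. -/
notation "rV" => 12
notation "rE" => 13
notation "rW" => 14
notation "rX" => 15

/- Registers of the flow algorithm: the value of the flow, whether to go on, the end of an augmenting
path, whether the flow exceeds the budget, and the budget. -/
notation "rFlow" => 17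
notation "rGo" => 18
notation "rSink" => 19
notation "rFail" => 20
notation "rBud" => 21

/- Registers for the stack of the pending nodes: their number, and where the next one is stored. -/
notation "rNum" => 22
notation "rOffL" => 23
notation "rOffD" => 24

/- Registers of the branching rules: the arc of the first rule; and for the scan of the family, the
index of the first member of the current set, whether no member of it has been decided, whether there
is a set without a decided member, and where it starts (`rTmp`, which also serves to exchange cells). -/
notation "rArc" => 25
notation "rBase" => 26
notation "rBad" => 27
notation "rViol" => 28
notation "rTmp" => 29

/- Arrays: the input, and the deleted arcs, which are also the output. -/
notation "aSV" => 0
notation "aSA" => 1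
notation "aTl" => 2
notation "aHd" => 3
notation "aFam" => 4
notation "aDel" => 5

/- Arrays for the residual graph: adjacency lists, end vertices, and capacities (zero or nonzero). -/
notation "aFst" => 6
notation "aNxt" => 7
notation "aTgt" => 8
notation "aCap" => 9

/- Arrays of the depth-first search: labels, parent arcs, the stack, the list of the finished
vertices, the next arcs to be explored, and the roots. -/
notation "aVis" => 10
notation "aPar" => 11
notation "aStk" => 12
notation "aOrd" => 13
notation "aCur" => 14
notation "aRt" => 15

/- Arrays for the committed vertices, the start vertices of the arcs of the residual graph, their
opposite arcs, and the smallest minimum cut. -/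
notation "aL" => 16
notation "aSrc" => 17
notation "aMate" => 18
notation "aCore" => 19

/- Arrays for the pending nodes: committed vertices, deleted arcs, and budgets. -/
notation "aSvL" => 20
notation "aSvD" => 21
notation "aSvK" => 22


namespace WordRAM

infixr:60 " ;; " => Prog.seq

open WordRAM.Expr WordRAM.Prog

/-- One step of the depth-first search: explore an arc from the top of the stack, or move the top
of the stack to the list of the finished vertices, or take the next root. -/
def dfsStep : Prog :=
  cond (.reg rSp)
    (set rV (get aStk (sub (.reg rSp) (const 1))) ;;
      set rE (get aCur (.reg rV)) ;;
      cond (.reg rE)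
        (put aCur (.reg rV) (get aNxt (.reg rE)) ;;
          cond (get aCap (.reg rE))
            (set rW (get aTgt (.reg rE)) ;;
              cond (get aVis (.reg rW)) skip
                (put aVis (.reg rW) (.reg rLb) ;;
                  put aPar (.reg rW) (.reg rE) ;;
                  put aCur (.reg rW) (get aFst (.reg rW)) ;;
                  put aStk (.reg rSp) (.reg rW) ;;
                  set rSp (add (.reg rSp) (const 1))))
            skip)
        (put aOrd (.reg rCnt) (.reg rV) ;;
          set rCnt (add (.reg rCnt) (const 1)) ;;
          set rSp (sub (.reg rSp) (const 1))))
    (set rV (get aRt (.reg rI)) ;;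
      set rI (add (.reg rI) (const 1)) ;;
      set rLb (add (.reg rLb) (const 1)) ;;
      cond (get aVis (.reg rV)) skip
        (put aVis (.reg rV) (.reg rLb) ;;
          put aPar (.reg rV) (const 0) ;;
          put aCur (.reg rV) (get aFst (.reg rV)) ;;
          put aStk (const 0) (.reg rV) ;;
          set rSp (const 1)))

/-- Depth-first search from the first `rNr` vertices in `aRt`, among the vertices whose label in
`aVis` is zero. -/
def dfs : Prog :=
  (set rSp (const 0) ;; set rCnt (const 0) ;; set rI (const 0)) ;;
    loop (add (.reg rSp) (sub (.reg rNr) (.reg rI))) dfsStep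

/-- The depth-first search that the state of the machine represents. -/
def State.dfs (s : State) : DfsState :=
  ⟨s.arr aVis, s.arr aPar, s.arr aCur, s.arr aStk, s.arr aOrd, s.reg rSp, s.reg rCnt, s.reg rI⟩

/-- The arrays of the machine hold the adjacency lists of `G`. -/
structure Loaded (G : AdjGraph) (s : State) : Prop where
  first : s.arr aFst = G.first
  nxt : s.arr aNxt = G.nxt
  tgt : s.arr aTgt = G.tgt
  src : s.arr aSrc = G.src

theorem dfsStep_spec {M : ℕ} {G : AdjGraph} {cap blk rt : ℕ → ℕ} {nr lb : ℕ} {s : State}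
    (hM : G.n ≤ M) (hlb : lb + nr ≤ M) (hG : Loaded G s) (hcap : s.arr aCap = cap)
    (hrt : s.arr aRt = rt) (hrtn : ∀ j < nr, rt j < G.n) (hinv : DfsInv G cap blk rt nr lb s.dfs)
    (hlab : s.reg rLb = lb + s.reg rI) (hgo : s.reg rSp + (nr - s.reg rI) ≠ 0) :
    Tri M dfsStep s 60 fun s' => DfsInv G cap blk rt nr lb s'.dfs ∧
      s'.reg rLb = lb + s'.reg rI ∧ s'.dfs.work G nr < s.dfs.work G nr := by
  refine Tri.straight rfl (by decide) fun hb => ?_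
  have hi := hinv.i_le
  simp only [State.dfs] at hi
  have hG1 := hG.first
  have hG2 := hG.nxt
  have hG3 := hG.tgt
  have hN : ∀ x, G.nxt x ≤ M := fun x => hG2 ▸ hb.arr _ _
  have hF : ∀ x, G.first x ≤ M := fun x => hG1 ▸ hb.arr _ _
  have hT : ∀ x, G.tgt x ≤ M := fun x => hG3 ▸ hb.arr _ _
  have hR : ∀ x, rt x ≤ M := fun x => hrt ▸ hb.arr _ _
  by_cases hsp : s.reg rSp = 0
  · have hi' : s.reg rI < nr := by omega
    have hn := hrtn _ hi'
    by_cases hr : s.arr aVis (rt (s.reg rI)) = 0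
    · have := hinv.push_root hrtn hsp hi' hr
      have hw := DfsInv.work_push_root (s := s.dfs) (l := lb + s.reg rI + 1) hsp hi' hn hr (by omega)
      simp [dfsStep, exec, Safe, val, hsp, hr, hb.arr, hb.reg, hb.pos, State.dfs,
        hG1, hG2, hG3, hlab, hrt, hF, hR] at this hw ⊢
      exact ⟨by omega, this, by omega, hw⟩
    · have := hinv.skip_root hrtn hsp hi' hr
      have hw := DfsInv.work_skip_root (G := G) (s := s.dfs) hi'
      simp [dfsStep, exec, Safe, val, hsp, hr, hb.arr, hb.reg, hb.pos, State.dfs,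
        hG1, hG2, hG3, hlab, hrt, hR] at this hw ⊢
      exact ⟨by omega, this, by omega, hw⟩
  · have hsp' : 0 < s.dfs.sp := Nat.pos_of_ne_zero hsp
    have hspn := hinv.sp_le
    have hcntn := hinv.cnt_le
    by_cases hc : s.arr aCur (s.arr aStk (s.reg rSp - 1)) = 0
    · have := hinv.pop hsp' hc
      have hcnt := this.cnt_le
      have hw := DfsInv.work_pop (G := G) (nr := nr)
        (f := Function.update s.dfs.ord s.dfs.cnt (s.dfs.stk (s.dfs.sp - 1))) hsp'
      simp [dfsStep, exec, Safe, val, hsp, hc, hb.arr, hb.reg, hb.pos, State.dfs,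
        hG1, hG2, hG3, hlab, hrt] at this hspn hcntn hcnt hw ⊢
      exact ⟨⟨by omega, by omega⟩, this, hw⟩
    · by_cases hca : cap (s.arr aCur (s.arr aStk (s.reg rSp - 1))) = 0
      · have := hinv.advance_aux hsp' hc (fun h => absurd hca h)
        have hw := hinv.work_advance hsp' hc
        simp [dfsStep, exec, Safe, val, hsp, hc, hca, hb.arr, hb.reg, hb.pos, State.dfs,
          hG1, hG2, hG3, hlab, hrt, hcap, hN] at this hw ⊢
        exact ⟨this, hw⟩
      · by_cases hv : s.arr aVis (G.tgt (s.arr aCur (s.arr aStk (s.reg rSp - 1)))) = 0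
        · have := hinv.push hsp' hc rfl hca rfl hv
          have hspn' := this.sp_le
          have hl := Nat.sub_lt hsp' one_pos
          have hst := hinv.stk_lt _ hl
          have hcs := hinv.cur_src _ hst.1 hst.2 (hinv.vis_top hsp')
          have hw := hinv.work_push hsp' hc rfl (G.tgt_lt _ (Nat.one_le_iff_ne_zero.2 hc) hcs.1) hv
          simp [dfsStep, exec, Safe, val, hsp, hc, hca, hv, hb.arr, hb.reg, hb.pos, State.dfs,
            hG1, hG2, hG3, hlab, hrt, hcap, hN, hT, hF] at this hw hspn' ⊢
          exact ⟨⟨by omega, by omega⟩, this, hw⟩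
        · have := hinv.advance_aux hsp' hc (fun _ => hv)
          have hw := hinv.work_advance hsp' hc
          simp [dfsStep, exec, Safe, val, hsp, hc, hca, hv, hb.arr, hb.reg, hb.pos, State.dfs,
            hG1, hG2, hG3, hlab, hrt, hcap, hN, hT] at this hw ⊢
          exact ⟨this, hw⟩

theorem dfs_spec {M : ℕ} {G : AdjGraph} {cap blk rt : ℕ → ℕ} {nr lb : ℕ} {s : State}
    (hM : G.n ≤ M) (hlb : lb + nr ≤ M) (hG : Loaded G s) (hcap : s.arr aCap = cap)
    (hblk : s.arr aVis = blk) (hrt : s.arr aRt = rt) (hnr : s.reg rNr = nr)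
    (hrtn : ∀ j < nr, rt j < G.n) (hlab : s.reg rLb = lb) :
    Tri M dfs s (66 * (G.H + G.n + nr + 2)) fun s' =>
      DfsInv G cap blk rt nr lb s'.dfs ∧ s'.reg rSp = 0 ∧ s'.reg rI = nr := by
  refine Tri.seq 6 (66 * (G.H + G.n + nr + 1)) ?_ (by omega)
  refine Tri.straight rfl (by decide) fun hb => ⟨by simp [Safe, val], fun hf hb' => ?_⟩
  refine Tri.loop (fun s' => DfsInv G cap blk rt nr lb s'.dfs ∧ s'.reg rLb = lb + s'.reg rI)
    (fun s' => s'.dfs.work G nr) 60 (by decide) ⟨DfsInv.start hblk rfl rfl rfl, hlab⟩ ?_ ?_ ?_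
  · rintro s' hf' hb₁ ⟨h1, h2⟩ hv
    have hf₁ := hf'.reg rNr (by rfl)
    have hval : s'.reg rSp + (nr - s'.reg rI) ≠ 0 := by
      simp only [val] at hv
      rwa [hf₁, hf.reg rNr (by rfl), hnr] at hv
    have ha : ∀ a, dfsStep.wa a = false → s'.arr a = s.arr a := fun a h =>
      (hf'.arr a h).trans (hf.arr a (by simp [wa]))
    refine Tri.mono (dfsStep_spec hM hlb ?_ ((ha aCap rfl).trans hcap) ((ha aRt rfl).trans hrt) hrtn
      h1 h2 hval) le_rfl fun s'' _ _ h => ⟨⟨h.1, h.2.1⟩, h.2.2⟩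
    exact ⟨(ha _ rfl).trans hG.first, (ha _ rfl).trans hG.nxt, (ha _ rfl).trans hG.tgt,
      (ha _ rfl).trans hG.src⟩
  · rintro s' hf' hb₁ ⟨h1, h2⟩ hv
    simp only [val] at hv
    rw [hf'.reg rNr (by rfl), hf.reg rNr (by rfl), hnr] at hv
    have := h1.i_le
    simp only [State.dfs] at this
    exact ⟨h1, by omega, by omega⟩
  · have := DfsState.work_le G nr (exec (set rSp (const 0) ;; set rCnt (const 0) ;;
      set rI (const 0)) s).dfs
    have h0 : (exec (set rSp (const 0) ;; set rCnt (const 0) ;; set rI (const 0)) s).dfs.sp = 0 :=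
      rfl
    rw [h0] at this
    have h1 : 60 + cost (add (.reg rSp) (sub (.reg rNr) (.reg rI))) + 1 = 66 := rfl
    rw [h1, mul_comm]
    exact Nat.mul_le_mul_left _ (by simpa using this)

end WordRAM

/-! ### Consequences of a finished depth-first search -/

namespace AdjGraph

variable {G : AdjGraph} {cap blk : ℕ → ℕ}

theorem Step.lt {v w : ℕ} (h : G.Step cap blk v w) : v < G.n ∧ w < G.n := by
  obtain ⟨⟨a, ha, rfl, rfl⟩, -⟩ := h
  exact ⟨G.src_lt _ ha.1 ha.2.1, G.tgt_lt _ ha.1 ha.2.1⟩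

theorem Conn.unblocked {v w : ℕ} (h : G.Conn cap blk v w) (hv : blk v = 0) : blk w = 0 := by
  cases h with
  | refl => exact hv
  | tail _ h => exact h.2

theorem Conn.lt {v w : ℕ} (h : G.Conn cap blk v w) (hv : v < G.n) : w < G.n := by
  cases h with
  | refl => exact hv
  | tail _ h => exact h.lt.2

theorem Conn.reverse {cap' blk' : ℕ → ℕ} {v w : ℕ}
    (hrev : ∀ v w, blk v = 0 → G.Step cap blk v w → G.Step cap' blk' w v)
    (h : G.Conn cap blk v w) (hv : blk v = 0) : G.Conn cap' blk' w v := by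
  induction h with
  | refl => exact .refl
  | @tail x y h1 h2 ih => exact .head (hrev _ _ (Conn.unblocked h1 hv) h2) ih

end AdjGraph

namespace DfsInv

variable {G : AdjGraph} {cap blk rt : ℕ → ℕ} {nr lb : ℕ} {d : DfsState}

theorem finished (h : DfsInv G cap blk rt nr lb d) (hsp : d.sp = 0) {v : ℕ} (hv : v < G.n)
    (hb : blk v = 0) (hvis : d.vis v ≠ 0) : ∃ j < d.cnt, d.ord j = v := by
  simpa [hsp] using (h.new_iff v hv hb).1 hvis

theorem vis_step (h : DfsInv G cap blk rt nr lb d) (hsp : d.sp = 0) {v w : ℕ}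
    (hb : blk v = 0) (hvis : d.vis v ≠ 0) (hvw : G.Step cap blk v w) :
    d.vis w ≠ 0 ∧ d.vis w ≤ d.vis v := by
  have hv := hvw.lt.1
  obtain ⟨j, hj, e⟩ := h.finished hsp hv hb hvis
  obtain ⟨⟨r, hr1, hr2, rfl⟩, hbw⟩ := hvw
  have := h.cur_max v hv hb hvis r (by rw [← e, h.done j hj]; exact hr1.1) hr1 hr2
  exact ⟨this.1, this.2 hbw⟩

theorem vis_conn (h : DfsInv G cap blk rt nr lb d) (hsp : d.sp = 0) {v w : ℕ}
    (hb : blk v = 0) (hvis : d.vis v ≠ 0) (hvw : G.Conn cap blk v w) :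
    d.vis w ≠ 0 ∧ d.vis w ≤ d.vis v := by
  induction hvw with
  | refl => exact ⟨hvis, le_rfl⟩
  | @tail x y h1 h2 ih =>
    have := h.vis_step hsp (AdjGraph.Conn.unblocked h1 hb) ih.1 h2
    exact ⟨this.1, this.2.trans ih.2⟩

/-- The second search of Kosaraju's algorithm, in the reversed graph and from the vertices in
decreasing finishing order, labels the strongly connected components in topological order. -/
theorem kosaraju {cap' blk' rt' : ℕ → ℕ} {lb' : ℕ} {d' : DfsState}
    (h : DfsInv G cap blk rt nr lb d) (hsp : d.sp = 0) (hi : d.i = nr)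
    (hall : ∀ v, v < G.n → blk v = 0 → ∃ j < nr, rt j = v)
    (h' : DfsInv G cap' blk' rt' d.cnt lb' d') (hsp' : d'.sp = 0) (hi' : d'.i = d.cnt)
    (hrt' : ∀ j < d.cnt, rt' j = d.ord (d.cnt - 1 - j))
    (hblk : ∀ v, v < G.n → (blk v = 0 ↔ blk' v = 0))
    (hrev : ∀ v w, blk v = 0 → G.Step cap blk v w → G.Step cap' blk' w v)
    (hrev' : ∀ v w, blk' v = 0 → G.Step cap' blk' v w → G.Step cap blk w v) :
    (∀ v, v < G.n → blk v = 0 → lb' < d'.vis v ∧ d'.vis v ≤ lb' + G.n) ∧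
    (∀ v w, v < G.n → blk v = 0 → G.Conn cap blk v w → d'.vis v ≤ d'.vis w) ∧
    (∀ v w, v < G.n → w < G.n → blk v = 0 → blk w = 0 → d'.vis v = d'.vis w →
      G.Conn cap blk v w) := by
  have hroot : ∀ k < d.cnt, d'.vis (d.ord k) ≠ 0 ∧
      d'.vis (d.ord k) ≤ lb' + (d.cnt - 1 - k) + 1 := by
    intro k hk
    have h1 := hrt' (d.cnt - 1 - k) (by omega)
    rw [show d.cnt - 1 - (d.cnt - 1 - k) = k by omega] at h1
    have h2 := h'.root (d.cnt - 1 - k) (by omega)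
    rw [h1] at h2
    exact ⟨h2.1, h2.2 ((hblk _ (h.ord_lt k hk).1).1 (h.ord_lt k hk).2)⟩
  have hord : ∀ v, v < G.n → blk v = 0 → ∃ k < d.cnt, d.ord k = v := by
    intro v hv hb
    obtain ⟨j, hj, rfl⟩ := hall v hv hb
    exact h.finished hsp hv hb (h.root j (hi ▸ hj)).1
  have hvis : ∀ v, v < G.n → blk v = 0 → d'.vis v ≠ 0 := by
    intro v hv hb
    obtain ⟨k, hk, rfl⟩ := hord v hv hb
    exact (hroot k hk).1
  have hmono : ∀ v w, v < G.n → blk v = 0 → G.Conn cap blk v w → d'.vis v ≤ d'.vis w := by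
    intro v w hv hb hc
    have hbw := hc.unblocked hb
    exact (h'.vis_conn hsp' ((hblk _ (hc.lt hv)).1 hbw) (hvis w (hc.lt hv) hbw)
      (hc.reverse hrev hb)).2
  have hlab : ∀ v, v < G.n → blk v = 0 → ∃ k < d.cnt, d'.vis v = lb' + (d.cnt - 1 - k) + 1 ∧
      G.Conn cap blk v (d.ord k) ∧ G.Conn cap blk (d.ord k) v := by
    intro v hv hb
    obtain ⟨j, hj, e, hbj, hc⟩ := h'.lab v hv ((hblk _ hv).1 hb) (hvis v hv hb)
    rw [hi'] at hj
    rw [hrt' j hj] at hbj hc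
    have hc' := hc.reverse hrev' hbj
    refine ⟨d.cnt - 1 - j, by omega, by omega, hc', ?_⟩
    obtain ⟨y, hy, rfl⟩ := hord v hv hb
    -- Every vertex on the path finishes no later than its end, by the minimality of the label.
    have key : ∀ u, G.Conn cap blk (d.ord y) u → ∃ l ≤ d.cnt - 1 - j, d.ord l = u := by
      intro u hu
      obtain ⟨l, hl, rfl⟩ := hord u (hu.lt hv) (hu.unblocked hb)
      have h1 := hmono _ _ hv hb hu
      have h2 := (hroot l hl).2
      exact ⟨l, by omega, rfl⟩
    obtain ⟨l, hl, hly⟩ := key _ .refl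
    obtain rfl := h.ord_inj l (by omega) y hy hly
    refine h.last _ (by omega) _ hl ?_
    have path : ∀ u, G.Conn cap blk (d.ord l) u → Relation.ReflTransGen (fun v w =>
        G.Step cap blk v w ∧ ∃ l ≤ d.cnt - 1 - j, d.ord l = w) (d.ord l) u := by
      intro u hu
      induction hu with
      | refl => exact .refl
      | tail h1 h2 ih => exact ih.tail ⟨h2, key _ (h1.tail h2)⟩
    exact path _ hc'
  refine ⟨fun v hv hb => ?_, hmono, fun v w hv hw hbv hbw e => ?_⟩
  · obtain ⟨k, hk, e, -⟩ := hlab v hv hb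
    have := h.cnt_le
    omega
  · obtain ⟨k, hk, e1, c1, -⟩ := hlab v hv hbv
    obtain ⟨l, hl, e2, -, c2⟩ := hlab w hw hbw
    obtain rfl : k = l := by omega
    exact c1.trans c2

end DfsInv

/-! ### Residual capacities -/

namespace AdjGraph

variable {G : AdjGraph} {cap mate : ℕ → ℕ}

/-- The number of arcs of nonzero capacity that leave the vertex set `P`. -/
noncomputable def leaving (G : AdjGraph) (cap : ℕ → ℕ) (P : ℕ → Prop) : ℕ := by
  classical
  exact ((Finset.Icc 1 G.H).filter fun h => cap h ≠ 0 ∧ P (G.src h) ∧ ¬ P (G.tgt h)).card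

theorem leaving_eq_zero {P : ℕ → Prop} :
    G.leaving cap P = 0 ↔ ∀ h, G.Live cap h → P (G.src h) → P (G.tgt h) := by
  classical
  simp only [leaving, Finset.card_eq_zero, Finset.filter_eq_empty_iff, Finset.mem_Icc, Live]
  grind

/-- The arcs come in pairs of opposite arcs, at most one of which has nonzero capacity. -/
structure Paired (G : AdjGraph) (mate cap : ℕ → ℕ) : Prop where
  le : ∀ h, 1 ≤ h → h ≤ G.H → 1 ≤ mate h ∧ mate h ≤ G.H
  invol : ∀ h, 1 ≤ h → h ≤ G.H → mate (mate h) = h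
  ne : ∀ h, 1 ≤ h → h ≤ G.H → mate h ≠ h
  src : ∀ h, 1 ≤ h → h ≤ G.H → G.src (mate h) = G.tgt h
  cap : ∀ h, 1 ≤ h → h ≤ G.H → cap h ≠ 0 → cap (mate h) = 0

theorem Paired.tgt {h : ℕ} (hp : G.Paired mate cap) (h1 : 1 ≤ h) (h2 : h ≤ G.H) :
    G.tgt (mate h) = G.src h := by
  have := hp.le h h1 h2
  rw [← hp.src _ this.1 this.2, hp.invol h h1 h2]

/-- Shift one unit of capacity from an arc to its opposite. -/
def flip (mate cap : ℕ → ℕ) (h : ℕ) : ℕ → ℕ :=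
  Function.update (Function.update cap h 0) (mate h) 1

theorem Paired.flip {h : ℕ} (hp : G.Paired mate cap) (hh : G.Live cap h) :
    G.Paired mate (AdjGraph.flip mate cap h) := by
  refine ⟨hp.le, hp.invol, hp.ne, hp.src, fun r h1 h2 hr => ?_⟩
  have e1 := hp.invol h hh.1 hh.2.1
  have e2 := hp.invol r h1 h2
  have e3 := hp.ne h hh.1 hh.2.1
  have e4 := hp.cap r h1 h2
  have e5 := hp.cap h hh.1 hh.2.1 hh.2.2
  simp only [AdjGraph.flip, Function.update_apply] at hr ⊢
  grind

/-- Pushing a unit of flow along an arc changes the capacity that leaves `P` only if the arc has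
exactly one end in `P`. -/
theorem leaving_flip {h : ℕ} (hp : G.Paired mate cap) (hh : G.Live cap h) (P : ℕ → Prop)
    [DecidablePred P] :
    G.leaving (flip mate cap h) P + (if P (G.src h) then 1 else 0) =
      G.leaving cap P + (if P (G.tgt h) then 1 else 0) := by
  classical
  have hm := hp.le h hh.1 hh.2.1
  have hne := hp.ne h hh.1 hh.2.1
  have hc := hp.cap h hh.1 hh.2.1 hh.2.2
  have hs := hp.src h hh.1 hh.2.1
  have ht := hp.tgt hh.1 hh.2.1
  set F : (ℕ → ℕ) → ℕ → ℕ := fun c r =>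
    if c r ≠ 0 ∧ P (G.src r) ∧ ¬ P (G.tgt r) then 1 else 0 with hF
  have hcard : ∀ c, G.leaving c P = ∑ r ∈ Finset.Icc 1 G.H, F c r := fun c => by
    simp only [leaving, hF, Finset.card_filter]
    exact Finset.sum_congr rfl fun r _ => by congr
  have hsub : ({h, mate h} : Finset ℕ) ⊆ Finset.Icc 1 G.H := by
    intro r hr
    simp only [Finset.mem_insert, Finset.mem_singleton] at hr
    rcases hr with rfl | rfl
    · exact Finset.mem_Icc.2 ⟨hh.1, hh.2.1⟩
    · exact Finset.mem_Icc.2 hm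
  rw [hcard, hcard, ← Finset.sum_sdiff hsub, ← Finset.sum_sdiff hsub,
    Finset.sum_pair hne.symm, Finset.sum_pair hne.symm]
  have hrest : ∑ r ∈ Finset.Icc 1 G.H \ {h, mate h}, F (flip mate cap h) r =
      ∑ r ∈ Finset.Icc 1 G.H \ {h, mate h}, F cap r := by
    refine Finset.sum_congr rfl fun r hr => ?_
    simp only [Finset.mem_sdiff, Finset.mem_insert, Finset.mem_singleton, not_or] at hr
    simp only [hF, flip, Function.update_of_ne hr.2.1, Function.update_of_ne hr.2.2]
  have e1 : F (flip mate cap h) h = 0 := by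
    simp [hF, flip, Function.update_of_ne hne.symm]
  have e2 : F cap (mate h) = 0 := by simp [hF, hc]
  have e3 : F (flip mate cap h) (mate h) = if P (G.tgt h) ∧ ¬ P (G.src h) then 1 else 0 := by
    simp [hF, flip, hs, ht]
  have e4 : F cap h = if P (G.src h) ∧ ¬ P (G.tgt h) then 1 else 0 := by
    simp [hF, hh.2.2]
  rw [hrest, e1, e2, e3, e4]
  by_cases hps : P (G.src h) <;> by_cases hpt : P (G.tgt h) <;> simp [hps, hpt]

end AdjGraph

/-! ### Partial labellings and minimum cuts of skew-symmetric digraphs -/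

namespace SkewSymmDigraph

variable {V A : Type*} (D : SkewSymmDigraph V A)

/-- A vertex set that does not contain two conjugate vertices. -/
def Consistent (X : Set V) : Prop := ∀ v ∈ X, D.σV v ∉ X

/-- A set of arcs that contains with each arc its conjugate. -/
def SelfConj (S : Finset A) : Prop := ∀ a ∈ S, D.σA a ∈ S

/-- The arcs outside `S` that leave the vertex set `X`. -/
noncomputable def out [Fintype A] (S : Finset A) (X : Set V) : Finset A := by
  classical
  exact Finset.univ.filter fun a => a ∉ S ∧ D.tail a ∈ X ∧ D.head a ∉ X

variable {D}

@[simp] theorem mem_out [Fintype A] {S : Finset A} {X : Set V} {a : A} :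
    a ∈ D.out S X ↔ a ∉ S ∧ D.tail a ∈ X ∧ D.head a ∉ X := by
  simp [out]

theorem SelfConj.mem_iff {S : Finset A} (h : D.SelfConj S) (a : A) : D.σA a ∈ S ↔ a ∈ S :=
  ⟨fun h' => by simpa [D.σA_σA] using h _ h', h _⟩

theorem SelfConj.image_eq [DecidableEq A] {S : Finset A} (h : D.SelfConj S) :
    S.image D.σA = S := by
  ext a
  rw [Finset.mem_image]
  exact ⟨fun ⟨b, hb, e⟩ => e ▸ h b hb, fun ha => ⟨D.σA a, h a ha, D.σA_σA a⟩⟩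

theorem selfConj_of_image_eq [DecidableEq A] {S : Finset A} (h : S.image D.σA = S) :
    D.SelfConj S := fun _ ha => h ▸ Finset.mem_image_of_mem _ ha

theorem SelfConj.even_card {S : Finset A} (h : D.SelfConj S) : Even S.card := by
  classical
  have h1 : ∑ a ∈ S, (1 : ZMod 2) = 0 :=
    Finset.sum_involution (fun a _ => D.σA a) (fun _ _ => by decide)
      (fun a _ _ => D.σA_ne a) h (fun a _ => D.σA_σA a)
  rw [Finset.sum_const, nsmul_one] at h1
  exact (ZMod.natCast_eq_zero_iff_even).1 h1

theorem Reach.conj {S : Finset A} (hS : D.SelfConj S) {u v : V} (h : D.Reach S u v) :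
    D.Reach S (D.σV v) (D.σV u) := by
  induction h with
  | refl => exact .refl
  | tail h1 h2 ih =>
    obtain ⟨a, ha, rfl, rfl⟩ := h2
    exact .head ⟨D.σA a, by rwa [hS.mem_iff], D.tail_σA a, D.head_σA a⟩ ih

theorem Reach.mem {S : Finset A} {X : Set V}
    (hX : ∀ a, a ∉ S → D.tail a ∈ X → D.head a ∈ X) {u v : V} (h : D.Reach S u v) (hu : u ∈ X) :
    v ∈ X := by
  induction h with
  | refl => exact hu
  | tail h1 h2 ih =>
    obtain ⟨a, ha, rfl, rfl⟩ := h2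
    exact hX a ha ih

/-- Some consistent set that is closed under reachability decides every vertex that is not
strongly connected with its conjugate. -/
theorem exists_labelling [Finite V] {S : Finset A} (hS : D.SelfConj S) :
    ∃ X : Set V, D.Consistent X ∧ (∀ a, a ∉ S → D.tail a ∈ X → D.head a ∈ X) ∧
      ∀ v, ¬ D.SameSCC S v (D.σV v) → v ∈ X ∨ D.σV v ∈ X := by
  obtain ⟨X, hX⟩ := (Set.toFinite {X : Set V | D.Consistent X ∧
    ∀ a, a ∉ S → D.tail a ∈ X → D.head a ∈ X}).exists_maximal ⟨∅, by simp [Consistent]⟩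
  obtain ⟨hXc, hXcl⟩ := hX.prop
  refine ⟨X, hXc, hXcl, fun v hv => ?_⟩
  by_contra hund
  rw [not_or] at hund
  -- Otherwise everything that is reachable from `u` could be added to the maximal set `X`.
  have key : ∀ u, ¬ D.Reach S u (D.σV u) → D.σV u ∉ X → u ∈ X := by
    intro u hu hu'
    have hcl : ∀ a, a ∉ S → D.tail a ∈ X ∪ {w | D.Reach S u w} →
        D.head a ∈ X ∪ {w | D.Reach S u w} := by
      rintro a ha (h | h)
      · exact .inl (hXcl a ha h)
      · exact .inr (h.tail ⟨a, ha, rfl, rfl⟩)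
    have hsym : ∀ x, D.Reach S u (D.σV x) → D.Reach S x (D.σV u) := fun x h => by
      simpa [D.σV_σV] using h.conj hS
    refine hX.le_of_ge (y := X ∪ {w | D.Reach S u w}) ⟨?_, hcl⟩ Set.subset_union_left (.inr .refl)
    rintro x (hx | hx) (hx' | hx')
    · exact hXc x hx hx'
    · exact hu' ((hsym x hx').mem hXcl hx)
    · exact hu' ((hsym (D.σV x) (by simpa [D.σV_σV] using hx)).mem hXcl hx')
    · exact hu (hx.trans (hsym x hx'))
  by_cases h : D.Reach S v (D.σV v)
  · refine hund.2 (key (D.σV v) (fun h' => hv ⟨h, ?_⟩) ?_)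
    · simpa [D.σV_σV] using h'
    · simpa [D.σV_σV] using hund.1
  · exact hund.1 (key v h hund.2)

theorem SelfConj.union [DecidableEq A] {S T : Finset A} (hS : D.SelfConj S)
    (hT : D.SelfConj T) : D.SelfConj (S ∪ T) := fun a ha =>
  Finset.mem_union.2 ((Finset.mem_union.1 ha).imp (hS a) (hT a))

section

variable [Fintype A]

/-- `Z` is a minimum cut between `L` and its conjugate in `D` minus the arcs in `S`, it cuts `l`
arcs, it is consistent, and no consistent minimum cut properly contains it. -/
structure IsMaxCut (D : SkewSymmDigraph V A) (S : Finset A) (L Z : Set V) (l : ℕ) : Prop where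
  subset : L ⊆ Z
  consistent : D.Consistent Z
  card : (D.out S Z).card = l
  le : ∀ Y : Set V, L ⊆ Y → (∀ v ∈ L, D.σV v ∉ Y) → l ≤ (D.out S Y).card
  lt : ∀ w, w ∉ Z → D.σV w ∉ Z → ∀ Y : Set V, Z ⊆ Y → w ∈ Y → D.Consistent Y →
    l + 1 ≤ (D.out S Y).card

variable {S : Finset A} {L Z X : Set V} {l : ℕ}

/-- The inequality behind persistency for a single pair of conjugate arcs. The propositions say
that the tail `t` and the head `h` of an arc, or their conjugates `t'` and `h'`, lie in `Z` or
`X`. -/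
theorem persistency_aux {tZ hZ tZ' hZ' tX hX tX' hX' : Prop} [Decidable tZ] [Decidable hZ]
    [Decidable tZ'] [Decidable hZ'] [Decidable tX] [Decidable hX] [Decidable tX'] [Decidable hX']
    (h1 : tZ → ¬ tZ') (h2 : hZ → ¬ hZ') (h3 : tX → ¬ tX') (h4 : hX → ¬ hX') :
    (if ((tX ∧ ¬ tZ') ∨ tZ) ∧ ¬ ((hX ∧ ¬ hZ') ∨ hZ) ∨
        ((hX' ∧ ¬ hZ) ∨ hZ') ∧ ¬ ((tX' ∧ ¬ tZ) ∨ tZ') then 1 else 0) +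
      (if (tZ ∧ tX) ∧ ¬ (hZ ∧ hX) then 1 else 0) +
      (if (hZ' ∧ hX') ∧ ¬ (tZ' ∧ tX') then 1 else 0) ≤
    (if tX ∧ ¬ hX ∨ hX' ∧ ¬ tX' then 1 else 0) + (if tZ ∧ ¬ hZ then 1 else 0) +
      (if hZ' ∧ ¬ tZ' then 1 else 0) := by
  by_cases b1 : tZ <;> by_cases b2 : hZ <;> by_cases b3 : tX <;> by_cases b4 : hX <;>
    by_cases b5 : tZ' <;> by_cases b6 : hZ' <;> by_cases b7 : tX' <;> by_cases b8 : hX' <;>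
    simp_all

/-- Persistency: a consistent minimum cut `Z` may be imposed on any labelling `X` without
increasing the number of arcs that have to be deleted, counted with their conjugates. -/
theorem card_out_union_le [DecidableEq A] (hS : D.SelfConj S) (hZ : D.Consistent Z)
    (hX : D.Consistent X) (hmin : (D.out S Z).card ≤ (D.out S (Z ∩ X)).card) :
    (D.out S ((X \ {v | D.σV v ∈ Z}) ∪ Z) ∪
      (D.out S ((X \ {v | D.σV v ∈ Z}) ∪ Z)).image D.σA).card ≤
    (D.out S X ∪ (D.out S X).image D.σA).card := by
  classical
  set Y := (X \ {v | D.σV v ∈ Z}) ∪ Z with hY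
  have himg : ∀ (T : Finset A) a, a ∈ T.image D.σA ↔ D.σA a ∈ T := by
    intro T a
    rw [Finset.mem_image]
    exact ⟨fun ⟨b, hb, e⟩ => by rwa [← e, D.σA_σA], fun h => ⟨_, h, D.σA_σA a⟩⟩
  have hsum : ∀ T : Finset A, T.card = ∑ a, if a ∈ T then 1 else 0 := fun T => by simp
  have hsum' : ∀ T : Finset A, T.card = ∑ a, if D.σA a ∈ T then 1 else 0 := fun T => by
    rw [← Finset.card_image_of_injective T (Function.Involutive.injective D.σA_σA), hsum]
    simp only [himg]
  have hle : (D.out S Y ∪ (D.out S Y).image D.σA).card + (D.out S (Z ∩ X)).card +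
      (D.out S (Z ∩ X)).card ≤ (D.out S X ∪ (D.out S X).image D.σA).card +
        (D.out S Z).card + (D.out S Z).card := by
    rw [hsum (D.out S Y ∪ _), hsum (D.out S X ∪ _)]
    nth_rw 1 [hsum (D.out S (Z ∩ X)), hsum (D.out S Z)]
    rw [hsum' (D.out S (Z ∩ X)), hsum' (D.out S Z)]
    simp only [← Finset.sum_add_distrib]
    refine Finset.sum_le_sum fun a _ => ?_
    simp only [Finset.mem_union, himg, mem_out, hS.mem_iff, D.tail_σA, D.head_σA, hY,
      Set.mem_union, Set.mem_sdiff, Set.mem_ofPred_eq, Set.mem_inter_iff, D.σV_σV]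
    by_cases ha : a ∈ S
    · simp [ha]
    simp only [ha, not_false_eq_true, true_and]
    exact persistency_aux (hZ _) (hZ _) (hX _) (hX _)
  omega

theorem IsMaxCut.lt_insert (h : D.IsMaxCut S L Z l) {w : V} (hw : w ∉ Z) (hw' : D.σV w ∉ Z)
    {Y : Set V} (hY : insert w Z ⊆ Y) (hc : D.Consistent Y) : l + 1 ≤ (D.out S Y).card :=
  h.lt w hw hw' Y ((Set.subset_insert _ _).trans hY) (hY (Set.mem_insert _ _)) hc

/-- Deleting an arc with an undecided head, together with its conjugate, makes the minimum cut smaller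
by at most one: a cut that lost both arcs contains the conjugate of the head, so it was not
minimum. -/
theorem IsMaxCut.le_of_delete [DecidableEq A] (h : D.IsMaxCut S L Z l) {a : A}
    (hw : D.head a ∉ Z) (hw' : D.σV (D.head a) ∉ Z) {Y : Set V} (hY : Z ⊆ Y)
    (hc : D.Consistent Y) : l ≤ (D.out (insert a (insert (D.σA a) S)) Y).card + 1 := by
  have hsub : D.out S Y ⊆ insert a (insert (D.σA a) (D.out (insert a (insert (D.σA a) S)) Y)) := by
    intro b hb
    simp only [Finset.mem_insert, mem_out] at hb ⊢
    tauto
  by_cases hmem : D.σV (D.head a) ∈ Y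
  · have h1 := h.lt _ hw' (by rwa [D.σV_σV]) Y hY hmem hc
    have h2 := (Finset.card_le_card hsub).trans ((Finset.card_insert_le _ _).trans
      (Nat.add_le_add_right (Finset.card_insert_le _ _) 1))
    omega
  · have hsub' : D.out S Y ⊆ insert a (D.out (insert a (insert (D.σA a) S)) Y) := by
      intro b hb
      have h1 := hsub hb
      simp only [Finset.mem_insert] at h1 ⊢
      rcases h1 with h1 | rfl | h1
      · exact .inl h1
      · rw [mem_out, D.tail_σA] at hb
        exact absurd hb.2.1 hmem
      · exact .inr h1
    have h1 := h.le Y (h.subset.trans hY) (fun v hv => hc v (hY (h.subset hv)))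
    have h2 := (Finset.card_le_card hsub').trans (Finset.card_insert_le _ _)
    omega

/-- If no arc that leaves `Z` has an undecided head, then the arcs that leave `Z` come in conjugate
pairs. -/
theorem selfConj_out (hS : D.SelfConj S) (hf : ∀ a ∈ D.out S Z, D.σV (D.head a) ∈ Z)
    (hZ : D.Consistent Z) : D.SelfConj (D.out S Z) := by
  intro a ha
  have h := hf a ha
  rw [mem_out] at ha ⊢
  rw [hS.mem_iff, D.tail_σA, D.head_σA]
  exact ⟨ha.1, h, hZ _ ha.2.1⟩

/-- After all arcs that leave a maximal minimum cut have been deleted, a further commitment still has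
a positive price. -/
theorem IsMaxCut.pos_of_forced [DecidableEq A] (h : D.IsMaxCut S L Z l) {w : V} (hw : w ∉ Z)
    (hw' : D.σV w ∉ Z) {Y : Set V} (hY : insert w Z ⊆ Y) (hc : D.Consistent Y) :
    1 ≤ (D.out (S ∪ D.out S Z) Y).card := by
  have h1 := h.lt_insert hw hw' hY hc
  have hsub : D.out S Y ⊆ D.out (S ∪ D.out S Z) Y ∪ D.out S Z := by
    intro b hb
    simp only [Finset.mem_union, mem_out] at hb ⊢
    tauto
  have h2 := (Finset.card_le_card hsub).trans (Finset.card_union_le _ _)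
  have h3 := h.card
  omega

end

end SkewSymmDigraph

/-! ### Partial solutions of an instance -/

namespace MulticutInstance

open SkewSymmDigraph

variable {I : MulticutInstance}

/-- Some multicut of size at most `2k` contains the arcs in `S`, and the vertices in `L` belong to
a labelling that witnesses it: a consistent set `X` that is closed under reachability and decides a
member of each set of the family. -/
def Sol (I : MulticutInstance) (S : Finset (Fin I.m)) (L : Set (Fin I.n)) : Prop :=
  ∃ (R : Finset (Fin I.m)) (X : Set (Fin I.n)), I.D.SelfConj R ∧ S ⊆ R ∧ R.card ≤ 2 * I.k ∧
    I.D.Consistent X ∧ L ⊆ X ∧ (∀ a, a ∉ R → I.D.tail a ∈ X → I.D.head a ∈ X) ∧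
    ∀ i, ∃ j, I.family i j ∈ X ∨ I.D.σV (I.family i j) ∈ X

variable {S : Finset (Fin I.m)} {L Z : Set (Fin I.n)} {l : ℕ}

theorem sol_of_isMulticut (h : I.IsMulticut S) : I.Sol ∅ ∅ := by
  obtain ⟨X, hX, hcl, hdec⟩ := exists_labelling (selfConj_of_image_eq h.1)
  refine ⟨S, X, selfConj_of_image_eq h.1, Finset.empty_subset _, h.2.1, hX, Set.empty_subset _,
    hcl, fun i => ?_⟩
  obtain ⟨j, hj⟩ := h.2.2 i
  exact ⟨j, hdec _ hj⟩

theorem isMulticut_of_out_eq_empty (hS : I.D.SelfConj S) (hk : S.card ≤ 2 * I.k)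
    (hZ : I.D.Consistent Z) (hout : I.D.out S Z = ∅)
    (hdec : ∀ i, ∃ j, I.family i j ∈ Z ∨ I.D.σV (I.family i j) ∈ Z) : I.IsMulticut S := by
  refine ⟨hS.image_eq, hk, fun i => ?_⟩
  have hcl : ∀ a, a ∉ S → I.D.tail a ∈ Z → I.D.head a ∈ Z := by
    intro a ha ht
    by_contra hh
    have : a ∈ I.D.out S Z := mem_out.2 ⟨ha, ht, hh⟩
    simp [hout] at this
  obtain ⟨j, hj | hj⟩ := hdec i
  · exact ⟨j, fun hs => hZ _ hj (hs.1.mem hcl hj)⟩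
  · exact ⟨j, fun hs => hZ _ hj (by rw [I.D.σV_σV]; exact hs.2.mem hcl hj)⟩

/-- A maximal consistent minimum cut may be committed. -/
theorem Sol.persist (hS : I.D.SelfConj S) (hc : I.D.IsMaxCut S L Z l) (h : I.Sol S L) :
    I.Sol S Z := by
  obtain ⟨R, X, hR, hSR, hk, hX, hLX, hcl, hdec⟩ := h
  set Y : Set (Fin I.n) := (X \ {v | I.D.σV v ∈ Z}) ∪ Z with hY
  have hmin : (I.D.out S Z).card ≤ (I.D.out S (Z ∩ X)).card :=
    hc.card.trans_le (hc.le _ (Set.subset_inter hc.subset hLX)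
      fun v hv hv' => hX v (hLX hv) hv'.2)
  have hle := card_out_union_le hS hc.consistent hX hmin
  rw [← hY] at hle
  have hsc : ∀ W : Set (Fin I.n), I.D.SelfConj (I.D.out S W ∪ (I.D.out S W).image I.D.σA) := by
    intro W a ha
    rw [Finset.mem_union, Finset.mem_image] at ha ⊢
    rcases ha with ha | ⟨b, hb, rfl⟩
    · exact .inr ⟨a, ha, rfl⟩
    · exact .inl (by rwa [I.D.σA_σA])
  have hXR : I.D.out S X ∪ (I.D.out S X).image I.D.σA ⊆ R \ S := by
    have h1 : ∀ a ∈ I.D.out S X, a ∈ R ∧ a ∉ S := fun a ha => by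
      rw [mem_out] at ha
      exact ⟨by_contra fun h => ha.2.2 (hcl a h ha.2.1), ha.1⟩
    intro a ha
    rw [Finset.mem_union, Finset.mem_image] at ha
    rw [Finset.mem_sdiff]
    rcases ha with ha | ⟨b, hb, rfl⟩
    · exact h1 a ha
    · rw [hR.mem_iff, hS.mem_iff]; exact h1 b hb
  have hcard := Finset.card_le_card hXR
  rw [Finset.card_sdiff_of_subset hSR] at hcard
  have hSR' := Finset.card_le_card hSR
  refine ⟨S ∪ (I.D.out S Y ∪ (I.D.out S Y).image I.D.σA), Y, hS.union (hsc Y),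
    Finset.subset_union_left, ?_, ?_, Set.subset_union_right, ?_, fun i => ?_⟩
  · have := Finset.card_union_le S (I.D.out S Y ∪ (I.D.out S Y).image I.D.σA)
    omega
  · rintro v (⟨h1, h2⟩ | h1) (⟨h3, h4⟩ | h3)
    · exact hX v h1 h3
    · exact h2 h3
    · exact h4 (by simpa [I.D.σV_σV] using h1)
    · exact hc.consistent v h1 h3
  · intro a ha ht
    by_contra hh
    refine ha (Finset.mem_union.2 ?_)
    by_cases h : a ∈ S
    · exact .inl h
    · exact .inr (Finset.mem_union_left _ (mem_out.2 ⟨h, ht, hh⟩))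
  · obtain ⟨j, hj⟩ := hdec i
    refine ⟨j, ?_⟩
    set v := I.family i j
    by_cases h1 : v ∈ Z
    · exact .inl (.inr h1)
    by_cases h2 : I.D.σV v ∈ Z
    · exact .inr (.inr h2)
    · exact hj.imp (fun h => .inl ⟨h, h2⟩) fun h => .inl ⟨h, by simpa [I.D.σV_σV] using h1⟩

theorem Sol.delete_or_keep (h : I.Sol S Z) {a : Fin I.m} (ha : I.D.tail a ∈ Z) :
    I.Sol (insert a (insert (I.D.σA a) S)) Z ∨ I.Sol S (insert (I.D.head a) Z) := by
  obtain ⟨R, X, hR, hSR, hk, hX, hLX, hcl, hdec⟩ := h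
  by_cases haR : a ∈ R
  · exact .inl ⟨R, X, hR, Finset.insert_subset haR (Finset.insert_subset (hR a haR) hSR), hk, hX,
      hLX, hcl, hdec⟩
  · exact .inr ⟨R, X, hR, hSR, hk, hX, Set.insert_subset (hcl a haR (hLX ha)) hLX, hcl, hdec⟩

/-- An arc from `Z` to the conjugate of `Z` cannot be kept. -/
theorem Sol.forced (h : I.Sol S Z) (hf : ∀ a ∈ I.D.out S Z, I.D.σV (I.D.head a) ∈ Z) :
    I.Sol (S ∪ I.D.out S Z) Z := by
  obtain ⟨R, X, hR, hSR, hk, hX, hLX, hcl, hdec⟩ := h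
  refine ⟨R, X, hR, Finset.union_subset hSR fun a ha => ?_, hk, hX, hLX, hcl, hdec⟩
  by_contra haR
  have h1 := hcl a haR (hLX (mem_out.1 ha).2.1)
  exact hX _ h1 (hLX (hf a ha))

theorem Sol.member (h : I.Sol S Z) (i : Fin I.t) : ∃ j, I.Sol S (insert (I.family i j) Z) ∨
    I.Sol S (insert (I.D.σV (I.family i j)) Z) := by
  obtain ⟨R, X, hR, hSR, hk, hX, hLX, hcl, hdec⟩ := h
  obtain ⟨j, hj⟩ := hdec i
  exact ⟨j, hj.imp (fun h => ⟨R, X, hR, hSR, hk, hX, Set.insert_subset h hLX, hcl, hdec⟩)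
    fun h => ⟨R, X, hR, hSR, hk, hX, Set.insert_subset h hLX, hcl, hdec⟩⟩

/-- The remaining budget has to pay for a cut around the committed vertices. -/
theorem Sol.exists_cut (h : I.Sol S L) : ∃ Y : Set (Fin I.n), L ⊆ Y ∧ I.D.Consistent Y ∧
    (I.D.out S Y).card + S.card ≤ 2 * I.k := by
  obtain ⟨R, X, hR, hSR, hk, hX, hLX, hcl, hdec⟩ := h
  refine ⟨X, hLX, hX, ?_⟩
  have hd : Disjoint (I.D.out S X) S := Finset.disjoint_left.2 fun a ha => (mem_out.1 ha).1
  rw [← Finset.card_union_of_disjoint hd]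
  refine (Finset.card_le_card (Finset.union_subset (fun a ha => ?_) hSR)).trans hk
  rw [mem_out] at ha
  exact by_contra fun h => ha.2.2 (hcl a h ha.2.1)

end MulticutInstance

/-! ### The residual graph of an instance -/

namespace MulticutInstance

open SkewSymmDigraph

variable {I : MulticutInstance}

/-- `G` is the graph with two opposite arcs `a + 1` and `m + a + 1` for each arc `a` of the
instance, and `mate` exchanges them. -/
structure HasGraph (I : MulticutInstance) (G : AdjGraph) (mate : ℕ → ℕ) : Prop where
  n_eq : G.n = I.n
  H_eq : G.H = 2 * I.m
  src_lo : ∀ a : Fin I.m, G.src (a + 1) = I.D.tail a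
  tgt_lo : ∀ a : Fin I.m, G.tgt (a + 1) = I.D.head a
  src_hi : ∀ a : Fin I.m, G.src (I.m + a + 1) = I.D.head a
  tgt_hi : ∀ a : Fin I.m, G.tgt (I.m + a + 1) = I.D.tail a
  mate_lo : ∀ a : Fin I.m, mate (a + 1) = I.m + a + 1
  mate_hi : ∀ a : Fin I.m, mate (I.m + a + 1) = a + 1

/-- A vertex set as a predicate on the natural numbers. -/
def Mem (X : Set (Fin I.n)) (v : ℕ) : Prop := ∃ h : v < I.n, (⟨v, h⟩ : Fin I.n) ∈ X

@[simp] theorem mem_coe {X : Set (Fin I.n)} {v : Fin I.n} : Mem X (v : ℕ) ↔ v ∈ X :=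
  ⟨fun ⟨_, h⟩ => h, fun h => ⟨v.2, h⟩⟩

variable {G : AdjGraph} {mate cap : ℕ → ℕ} {S : Finset (Fin I.m)} {L : Set (Fin I.n)} {l : ℕ}

theorem HasGraph.cases (hG : I.HasGraph G mate) {h : ℕ} (h1 : 1 ≤ h) (h2 : h ≤ G.H) :
    (∃ a : Fin I.m, h = a + 1) ∨ ∃ a : Fin I.m, h = I.m + a + 1 := by
  rw [hG.H_eq] at h2
  by_cases h3 : h ≤ I.m
  · exact .inl ⟨⟨h - 1, by omega⟩, by simp; omega⟩
  · exact .inr ⟨⟨h - 1 - I.m, by omega⟩, by simp; omega⟩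

/-- The capacities before any augmentation. -/
structure InitCap (I : MulticutInstance) (S : Finset (Fin I.m)) (cap : ℕ → ℕ) : Prop where
  lo : ∀ a : Fin I.m, cap (a + 1) ≠ 0 ↔ a ∉ S
  hi : ∀ a : Fin I.m, cap (I.m + a + 1) = 0

theorem HasGraph.paired (hG : I.HasGraph G mate) (hc : I.InitCap S cap) : G.Paired mate cap := by
  constructor <;> intro h h1 h2 <;> rcases hG.cases h1 h2 with ⟨a, rfl⟩ | ⟨a, rfl⟩ <;>
    simp only [hG.mate_lo, hG.mate_hi, hG.src_lo, hG.src_hi, hG.tgt_lo, hG.tgt_hi, hG.H_eq,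
      hc.hi] <;> have := a.2 <;> simp <;> omega

theorem HasGraph.leaving_init (hG : I.HasGraph G mate) (hc : I.InitCap S cap)
    (X : Set (Fin I.n)) : G.leaving cap (Mem X) = (I.D.out S X).card := by
  classical
  rw [AdjGraph.leaving]
  refine (Finset.card_bij (fun a _ => a.1 + 1) ?_ ?_ ?_).symm
  · intro a ha
    rw [mem_out] at ha
    rw [Finset.mem_filter, Finset.mem_Icc, hc.lo, hG.src_lo, hG.tgt_lo, mem_coe, mem_coe, hG.H_eq]
    have := a.2
    exact ⟨by omega, ha⟩
  · intro a _ b _ e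
    exact Fin.ext (by simpa using e)
  · intro h hh
    rw [Finset.mem_filter, Finset.mem_Icc] at hh
    rcases hG.cases hh.1.1 hh.1.2 with ⟨a, rfl⟩ | ⟨a, rfl⟩
    · rw [hc.lo, hG.src_lo, hG.tgt_lo, mem_coe, mem_coe] at hh
      exact ⟨a, mem_out.2 hh.2, rfl⟩
    · exact absurd (hc.hi a) hh.2.1

/-- The invariant of the augmenting path algorithm: after `l` augmentations, each set that
separates `L` from its conjugate has lost `l` units of its outgoing capacity. -/
structure FlowInv (I : MulticutInstance) (G : AdjGraph) (mate : ℕ → ℕ) (S : Finset (Fin I.m))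
    (L : Set (Fin I.n)) (cap : ℕ → ℕ) (l : ℕ) : Prop where
  paired : G.Paired mate cap
  card : ∀ X : Set (Fin I.n), L ⊆ X → (∀ v ∈ L, I.D.σV v ∉ X) →
    (I.D.out S X).card = G.leaving cap (Mem X) + l

theorem FlowInv.init (hG : I.HasGraph G mate) (hc : I.InitCap S cap) :
    I.FlowInv G mate S L cap 0 :=
  ⟨hG.paired hc, fun X _ _ => (hG.leaving_init hc X).symm⟩

/-- Closed under arcs of nonzero capacity. -/
def Closed (G : AdjGraph) (cap : ℕ → ℕ) (X : Set (Fin I.n)) : Prop :=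
  ∀ h, G.Live cap h → Mem X (G.src h) → Mem X (G.tgt h)

/-- Max-flow min-cut: the residually closed sets are the cuts whose size is the value of the flow. -/
theorem FlowInv.closed_iff (hf : I.FlowInv G mate S L cap l) {X : Set (Fin I.n)} (hL : L ⊆ X)
    (hL' : ∀ v ∈ L, I.D.σV v ∉ X) : Closed G cap X ↔ (I.D.out S X).card = l := by
  rw [hf.card X hL hL', Closed, ← AdjGraph.leaving_eq_zero]
  omega

theorem card_out_conj (hS : I.D.SelfConj S) (X : Set (Fin I.n)) :
    (I.D.out S {v | I.D.σV v ∉ X}).card = (I.D.out S X).card := by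
  refine Finset.card_bij' (fun a _ => I.D.σA a) (fun a _ => I.D.σA a) ?_ ?_
    (fun a _ => I.D.σA_σA a) (fun a _ => I.D.σA_σA a) <;>
  · intro a ha
    rw [mem_out] at ha ⊢
    simpa [hS.mem_iff, I.D.tail_σA, I.D.head_σA, I.D.σV_σV, and_comm] using ha

/-- The family of the minimum cuts is symmetric under conjugation. -/
theorem FlowInv.closed_conj (hf : I.FlowInv G mate S L cap l) (hS : I.D.SelfConj S)
    {X : Set (Fin I.n)} (hL : L ⊆ X) (hL' : ∀ v ∈ L, I.D.σV v ∉ X) (hX : Closed G cap X) :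
    Closed G cap {v : Fin I.n | I.D.σV v ∉ X} := by
  refine (hf.closed_iff (X := {v : Fin I.n | I.D.σV v ∉ X}) hL' fun v hv h => ?_).2 ?_
  · rw [Set.mem_ofPred_eq, I.D.σV_σV] at h
    exact h (hL hv)
  · rw [card_out_conj hS]
    exact (hf.closed_iff hL hL').1 hX

theorem Closed.conn {blk : ℕ → ℕ} {X : Set (Fin I.n)} (hX : Closed G cap X) {v w : ℕ}
    (h : G.Conn cap blk v w) (hv : Mem X v) : Mem X w := by
  induction h with
  | refl => exact hv
  | tail _ h ih =>
    obtain ⟨⟨a, ha, rfl, rfl⟩, -⟩ := h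
    exact hX a ha ih

/-- Let `core` be the smallest minimum cut. If the components of the residual graph on the
vertices outside `core` and its conjugate are labelled in topological order, then the vertices
with a larger label than their conjugates form a maximal consistent minimum cut. -/
theorem FlowInv.isMaxCut (hf : I.FlowInv G mate S L cap l)
    (hS : I.D.SelfConj S) {core : Set (Fin I.n)} (hL : L ⊆ core)
    (hL' : ∀ v ∈ L, I.D.σV v ∉ core) (hcl : Closed G cap core)
    (hmin : ∀ X : Set (Fin I.n), L ⊆ X → Closed G cap X → core ⊆ X)
    {blk lab : ℕ → ℕ} {big : ℕ}
    (hblk : ∀ v : Fin I.n, blk v = 0 ↔ v ∉ core ∧ I.D.σV v ∉ core)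
    (h1 : ∀ v ∈ core, lab v = big) (h2 : ∀ v, I.D.σV v ∈ core → lab v = 1)
    (hbig : 1 < big)
    (hmono : ∀ v w : Fin I.n, blk v = 0 → G.Conn cap blk v w → lab v ≤ lab w)
    (heq : ∀ v w : Fin I.n, blk v = 0 → blk w = 0 → lab v = lab w → G.Conn cap blk v w) :
    I.D.IsMaxCut S L {v | lab (I.D.σV v) < lab v} l := by
  have hcons : ∀ v ∈ core, I.D.σV v ∉ core :=
    hmin _ hL' (hf.closed_conj hS hL hL' hcl)
  have hcl' := hf.closed_conj hS hL hL' hcl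
  have hblk' : ∀ v : Fin I.n, blk v = 0 → blk (I.D.σV v) = 0 := by
    intro v hv
    rw [hblk] at hv ⊢
    rw [I.D.σV_σV]
    exact hv.symm
  have hout : ∀ h (v : Fin I.n), G.Live cap h → G.src h = v → blk v = 0 →
      ∃ w : Fin I.n, G.tgt h = w ∧ (w ∈ core ∨ blk w = 0) := by
    intro h v hh hv hb
    have hv' : Mem {v : Fin I.n | I.D.σV v ∉ core} (G.src h) := by
      rw [hv, mem_coe]; exact ((hblk v).1 hb).2
    obtain ⟨hlt, hw⟩ := hcl' h hh hv'
    refine ⟨⟨_, hlt⟩, rfl, ?_⟩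
    by_cases hc : (⟨_, hlt⟩ : Fin I.n) ∈ core
    · exact .inl hc
    · exact .inr ((hblk _).2 ⟨hc, hw⟩)
  -- Reachability outside the core and its conjugate is symmetric under conjugation: otherwise the
  -- conjugate of the set reachable from `σ w`, which is a minimum cut as well, contains `v`, but not
  -- `w`.
  have hsym : ∀ v w : Fin I.n, blk v = 0 → blk w = 0 → G.Conn cap blk v w →
      G.Conn cap blk (I.D.σV w) (I.D.σV v) := by
    intro v w hv hw hc
    set Y : Set (Fin I.n) := core ∪ {x | G.Conn cap blk (I.D.σV w) x} with hY
    have hYcl : Closed G cap Y := by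
      rintro h hh ⟨hlt, hx | hx⟩
      · obtain ⟨hlt', hx'⟩ := hcl h hh ⟨hlt, hx⟩
        exact ⟨hlt', .inl hx'⟩
      · have hbx := AdjGraph.Conn.unblocked hx (hblk' w hw)
        obtain ⟨y, hy, hy'⟩ := hout h ⟨_, hlt⟩ hh rfl hbx
        rw [hy, mem_coe]
        rcases hy' with hy' | hy'
        · exact .inl hy'
        · exact .inr (Relation.ReflTransGen.tail hx ⟨⟨h, hh, rfl, hy⟩, hy'⟩)
    have hYL : ∀ v ∈ L, I.D.σV v ∉ Y := by
      rintro u hu (hu' | hu')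
      · exact hL' u hu hu'
      · have := (hblk _).1 (AdjGraph.Conn.unblocked hu' (hblk' w hw))
        rw [I.D.σV_σV] at this
        exact this.2 (hL hu)
    have hcY := hf.closed_conj hS (hL.trans Set.subset_union_left) hYL hYcl
    by_contra hnot
    have hv' : Mem {x : Fin I.n | I.D.σV x ∉ Y} (v : ℕ) := by
      rw [mem_coe]
      rintro (h | h)
      · exact ((hblk v).1 hv).2 h
      · exact hnot h
    have := hcY.conn hc hv'
    rw [mem_coe] at this
    exact this (.inr .refl)
  set Z : Set (Fin I.n) := {v | lab (I.D.σV v) < lab v} with hZ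
  have hcoreZ : core ⊆ Z := by
    intro v hv
    rw [hZ, Set.mem_ofPred_eq, h1 v hv, h2 (I.D.σV v) (by rwa [I.D.σV_σV])]
    exact hbig
  have hZcons : I.D.Consistent Z := by
    intro v hv hv'
    rw [hZ, Set.mem_ofPred_eq] at hv hv'
    rw [I.D.σV_σV] at hv'
    omega
  have hZL : ∀ v ∈ L, I.D.σV v ∉ Z := fun v hv => hZcons v (hcoreZ (hL hv))
  have hZcl : Closed G cap Z := by
    rintro h hh ⟨hlt, hx⟩
    set x : Fin I.n := ⟨_, hlt⟩
    by_cases hxc : x ∈ core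
    · obtain ⟨hlt', hy⟩ := hcl h hh ⟨hlt, hxc⟩
      exact ⟨hlt', hcoreZ hy⟩
    by_cases hxc' : I.D.σV x ∈ core
    · exact absurd hx (hZcons _ (hcoreZ hxc') |> fun h' => by rwa [I.D.σV_σV] at h')
    have hbx := (hblk x).2 ⟨hxc, hxc'⟩
    obtain ⟨y, hy, hy'⟩ := hout h x hh rfl hbx
    rw [hy, mem_coe]
    rcases hy' with hy' | hy'
    · exact hcoreZ hy'
    · have hc : G.Conn cap blk x y := .single ⟨⟨h, hh, rfl, hy⟩, hy'⟩
      have e1 := hmono x y hbx hc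
      have e2 := hmono _ _ (hblk' y hy') (hsym x y hbx hy' hc)
      rw [hZ, Set.mem_ofPred_eq] at hx ⊢
      omega
  refine ⟨hL.trans hcoreZ, hZcons, (hf.closed_iff (hL.trans hcoreZ) hZL).1 hZcl,
    fun Y hY hY' => by rw [hf.card Y hY hY']; omega, fun w hw hw' Y hZY hwY hY => ?_⟩
  have hLY := (hL.trans hcoreZ).trans hZY
  have hLY' : ∀ v ∈ L, I.D.σV v ∉ Y := fun v hv => hY v (hLY hv)
  have hbw : blk w = 0 := (hblk w).2 ⟨fun h => hw (hcoreZ h), fun h => hw' (hcoreZ h)⟩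
  -- The undecided vertex `w` has the same label as its conjugate, so that a minimum cut that contains
  -- `w` contains its conjugate, too.
  have hne : (I.D.out S Y).card ≠ l := by
    intro e
    have hYcl := (hf.closed_iff hLY hLY').2 e
    have hlab : lab w = lab (I.D.σV w) := by
      rw [hZ, Set.mem_ofPred_eq] at hw hw'
      rw [I.D.σV_σV] at hw'
      omega
    have := hYcl.conn (heq w _ hbw (hblk' w hbw) hlab) (mem_coe.2 hwY)
    exact hY w hwY (mem_coe.1 this)
  have := hf.card Y hLY hLY'
  omega

/-- A finished search from `L` that has not met the conjugate of `L` has found the smallest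
minimum cut. -/
theorem core_of_dfs (hn : G.n = I.n) {blk rt : ℕ → ℕ} {nr lb : ℕ} {d : DfsState}
    (hd : DfsInv G cap blk rt nr lb d) (hsp : d.sp = 0) (hi : d.i = nr)
    (hblk : ∀ v, v < I.n → blk v = 0) (hrt : ∀ j < nr, ∃ v ∈ L, rt j = (v : Fin I.n))
    (hrt' : ∀ v ∈ L, ∃ j < nr, rt j = (v : Fin I.n)) :
    L ⊆ {v : Fin I.n | d.vis v ≠ 0} ∧ Closed G cap {v : Fin I.n | d.vis v ≠ 0} ∧
      ∀ X : Set (Fin I.n), L ⊆ X → Closed G cap X → {v : Fin I.n | d.vis v ≠ 0} ⊆ X := by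
  refine ⟨fun v hv => ?_, ?_, fun X hX hXc v hv => ?_⟩
  · obtain ⟨j, hj, e⟩ := hrt' v hv
    rw [Set.mem_ofPred_eq, ← e]
    exact (hd.root j (hi ▸ hj)).1
  · rintro h hh ⟨hlt, hx⟩
    have hlt' : G.tgt h < I.n := hn ▸ G.tgt_lt h hh.1 hh.2.1
    exact ⟨hlt', (hd.vis_step hsp (hblk _ hlt) hx ⟨⟨h, hh, rfl, rfl⟩, hblk _ hlt'⟩).1⟩
  · obtain ⟨j, hj, -, -, hc⟩ := hd.lab v (hn.symm ▸ v.2) (hblk v v.2) hv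
    obtain ⟨u, hu, e⟩ := hrt j (hi ▸ hj)
    exact mem_coe.1 (hXc.conn hc (by rw [e, mem_coe]; exact hX hu))

end MulticutInstance

/-! ### Maximum flows on the word RAM -/

namespace MulticutInstance

variable (I : MulticutInstance)

/-- The vertices at which `f` is nonzero. -/
def vset (f : ℕ → ℕ) : Set (Fin I.n) := {v | f v ≠ 0}

/-- The arcs at which `f` is nonzero. -/
def aset (f : ℕ → ℕ) : Finset (Fin I.m) := Finset.univ.filter fun a => f a ≠ 0

variable {I}

@[simp] theorem mem_vset {f : ℕ → ℕ} {v : Fin I.n} : v ∈ I.vset f ↔ f v ≠ 0 := Iff.rfl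

@[simp] theorem mem_aset {f : ℕ → ℕ} {a : Fin I.m} : a ∈ I.aset f ↔ f a ≠ 0 := by simp [aset]

end MulticutInstance

namespace WordRAM

open WordRAM.Expr WordRAM.Prog MulticutInstance

variable {I : MulticutInstance} {G : AdjGraph} {mate : ℕ → ℕ} {M : ℕ} {s : State}

/-- The cells that hold the instance and its graph. -/
structure Static (I : MulticutInstance) (G : AdjGraph) (mate : ℕ → ℕ) (s : State) : Prop where
  n : s.reg rN = I.n
  m : s.reg rM = I.m
  d : s.reg rD = I.d
  t : s.reg rT = I.t
  k : s.reg rK = I.k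
  sv : ∀ v : Fin I.n, s.arr aSV v = I.D.σV v
  sa : ∀ a : Fin I.m, s.arr aSA a = I.D.σA a
  tl : ∀ a : Fin I.m, s.arr aTl a = I.D.tail a
  hd : ∀ a : Fin I.m, s.arr aHd a = I.D.head a
  fam : ∀ (i : Fin I.t) (j : Fin I.d), s.arr aFam (i * I.d + j) = I.family i j
  loaded : Loaded G s
  graph : I.HasGraph G mate
  mate : s.arr aMate = mate

/-- The program does not assign to the cells that hold the instance and its graph. -/
def Prog.keeps (p : Prog) : Bool :=
  [rN, rM, rD, rT, rK].all (fun x => !p.wr x) &&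
    [aSV, aSA, aTl, aHd, aFam, aFst, aNxt, aTgt, aSrc, aMate].all (fun a => !p.wa a)

theorem Static.frame {p : Prog} {s' : State} (h : Static I G mate s) (hf : Frame p s s')
    (hp : p.keeps = true) : Static I G mate s' := by
  simp only [Prog.keeps, List.all_cons, List.all_nil, Bool.and_true, Bool.and_eq_true,
    Bool.not_eq_true'] at hp
  obtain ⟨⟨h0, h1, h2, h3, h4⟩, a0, a1, a2, a3, a4, a6, a7, a8, a17, a18⟩ := hp
  exact
    { n := (hf.reg _ h0).trans h.n
      m := (hf.reg _ h1).trans h.m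
      d := (hf.reg _ h2).trans h.d
      t := (hf.reg _ h3).trans h.t
      k := (hf.reg _ h4).trans h.k
      sv := by rw [hf.arr _ a0]; exact h.sv
      sa := by rw [hf.arr _ a1]; exact h.sa
      tl := by rw [hf.arr _ a2]; exact h.tl
      hd := by rw [hf.arr _ a3]; exact h.hd
      fam := by rw [hf.arr _ a4]; exact h.fam
      loaded := ⟨(hf.arr _ a6).trans h.loaded.first, (hf.arr _ a7).trans h.loaded.nxt,
        (hf.arr _ a8).trans h.loaded.tgt, (hf.arr _ a17).trans h.loaded.src⟩
      mate := (hf.arr _ a18).trans h.mate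
      graph := h.graph }

/-- Set the capacities for the zero flow. -/
def initCap : Prog :=
  Prog.for rX rM
    (put aCap (add (.reg rX) (const 1)) (.eq (get aDel (.reg rX)) (const 0)) ;;
      put aCap (add (add (.reg rM) (.reg rX)) (const 1)) (const 0))

theorem initCap_spec (hs : Static I G mate s) :
    Tri M initCap s (30 * (I.m + 1)) fun s' => I.InitCap (I.aset (s.arr aDel)) (s'.arr aCap) := by
  refine Tri.for (fun i s' => ∀ a : Fin I.m, a < i → (s'.arr aCap (a + 1) ≠ 0 ↔ s.arr aDel a = 0) ∧
    s'.arr aCap (I.m + a + 1) = 0) 20 rfl rfl (by decide) (by simp) ?_ ?_ (by rw [hs.m]; omega)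
  · intro i s' hf hb hi hx hI
    refine Tri.straight rfl (by decide) fun _ => ?_
    have h1 := hf.reg rM rfl
    have h2 := hf.arr aDel rfl
    rw [hs.m] at h1 hi
    simp [exec, Safe, val, hx, h1, h2]
    refine ⟨?_, fun _ a ha => ?_⟩
    · split <;> simp [hb.pos]
    · have := a.2
      by_cases hai : (a : ℕ) = i
      · subst hai
        simp [Function.update_apply]
        omega
      · have := hI a (by omega)
        have hne : ¬ I.m + (a : ℕ) = i := by omega
        simp [Function.update_apply, hai, hne]
        exact ⟨by rw [← this.1]; omega, this.2⟩
  · intro s' hf hb hI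
    refine ⟨fun a => ?_, fun a => (hI a (by rw [hs.m]; exact a.2)).2⟩
    rw [(hI a (by rw [hs.m]; exact a.2)).1]; simp

/-- List the vertices in `aL` as roots, and mark all vertices as unvisited. -/
def prepRoots : Prog :=
  set rNr (const 0) ;;
    Prog.for rX rN
      (put aVis (.reg rX) (const 0) ;;
        cond (get aL (.reg rX))
          (put aRt (.reg rNr) (.reg rX) ;; set rNr (add (.reg rNr) (const 1))) skip)

theorem prepRoots_spec (hs : Static I G mate s) (hM : I.n ≤ M) :
    Tri M prepRoots s (40 * (I.n + 1)) fun s' => (∀ v, v < I.n → s'.arr aVis v = 0) ∧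
      s'.reg rNr ≤ I.n ∧
      (∀ j < s'.reg rNr, ∃ v ∈ I.vset (s.arr aL), s'.arr aRt j = (v : Fin I.n)) ∧
      ∀ v ∈ I.vset (s.arr aL), ∃ j < s'.reg rNr, s'.arr aRt j = (v : Fin I.n) := by
  refine Tri.seq 2 (28 * (I.n + 1) + 2) ?_ (by omega)
  refine Tri.straight rfl le_rfl fun hb => ⟨by simp [Safe, val], fun hf0 hb0 => ?_⟩
  refine Tri.for (fun i s' => (∀ v, v < i → s'.arr aVis v = 0) ∧ s'.reg rNr ≤ i ∧
    (∀ j < s'.reg rNr, ∃ v ∈ I.vset (s.arr aL), s'.arr aRt j = (v : Fin I.n)) ∧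
    ∀ v ∈ I.vset (s.arr aL), (v : ℕ) < i → ∃ j < s'.reg rNr, s'.arr aRt j = (v : Fin I.n)) 20
    rfl rfl (by decide) (by simp [exec, val]) ?_ ?_ ?_
  · rintro i s' hf hb1 hi hx ⟨h1, h2, h3, h4⟩
    have hL : s'.arr aL = s.arr aL := (hf.arr aL rfl).trans (hf0.arr aL rfl)
    rw [hf0.reg rN rfl, hs.n] at hi
    refine Tri.straight rfl (by decide) fun _ => ?_
    by_cases hLi : s.arr aL i = 0
    · simp [exec, Safe, val, hx, hL, hLi]
      refine fun _ => ⟨fun v hv => ?_, by omega, by simpa using h3, fun v hv hvi => ?_⟩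
      · rw [Function.update_apply]; split
        · rfl
        · exact h1 v (by omega)
      · refine h4 v hv (lt_of_le_of_ne hvi ?_)
        intro e; exact hv (by rw [e]; exact hLi)
    · simp [exec, Safe, val, hx, hL, hLi]
      refine ⟨⟨by omega, by omega⟩, fun _ => ⟨fun v hv => ?_, by omega, fun j hj => ?_,
        fun v hv hvi => ?_⟩⟩
      · rw [Function.update_apply]; split
        · rfl
        · exact h1 v (by omega)
      · rcases Nat.lt_or_eq_of_le hj with hj | rfl
        · rw [Function.update_of_ne (by omega)]
          simpa using h3 j hj
        · exact ⟨⟨i, hi⟩, hLi, by simp⟩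
      · rcases Nat.lt_or_eq_of_le hvi with hvi | hvi
        · obtain ⟨j, hj, e⟩ := h4 v hv hvi
          exact ⟨j, by omega, by rw [Function.update_of_ne (by omega)]; exact e⟩
        · exact ⟨s'.reg rNr, by omega, by simp [hvi]⟩
  · rintro s' hf hb1 ⟨h1, h2, h3, h4⟩
    have : (exec (set rNr (const 0)) s).reg rN = I.n := by simp [exec, hs.n]
    rw [this] at h1 h2 h4
    exact ⟨h1, h2, h3, fun v hv => h4 v hv v.2⟩
  · simp [exec, hs.n]; omega

/-- Look for a visited vertex whose conjugate is in `aL`; `rSink` becomes `n` if there is none. -/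
def findSink : Prog :=
  set rSink (.reg rN) ;;
    Prog.for rX rN
      (cond (get aVis (.reg rX)) (cond (get aL (get aSV (.reg rX))) (set rSink (.reg rX)) skip) skip)

theorem findSink_spec (hs : Static I G mate s) :
    Tri M findSink s (40 * (I.n + 1)) fun s' =>
      (s'.reg rSink = I.n ∧ ∀ v : Fin I.n, s.arr aVis v ≠ 0 → s.arr aL (I.D.σV v) = 0) ∨
      ∃ v : Fin I.n, s'.reg rSink = v ∧ s.arr aVis v ≠ 0 ∧ s.arr aL (I.D.σV v) ≠ 0 := by
  refine Tri.seq 2 (28 * (I.n + 1) + 2) ?_ (by omega)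
  refine Tri.straight rfl le_rfl fun hb => ⟨by simp [Safe, val, hb.reg], fun hf0 hb0 => ?_⟩
  refine Tri.for (fun i s' =>
      (s'.reg rSink = I.n ∧ ∀ v : Fin I.n, (v : ℕ) < i → s.arr aVis v ≠ 0 →
        s.arr aL (I.D.σV v) = 0) ∨
      ∃ v : Fin I.n, s'.reg rSink = v ∧ s.arr aVis v ≠ 0 ∧ s.arr aL (I.D.σV v) ≠ 0) 20
    rfl rfl (by decide) (by simp [exec, val, hs.n]) ?_ ?_ ?_
  · rintro i s' hf hb1 hi hx hI
    have hL : s'.arr aL = s.arr aL := (hf.arr aL rfl).trans (hf0.arr aL rfl)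
    have hV : s'.arr aVis = s.arr aVis := (hf.arr aVis rfl).trans (hf0.arr aVis rfl)
    have hS : s'.arr aSV = s.arr aSV := (hf.arr aSV rfl).trans (hf0.arr aSV rfl)
    rw [hf0.reg rN rfl, hs.n] at hi
    refine Tri.straight rfl (by decide) fun _ => ?_
    have hsv := hs.sv ⟨i, hi⟩
    simp only at hsv
    by_cases h1 : s.arr aVis i ≠ 0 ∧ s.arr aL (I.D.σV ⟨i, hi⟩) ≠ 0
    · simp [exec, Safe, val, hx, hL, hV, hS, h1.1, h1.2, hsv, hb1.reg]
      refine ⟨by rw [← hx]; exact hb1.reg _, fun _ => .inr ⟨⟨i, hi⟩, rfl, h1⟩⟩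
    · have h2 : ∀ v : Fin I.n, (v : ℕ) = i → s.arr aVis v ≠ 0 → s.arr aL (I.D.σV v) = 0 := by
        rintro v rfl h2
        by_contra h3
        exact h1 ⟨h2, h3⟩
      by_cases h3 : s.arr aVis i = 0
      · simp [exec, Safe, val, hx, hL, hV, hS, h3]
        refine fun _ => hI.imp (fun h => ⟨h.1, fun v hv hv' => ?_⟩) fun h => h
        rcases Nat.lt_or_eq_of_le hv with hv | hv
        · exact h.2 v hv hv'
        · exact h2 v hv hv'
      · have h4 := h2 ⟨i, hi⟩ rfl h3
        simp [exec, Safe, val, hx, hL, hV, hS, h3, hsv, h4]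
        refine fun _ => hI.imp (fun h => ⟨h.1, fun v hv hv' => ?_⟩) fun h => h
        rcases Nat.lt_or_eq_of_le hv with hv | hv
        · exact h.2 v hv hv'
        · exact h2 v hv hv'
  · rintro s' hf hb1 hI
    refine hI.imp (fun h => ⟨h.1, fun v => h.2 v ?_⟩) fun h => h
    rw [hf0.reg rN rfl, hs.n]; exact v.2
  · simp [exec, hs.n]; omega

end WordRAM

namespace WordRAM

open WordRAM.Expr WordRAM.Prog MulticutInstance

variable {I : MulticutInstance} {G : AdjGraph} {mate : ℕ → ℕ} {M : ℕ} {s : State}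

/-- Augment the flow along the path on which the search has visited the vertex `rSink`. -/
def augment : Prog :=
  (set rV (.reg rSink) ;; set rE (get aPar (.reg rV))) ;;
    loop (.reg rE)
      (put aCap (.reg rE) (const 0) ;;
        put aCap (get aMate (.reg rE)) (const 1) ;;
        set rV (get aSrc (.reg rE)) ;;
        set rE (get aPar (.reg rV)))

/-- The path is followed backwards from the sink. Meanwhile, the flow has an excess of one unit at the
current vertex. The vertices on the path are met in increasing finishing order, whence the arcs that
lie ahead keep their capacities. -/
theorem augment_spec (hs : Static I G mate s) {S : Finset (Fin I.m)} {L : Set (Fin I.n)}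
    {cap blk rt : ℕ → ℕ} {nr lb l : ℕ} (hcap : s.arr aCap = cap)
    (hd : DfsInv G cap blk rt nr lb s.dfs) (hsp : s.reg rSp = 0) (hi : s.reg rI = nr)
    (hblk : ∀ v, v < I.n → blk v = 0) (hrt : ∀ j < nr, ∃ v ∈ L, rt j = (v : Fin I.n))
    (hf : I.FlowInv G mate S L cap l) {t : Fin I.n} (ht : s.reg rSink = t)
    (htv : s.arr aVis t ≠ 0) (htL : I.D.σV t ∈ L) :
    Tri M augment s (40 * (I.n + 1)) fun s' => I.FlowInv G mate S L (s'.arr aCap) (l + 1) := by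
  classical
  have hn := hs.graph.n_eq
  obtain ⟨p₀, hp₀, ep₀⟩ := hd.finished hsp (hn.symm ▸ t.2) (hblk t t.2) htv
  have hlive' : ∀ q < s.dfs.cnt, s.dfs.par (s.dfs.ord q) ≠ 0 →
      G.Live cap (s.dfs.par (s.dfs.ord q)) ∧ G.tgt (s.dfs.par (s.dfs.ord q)) = s.dfs.ord q ∧
      ∃ k < s.dfs.cnt, q < k ∧ G.src (s.dfs.par (s.dfs.ord q)) = s.dfs.ord k := by
    intro q hq hpar
    obtain ⟨h1, h2, h3⟩ := (hd.par_ord q hq).resolve_left fun h => hpar h.1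
    refine ⟨h1, h2, h3.resolve_right ?_⟩
    rintro ⟨k, hk, -⟩
    exact absurd hk (by simp [State.dfs, hsp])
  refine Tri.seq 6 (30 * (I.n + 1) + 2) ?_ (by omega)
  refine Tri.straight rfl (by decide) fun hb => ⟨by simp [Safe, exec, val, hb.reg, hb.arr],
    fun hf0 hb0 => ?_⟩
  have hcn := hd.cnt_le
  rw [hn] at hcn
  refine Tri.loop_ghost (fun p s' => p < s.dfs.cnt ∧ s'.reg rV = s.dfs.ord p ∧
      s'.reg rE = s.dfs.par (s.dfs.ord p) ∧ G.Paired mate (s'.arr aCap) ∧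
      (∀ X : Set (Fin I.n), L ⊆ X → (∀ v ∈ L, I.D.σV v ∉ X) → (I.D.out S X).card =
        G.leaving (s'.arr aCap) (Mem X) + l + if Mem X (s.dfs.ord p) then 1 else 0) ∧
      ∀ q, p ≤ q → q < s.dfs.cnt → s.dfs.par (s.dfs.ord q) ≠ 0 →
        s'.arr aCap (s.dfs.par (s.dfs.ord q)) ≠ 0) (fun p => s.dfs.cnt - p) 20 (by decide) p₀
    ?_ ?_ ?_ ?_
  · have hpar : s.arr aPar = s.dfs.par := rfl
    simp only [exec, val, State.setReg_reg, State.setReg_arr, hcap, if_pos, ht, ep₀, hpar]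
    refine ⟨hp₀, by simp, trivial, hf.paired, fun X hX hX' => ?_, fun q _ hq hne => ?_⟩
    · rw [if_neg, hf.card X hX hX', add_zero]
      rw [mem_coe]
      have := hX' _ htL
      rwa [I.D.σV_σV] at this
    · exact (hlive' q hq hne).1.2.2
  · rintro p s' hf1 hb1 ⟨hp, hv, he, hpair, hcard, hcapl⟩ hne
    simp only [val] at hne
    have hcap1 := hcapl p le_rfl hp (he ▸ hne)
    obtain ⟨h1, h2, p', hp', hpp, hsrc⟩ := hlive' p hp (he ▸ hne)
    refine ⟨p', by omega, ?_⟩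
    set h := s.dfs.par (s.dfs.ord p)
    have hL : G.Live (s'.arr aCap) h := ⟨h1.1, h1.2.1, hcap1⟩
    have hm : s'.arr aMate = mate := ((hf1.arr aMate rfl).trans (hf0.arr aMate rfl)).trans hs.mate
    have hsr : s'.arr aSrc = G.src :=
      ((hf1.arr aSrc rfl).trans (hf0.arr aSrc rfl)).trans hs.loaded.src
    have hpar : s'.arr aPar = s.dfs.par := (hf1.arr aPar rfl).trans (hf0.arr aPar rfl)
    have hS : ∀ x, G.src x ≤ M := fun x => hsr ▸ hb1.arr _ _
    have hP : ∀ x, s.dfs.par x ≤ M := fun x => hpar ▸ hb1.arr _ _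
    refine Tri.straight rfl (by decide) fun _ => ?_
    have hflip := fun X : Set (Fin I.n) => AdjGraph.leaving_flip hpair hL (Mem X)
    have hpair' := hpair.flip hL
    simp only [AdjGraph.flip] at hflip hpair'
    simp [exec, Safe, val, he, hm, hsr, hpar, hsrc, hb1.pos, hP, hp', hpair']
    refine ⟨by rw [← hsrc]; exact hS _, fun X hX hX' => ?_, fun q hq1 hq2 hq3 => ?_⟩
    · have e1 := hflip X
      have e2 := hcard X hX hX'
      rw [h2, hsrc] at e1
      omega
    · have e1 := hcapl q (by omega) hq2 hq3
      have e2 : s.dfs.par (s.dfs.ord q) ≠ h := by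
        intro e
        have e3 := (hlive' q hq2 hq3).2.1
        rw [e, h2] at e3
        have := hd.ord_inj p hp q hq2 e3
        omega
      rw [Function.update_apply]
      split
      · exact one_ne_zero
      · rwa [Function.update_of_ne e2]
  · rintro p s' hf1 hb1 ⟨hp, hv, he, hpair, hcard, hcapl⟩ h0
    simp only [val] at h0
    refine ⟨hpair, fun X hX hX' => ?_⟩
    rcases hd.par_ord p hp with ⟨-, k, hk, e⟩ | ⟨h1, -⟩
    · obtain ⟨v, hv, e'⟩ := hrt k (hi ▸ hk)
      have := hcard X hX hX'
      rw [if_pos (by rw [e, e', mem_coe]; exact hX hv)] at this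
      omega
    · exact absurd (he.symm.trans h0) (by have := h1.1; omega)
  · simp only [cost]
    have : (s.dfs.cnt - p₀ + 1) * (20 + 1 + 1) ≤ (I.n + 1) * 22 := by
      apply Nat.mul_le_mul <;> omega
    omega

end WordRAM

namespace MulticutInstance

variable {I : MulticutInstance}

/-- `C` is the smallest residually closed set that contains `L`, and it separates `L` from its
conjugate. -/
structure IsCore (I : MulticutInstance) (G : AdjGraph) (cap : ℕ → ℕ) (L C : Set (Fin I.n)) :
    Prop where
  subset : L ⊆ C
  avoids : ∀ v ∈ L, I.D.σV v ∉ C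
  closed : Closed G cap C
  min : ∀ X : Set (Fin I.n), L ⊆ X → Closed G cap X → C ⊆ X

end MulticutInstance

namespace WordRAM

open WordRAM.Expr WordRAM.Prog MulticutInstance

variable {I : MulticutInstance} {G : AdjGraph} {mate : ℕ → ℕ} {M : ℕ} {s : State}

/-- Search the residual graph from the vertices in `aL`. -/
def search : Prog := prepRoots ;; set rLb (const 0) ;; dfs ;; findSink

theorem search_spec (hs : Static I G mate s) (hM : I.n ≤ M) :
    Tri M search s (300 * (I.n + I.m + 1)) fun s' => ∃ blk rt nr,
      DfsInv G (s.arr aCap) blk rt nr 0 s'.dfs ∧ s'.reg rSp = 0 ∧ s'.reg rI = nr ∧ nr ≤ I.n ∧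
      (∀ v, v < I.n → blk v = 0) ∧ (∀ j < nr, ∃ v ∈ I.vset (s.arr aL), rt j = (v : Fin I.n)) ∧
      (∀ v ∈ I.vset (s.arr aL), ∃ j < nr, rt j = (v : Fin I.n)) ∧
      ((s'.reg rSink = I.n ∧ ∀ v : Fin I.n, s'.arr aVis v ≠ 0 → s.arr aL (I.D.σV v) = 0) ∨
        ∃ v : Fin I.n, s'.reg rSink = v ∧ s'.arr aVis v ≠ 0 ∧ s.arr aL (I.D.σV v) ≠ 0) := by
  have hn := hs.graph.n_eq
  have hH := hs.graph.H_eq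
  refine Tri.seq (40 * (I.n + 1)) (260 * (I.n + I.m + 1)) ?_ (by omega)
  refine Tri.mono (prepRoots_spec hs hM) le_rfl fun s₁ _ _ h1 hf1 hb1 => ?_
  refine Tri.seq 2 (258 * (I.n + I.m + 1)) ?_ (by omega)
  refine Tri.straight rfl le_rfl fun _ => ⟨Nat.zero_le _, fun hf2 hb2 => ?_⟩
  set s₂ := exec (set rLb (const 0)) s₁
  have hs2 : Static I G mate s₂ := (hs.frame hf1 rfl).frame hf2 rfl
  have hnr : s₂.reg rNr = s₁.reg rNr := hf2.reg _ rfl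
  refine Tri.seq (66 * (G.H + G.n + s₁.reg rNr + 2)) (40 * (I.n + 1)) ?_ (by omega)
  refine Tri.mono (dfs_spec (lb := 0) (hn ▸ hM) (by omega) hs2.loaded
    (((hf2.arr aCap rfl).trans (hf1.arr aCap rfl))) rfl rfl hnr ?_ (by rfl)) le_rfl
    fun s₃ _ _ h3 hf3 hb3 => ?_
  · intro j hj
    obtain ⟨v, -, e⟩ := h1.2.2.1 j hj
    rw [hf2.arr aRt rfl, e, hn]
    exact v.2
  have hs3 := hs2.frame hf3 rfl
  refine Tri.mono (findSink_spec hs3) le_rfl fun s₄ _ hf4 h4 => ?_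
  have hdfs : s₄.dfs = s₃.dfs := by
    simp only [State.dfs, hf4.arr aVis rfl, hf4.arr aPar rfl, hf4.arr aCur rfl, hf4.arr aStk rfl,
      hf4.arr aOrd rfl, hf4.reg rSp rfl, hf4.reg rCnt rfl, hf4.reg rI rfl]
  have hL : s₃.arr aL = s.arr aL :=
    ((hf3.arr aL rfl).trans (hf2.arr aL rfl)).trans (hf1.arr aL rfl)
  rw [hL] at h4
  refine ⟨s₂.arr aVis, s₂.arr aRt, s₁.reg rNr, hdfs ▸ h3.1, (hf4.reg _ rfl).trans h3.2.1,
    (hf4.reg _ rfl).trans h3.2.2, h1.2.1, ?_, ?_, ?_, ?_⟩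
  · rw [hf2.arr aVis rfl]; exact h1.1
  · rw [hf2.arr aRt rfl]; exact h1.2.2.1
  · rw [hf2.arr aRt rfl]; exact h1.2.2.2
  · rw [hf4.arr aVis rfl]; exact h4

/-- Augment the flow from `aL` to its conjugate until it is maximum or exceeds `rBud`. In the
second case set `rFail`. -/
def maxFlow : Prog :=
  (set rFlow (const 0) ;; set rGo (const 1) ;; set rFail (const 0)) ;;
    loop (.reg rGo)
      (search ;;
        cond (.lt (.reg rSink) (.reg rN))
          (cond (.lt (.reg rFlow) (.reg rBud))
            (augment ;; set rFlow (add (.reg rFlow) (const 1)))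
            (set rFail (const 1) ;; set rGo (const 0)))
          (set rGo (const 0)))

theorem maxFlow_spec (hs : Static I G mate s) (hM : I.n ≤ M) {S : Finset (Fin I.m)}
    (hcap : I.InitCap S (s.arr aCap)) :
    Tri M maxFlow s (500 * ((s.reg rBud + 2) * (I.n + I.m + 1))) fun s' =>
      (s'.reg rFail ≠ 0 ∧ ∀ X, I.vset (s.arr aL) ⊆ X → (∀ v ∈ I.vset (s.arr aL), I.D.σV v ∉ X) →
        s.reg rBud + 1 ≤ (I.D.out S X).card) ∨
      (s'.reg rFail = 0 ∧ s'.reg rFlow ≤ s.reg rBud ∧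
        I.FlowInv G mate S (I.vset (s.arr aL)) (s'.arr aCap) (s'.reg rFlow) ∧
        I.IsCore G (s'.arr aCap) (I.vset (s.arr aL)) (I.vset (s'.arr aVis)) ∧
        ∀ v : Fin I.n, s'.arr aVis v ≤ I.n) := by
  have hn := hs.graph.n_eq
  set L := I.vset (s.arr aL) with hLdef
  refine Tri.seq 6 (400 * ((s.reg rBud + 2) * (I.n + I.m + 1))) ?_ ?_
  swap
  · have : 1 * 1 ≤ (s.reg rBud + 2) * (I.n + I.m + 1) := Nat.mul_le_mul (by omega) (by omega)
    omega
  refine Tri.straight rfl (by decide) fun hb => ⟨by simp [Safe, exec, val, hb.pos],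
    fun hf0 hb0 => ?_⟩
  have hbud0 := hf0.reg rBud rfl
  refine Tri.loop (fun s' => I.FlowInv G mate S L (s'.arr aCap) (s'.reg rFlow) ∧
      s'.reg rFlow ≤ s.reg rBud ∧
      ((s'.reg rGo ≠ 0 ∧ s'.reg rFail = 0) ∨
      (s'.reg rGo = 0 ∧ s'.reg rFail ≠ 0 ∧ ∀ X, L ⊆ X → (∀ v ∈ L, I.D.σV v ∉ X) →
        s.reg rBud + 1 ≤ (I.D.out S X).card) ∨
      (s'.reg rGo = 0 ∧ s'.reg rFail = 0 ∧ I.IsCore G (s'.arr aCap) L (I.vset (s'.arr aVis)) ∧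
        ∀ v : Fin I.n, s'.arr aVis v ≤ I.n)))
    (fun s' => if s'.reg rGo = 0 then 0 else s.reg rBud + 1 - s'.reg rFlow)
    (390 * (I.n + I.m + 1)) (by decide) ?_ ?_ ?_ ?_
  · refine ⟨?_, ?_, .inl ?_⟩
    · simpa [exec, val] using FlowInv.init hs.graph hcap
    · simp [exec, val]
    · simp [exec, val]
  · rintro s₁ hf1 hb1 ⟨hfl, hle, hcase⟩ hgo
    simp only [val] at hgo
    have hs1 : Static I G mate s₁ := (hs.frame hf0 rfl).frame hf1 rfl
    have hL1 : s₁.arr aL = s.arr aL := (hf1.arr aL rfl).trans (hf0.arr aL rfl)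
    have hbud : s₁.reg rBud = s.reg rBud := (hf1.reg rBud rfl).trans hbud0
    have hfail : s₁.reg rFail = 0 := by
      rcases hcase with h | h | h
      · exact h.2
      · exact absurd h.1 hgo
      · exact absurd h.1 hgo
    rw [if_neg hgo]
    refine Tri.seq (300 * (I.n + I.m + 1)) (80 * (I.n + I.m + 1)) ?_ (by omega)
    refine Tri.mono (search_spec hs1 hM) le_rfl fun s₂ hb2 _ h2 hf2 _ => ?_
    obtain ⟨blk, rt, nr, hd, hsp, hi, hnr, hblk, hrt, hrt', hsink⟩ := h2
    rw [hL1] at hrt hrt' hsink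
    have hs2 := hs1.frame hf2 rfl
    have hcap2 : s₂.arr aCap = s₁.arr aCap := hf2.arr aCap rfl
    have hcore := core_of_dfs (cap := s₁.arr aCap) hn hd hsp hi hblk hrt hrt'
    have hflow2 : s₂.reg rFlow = s₁.reg rFlow := hf2.reg _ rfl
    have hbud2 : s₂.reg rBud = s.reg rBud := (hf2.reg _ rfl).trans hbud
    have hgo2 : s₂.reg rGo = s₁.reg rGo := hf2.reg _ rfl
    have hfail2 : s₂.reg rFail = 0 := (hf2.reg _ rfl).trans hfail
    refine Tri.cond (70 * (I.n + I.m + 1)) (by decide) ?_ ?_ (by simp [cost]; omega)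
    · intro hlt
      have hlt' : s₂.reg rSink < I.n := by
        by_contra h
        simp [val, hs2.n, h] at hlt
      obtain ⟨t, ht, htv, htL⟩ := hsink.resolve_left fun h => by omega
      refine Tri.cond (60 * (I.n + I.m + 1)) (by decide) ?_ ?_ (by simp [cost]; omega)
      · intro hfb
        have hfb' : s₁.reg rFlow < s.reg rBud := by
          by_contra h
          simp [val, hflow2, hbud2, h] at hfb
        refine Tri.seq (40 * (I.n + 1)) 4 ?_ (by omega)
        refine Tri.mono (augment_spec hs2 (l := s₁.reg rFlow) hcap2 hd hsp hi hblk hrt hfl ht htv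
          htL) le_rfl fun s₃ _ _ h3 hf3 hb3 => ?_
        have e1 : s₃.reg rFlow = s₁.reg rFlow := (hf3.reg _ rfl).trans hflow2
        have e2 : s₃.reg rGo = s₁.reg rGo := (hf3.reg _ rfl).trans hgo2
        have e3 : s₃.reg rFail = 0 := (hf3.reg _ rfl).trans hfail2
        have e4 := hb1.reg rBud
        refine Tri.straight rfl (by decide) fun _ => ?_
        simp [exec, Safe, val, e1, e2, e3, hgo]
        exact ⟨by omega, ⟨h3, by omega⟩, by omega⟩
      · intro hfb
        have hfb' : s.reg rBud ≤ s₁.reg rFlow := by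
          by_contra h
          have : s₁.reg rFlow < s.reg rBud := by omega
          simp [val, hflow2, hbud2, this] at hfb
        refine Tri.straight rfl (by simp [cst, cost]; omega) fun _ => ?_
        simp [exec, Safe, val, hcap2, hflow2, hb2.pos]
        refine ⟨⟨hfl, hle, fun X hX hX' => ?_⟩, by omega⟩
        -- Residually closed sets that contain `L` contain the sink.
        have h1 := hfl.card X hX hX'
        have h2 : G.leaving (s₁.arr aCap) (Mem X) ≠ 0 := by
          rw [Ne, AdjGraph.leaving_eq_zero]
          intro hcl
          have h3 : t ∈ X := hcore.2.2 X hX hcl htv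
          have h4 := hX' (I.D.σV t) htL
          rw [I.D.σV_σV] at h4
          exact h4 h3
        omega
    · intro hlt
      refine Tri.straight rfl (by simp [cst, cost]; omega) fun _ => ?_
      have hno : ∀ v : Fin I.n, s₂.arr aVis v ≠ 0 → s.arr aL (I.D.σV v) = 0 := by
        rcases hsink with h | ⟨v, h, -⟩
        · exact h.2
        · have := v.2
          rw [← h] at this
          simp [val, hs2.n, this] at hlt
      simp [exec, Safe, val, hcap2, hflow2, hfail2]
      refine ⟨⟨hfl, hle, ⟨hcore.1, fun v hv hv' => ?_, hcore.2.1, hcore.2.2⟩, fun v => ?_⟩, by omega⟩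
      · have := hno _ hv'
        rw [I.D.σV_σV] at this
        exact hv this
      · rcases Nat.eq_zero_or_pos (s₂.arr aVis v) with h | h
        · omega
        · obtain ⟨j, hj, e, -⟩ := hd.lab v (hn.symm ▸ v.2) (hblk v v.2) h.ne'
          have e' : s₂.arr aVis v = 0 + j + 1 := e
          have hj' : j < s₂.reg rI := hj
          omega
  · rintro s₁ hf1 hb1 ⟨hfl, hle, hcase⟩ hgo
    simp only [val] at hgo
    rcases hcase with h | h | h
    · exact absurd hgo h.1
    · exact .inl h.2
    · exact .inr ⟨h.2.1, hle, hfl, h.2.2⟩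
  · have e : s.reg rBud + 1 + 1 = s.reg rBud + 2 := rfl
    simp [exec, val, cost]
    rw [e]
    have : (s.reg rBud + 2) * (390 * (I.n + I.m + 1) + 1 + 1) ≤
      (s.reg rBud + 2) * (400 * (I.n + I.m + 1)) := Nat.mul_le_mul_left _ (by omega)
    refine this.trans (le_of_eq (by ring))

end WordRAM

/-! ### Maximal minimum cuts on the word RAM -/

namespace WordRAM

open WordRAM.Expr WordRAM.Prog MulticutInstance

variable {I : MulticutInstance} {G : AdjGraph} {mate : ℕ → ℕ} {M : ℕ} {s : State}

/-- Prepare the search among the vertices outside the core and its conjugate. -/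
def blockCore : Prog :=
  Prog.for rX rN (put aCore (.reg rX) (get aVis (.reg rX))) ;;
    Prog.for rX rN (put aVis (.reg rX) (add (get aCore (.reg rX)) (get aCore (get aSV (.reg rX))))) ;;
    Prog.for rX rN (put aRt (.reg rX) (.reg rX)) ;;
    (set rNr (.reg rN) ;; set rLb (const 0))

theorem blockCore_spec (hs : Static I G mate s) (hM : 2 * I.n ≤ M)
    (hv : ∀ v : Fin I.n, s.arr aVis v ≤ I.n) :
    Tri M blockCore s (60 * (I.n + 1)) fun s' =>
      (∀ v : Fin I.n, s'.arr aCore v = s.arr aVis v) ∧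
      (∀ v : Fin I.n, s'.arr aVis v = 0 ↔ s.arr aVis v = 0 ∧ s.arr aVis (I.D.σV v) = 0) ∧
      (∀ v, v < I.n → s'.arr aRt v = v) ∧ s'.reg rNr = I.n ∧ s'.reg rLb = 0 := by
  refine Tri.seq ((I.n + 1) * 12 + 2) (40 * (I.n + 1)) ?_ (by omega)
  refine Tri.mono (Tri.fill 0 (s.arr aVis) (by decide) (by decide) (by decide) ?_
    (fun hb i _ => hb.arr _ _) (by rw [hs.n]; simp [cost])) le_rfl fun s₁ _ _ h1 hf1 hb1 => ?_
  · intro i s' hf hb hi hx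
    simp [val, hx, hf.arr aVis rfl]
  have hs1 := hs.frame hf1 rfl
  have hc1 : ∀ v, v < I.n → s₁.arr aCore v = s.arr aVis v := fun v hv => by
    simpa using h1.1 v (by rwa [hs.n])
  refine Tri.seq ((I.n + 1) * 16 + 2) (22 * (I.n + 1)) ?_ (by omega)
  refine Tri.mono (Tri.fill 0 (fun i => s₁.arr aCore i + s₁.arr aCore (s₁.arr aSV i)) (by decide)
    (by decide) (by decide) ?_ ?_ (by rw [hs1.n]; simp [cost])) le_rfl fun s₂ _ _ h2 hf2 hb2 => ?_
  · intro i s' hf hb hi hx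
    simp [val, hx, hf.arr aCore rfl, hf.arr aSV rfl]
  · intro _ i hi
    rw [hs1.n] at hi
    have h3 := hs1.sv ⟨i, hi⟩
    simp only at h3
    have h4 := hv ⟨i, hi⟩
    have h5 := hv (I.D.σV ⟨i, hi⟩)
    simp only at h4
    rw [h3, hc1 i hi, hc1 _ (Fin.is_lt _)]
    omega
  have hs2 := hs1.frame hf2 rfl
  refine Tri.seq ((I.n + 1) * 11 + 2) 4 ?_ (by omega)
  refine Tri.mono (Tri.fill 0 (fun i => i) (by decide)
    (by decide) (by decide) ?_ ?_ (by rw [hs2.n]; simp [cost])) le_rfl fun s₃ _ _ h3 hf3 hb3 => ?_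
  · intro i s' hf hb hi hx
    simp [val, hx]
  · intro _ i hi
    rw [hs2.n] at hi
    omega
  have hs3 := hs2.frame hf3 rfl
  refine Tri.straight rfl (by decide) fun hb => ⟨by simp [exec, Safe, val, hb.reg], ?_⟩
  simp only [exec, val, State.setReg_arr, State.setReg_reg]
  refine ⟨fun v => ?_, fun v => ?_, fun v hv => ?_, by simp [hs3.n], by simp⟩
  · rw [hf3.arr aCore rfl, hf2.arr aCore rfl, hc1 _ v.2]
  · rw [hf3.arr aVis rfl]
    have := h2.1 v (by rw [hs1.n]; exact v.2)
    rw [zero_add, hc1 _ v.2, hs1.sv, hc1 _ (Fin.is_lt _)] at this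
    rw [this, Nat.add_eq_zero_iff]
  · simpa using h3.1 v (by rwa [hs2.n])

/-- Exchange the capacities of opposite arcs. -/
def reverseCap : Prog :=
  Prog.for rX rM
    (set rTmp (get aCap (add (.reg rX) (const 1))) ;;
      put aCap (add (.reg rX) (const 1)) (get aCap (add (add (.reg rM) (.reg rX)) (const 1))) ;;
      put aCap (add (add (.reg rM) (.reg rX)) (const 1)) (.reg rTmp))

theorem reverseCap_spec (hs : Static I G mate s) :
    Tri M reverseCap s (40 * (I.m + 1)) fun s' =>
      ∀ h, 1 ≤ h → h ≤ G.H → s'.arr aCap (mate h) = s.arr aCap h := by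
  refine Tri.for (fun i s' => ∀ a : Fin I.m,
      (a < i → s'.arr aCap (a + 1) = s.arr aCap (I.m + a + 1) ∧
        s'.arr aCap (I.m + a + 1) = s.arr aCap (a + 1)) ∧
      (i ≤ a → s'.arr aCap (a + 1) = s.arr aCap (a + 1) ∧
        s'.arr aCap (I.m + a + 1) = s.arr aCap (I.m + a + 1)))
    28 rfl rfl (by decide) (by simp) ?_ ?_ (by rw [hs.m]; omega)
  · intro i s' hf hb hi hx hI
    have h1 := hf.reg rM rfl
    rw [hs.m] at h1 hi
    have hi1 := (hI ⟨i, hi⟩).2 le_rfl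
    simp only at hi1
    refine Tri.straight rfl (by decide) fun _ => ?_
    simp [exec, Safe, val, hx, h1, hb.arr, hi1]
    have b1 := hb.arr aCap (i + 1)
    have b2 := hb.arr aCap (I.m + i + 1)
    rw [hi1.1] at b1
    rw [hi1.2] at b2
    refine ⟨by omega, fun _ a => ?_⟩
    · have ha := a.2
      have h2 := hI a
      have hne : ¬ I.m + (a : ℕ) = i := by omega
      have hne' : ¬ (a : ℕ) = I.m + i := by omega
      by_cases hai : (a : ℕ) = i
      · subst hai
        simp [Function.update_apply, hne']
        omega
      · simp only [Function.update_apply, add_left_inj, hne', hai, hne, if_false, add_right_inj,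
          hi1.2]
        refine ⟨fun h => h2.1 (by omega), fun h => h2.2 (by omega)⟩
  · intro s' hf hb hI h h1 h2
    rcases hs.graph.cases h1 h2 with ⟨a, rfl⟩ | ⟨a, rfl⟩
    · rw [hs.graph.mate_lo]; exact ((hI a).1 (by rw [hs.m]; exact a.2)).2
    · rw [hs.graph.mate_hi]; exact ((hI a).1 (by rw [hs.m]; exact a.2)).1

/-- Prepare the second search, which takes the roots in decreasing finishing order. The core gets the
label `n + 2`, its conjugate the label `1`, and the search will use the labels in between. -/
def relabel : Prog :=
  Prog.for rX rN
    (cond (get aCore (.reg rX)) (put aVis (.reg rX) (add (.reg rN) (const 2)))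
      (cond (get aCore (get aSV (.reg rX))) (put aVis (.reg rX) (const 1))
        (put aVis (.reg rX) (const 0)))) ;;
    Prog.for rX rCnt (put aRt (.reg rX) (get aOrd (sub (sub (.reg rCnt) (const 1)) (.reg rX)))) ;;
    (set rNr (.reg rCnt) ;; set rLb (const 1))

theorem relabel_spec (hs : Static I G mate s) (hM : I.n + 2 ≤ M) (hcnt : s.reg rCnt ≤ I.n) :
    Tri M relabel s (60 * (I.n + 1)) fun s' =>
      (∀ v : Fin I.n, s'.arr aVis v = if s.arr aCore v ≠ 0 then I.n + 2 else
        if s.arr aCore (I.D.σV v) ≠ 0 then 1 else 0) ∧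
      (∀ j < s.reg rCnt, s'.arr aRt j = s.arr aOrd (s.reg rCnt - 1 - j)) ∧
      s'.reg rNr = s.reg rCnt ∧ s'.reg rLb = 1 := by
  refine Tri.seq ((I.n + 1) * 28 + 2) (24 * (I.n + 1)) ?_ (by omega)
  refine Tri.mono (Tri.for (B := (I.n + 1) * 28 + 2) (fun i s' => ∀ v : Fin I.n, v < i →
      s'.arr aVis v = if s.arr aCore v ≠ 0 then I.n + 2 else
        if s.arr aCore (I.D.σV v) ≠ 0 then 1 else 0) 20 rfl rfl (by decide) (by simp) ?_
    (fun s' _ _ h => h) (by rw [hs.n])) le_rfl fun s₁ _ _ h1 hf1 hb1 => ?_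
  · intro i s' hf hb hi hx hI
    have h1 := hf.reg rN rfl
    rw [hs.n] at h1 hi
    have h2 := hf.arr aCore rfl
    have h3 := hf.arr aSV rfl
    have h4 := hs.sv ⟨i, hi⟩
    simp only at h4
    refine Tri.straight rfl (by decide) fun _ => ?_
    have key : ∀ v : Fin I.n, (v : ℕ) ≤ i → v ≠ ⟨i, hi⟩ → (v : ℕ) ≠ i ∧ (v : ℕ) < i := by
      intro v hv hne
      have : (v : ℕ) ≠ i := fun e => hne (Fin.ext e)
      exact ⟨this, by omega⟩
    by_cases hc : s.arr aCore i = 0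
    · by_cases hc' : s.arr aCore (I.D.σV ⟨i, hi⟩) = 0
      · simp [exec, Safe, val, hx, h1, h2, h3, h4, hc, hc']
        intro _ v hv
        by_cases hvi : v = ⟨i, hi⟩
        · subst hvi; simp [hc, hc']
        · rw [Function.update_of_ne (key v hv hvi).1]
          simpa using hI v (key v hv hvi).2
      · simp [exec, Safe, val, hx, h1, h2, h3, h4, hc, hc', hb.pos]
        intro _ v hv
        by_cases hvi : v = ⟨i, hi⟩
        · subst hvi; simp [hc, hc']
        · rw [Function.update_of_ne (key v hv hvi).1]
          simpa using hI v (key v hv hvi).2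
    · simp [exec, Safe, val, hx, h1, h2, h3, h4, hc]
      refine ⟨hM, fun _ v hv => ?_⟩
      by_cases hvi : v = ⟨i, hi⟩
      · subst hvi; simp [hc]
      · rw [Function.update_of_ne (key v hv hvi).1]
        simpa using hI v (key v hv hvi).2
  rw [hs.n] at h1
  have hc1 : s₁.reg rCnt = s.reg rCnt := hf1.reg _ rfl
  have ho1 : s₁.arr aOrd = s.arr aOrd := hf1.arr _ rfl
  refine Tri.seq ((I.n + 1) * 16 + 2) 4 ?_ (by omega)
  refine Tri.mono (Tri.fill 0 (fun i => s₁.arr aOrd (s₁.reg rCnt - 1 - i)) (by decide)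
    (by decide) (by decide) ?_ (fun hb i _ => hb.arr _ _) (B := (I.n + 1) * 16 + 2) ?_) le_rfl
    fun s₂ _ _ h2 hf2 hb2 => ?_
  · intro i s' hf hb hi hx
    simp [val, hx, hf.arr aOrd rfl, hf.reg rCnt rfl]
  · simp only [cost, Nat.add_le_add_iff_right, hc1]
    apply Nat.mul_le_mul <;> omega
  refine Tri.straight rfl (by decide) fun hb => ⟨by simp [exec, Safe, val, hb.reg, hb.pos], ?_⟩
  simp only [exec, val, State.setReg_arr, State.setReg_reg]
  refine ⟨fun v => ?_, fun j hj => ?_, ?_, by simp⟩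
  · rw [hf2.arr aVis rfl]; exact h1 v v.2
  · rw [← ho1, ← hc1]; simpa using h2.1 j (by rwa [hc1])
  · simp [hf2.reg rCnt rfl, hc1]

/-- Replace `aL` by a maximal consistent minimum cut, given a maximum flow and its core. -/
def maxCut : Prog :=
  blockCore ;; dfs ;; reverseCap ;; relabel ;; dfs ;;
    Prog.for rX rN (put aL (.reg rX) (.lt (get aVis (get aSV (.reg rX))) (get aVis (.reg rX))))

theorem maxCut_spec (hs : Static I G mate s) (hM : 2 * I.n + 2 ≤ M) {S : Finset (Fin I.m)}
    {L : Set (Fin I.n)} {l : ℕ} (hS : I.D.SelfConj S)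
    (hf : I.FlowInv G mate S L (s.arr aCap) l)
    (hc : I.IsCore G (s.arr aCap) L (I.vset (s.arr aVis)))
    (hv : ∀ v : Fin I.n, s.arr aVis v ≤ I.n) :
    Tri M maxCut s (1000 * (I.n + I.m + 1)) fun s' =>
      I.D.IsMaxCut S L (I.vset (s'.arr aL)) l := by
  have hn := hs.graph.n_eq
  have hH := hs.graph.H_eq
  refine Tri.seq (60 * (I.n + 1)) (900 * (I.n + I.m + 1)) ?_ (by omega)
  refine Tri.mono (blockCore_spec hs (by omega) hv) le_rfl fun s₁ _ _ h1 hf1 hb1 => ?_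
  obtain ⟨hcore, hblk, hrt, hnr, hlb⟩ := h1
  have hs1 := hs.frame hf1 rfl
  have hcap1 : s₁.arr aCap = s.arr aCap := hf1.arr _ rfl
  refine Tri.seq (66 * (G.H + G.n + I.n + 2)) (700 * (I.n + I.m + 1)) ?_ (by omega)
  refine Tri.mono (dfs_spec (lb := 0) (by omega) (by omega) hs1.loaded hcap1 rfl rfl hnr
    (fun j hj => by rw [hrt j hj, hn]; exact hj) hlb) le_rfl fun s₂ _ _ h2 hf2 hb2 => ?_
  obtain ⟨hd, hsp, hi⟩ := h2
  have hs2 := hs1.frame hf2 rfl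
  have hcap2 : s₂.arr aCap = s.arr aCap := (hf2.arr _ rfl).trans hcap1
  refine Tri.seq (40 * (I.m + 1)) (600 * (I.n + I.m + 1)) ?_ (by omega)
  refine Tri.mono (reverseCap_spec hs2) le_rfl fun s₃ _ _ hrev hf3 hb3 => ?_
  have hs3 := hs2.frame hf3 rfl
  have hcnt : s₂.reg rCnt ≤ I.n := hn ▸ hd.cnt_le
  have hcnt3 : s₃.reg rCnt = s₂.reg rCnt := hf3.reg _ rfl
  refine Tri.seq (60 * (I.n + 1)) (500 * (I.n + I.m + 1)) ?_ (by omega)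
  refine Tri.mono (relabel_spec hs3 (by omega) (by omega)) le_rfl fun s₄ _ _ h4 hf4 hb4 => ?_
  obtain ⟨hlab4, hrt4, hnr4, hlb4⟩ := h4
  have hcore3 : ∀ v : Fin I.n, s₃.arr aCore v = s.arr aVis v := fun v => by
    rw [hf3.arr aCore rfl, hf2.arr aCore rfl, hcore]
  simp only [hcore3] at hlab4
  rw [hcnt3] at hrt4 hnr4
  rw [hf3.arr aOrd rfl] at hrt4
  have hs4 := hs3.frame hf4 rfl
  have hcap4 : s₄.arr aCap = s₃.arr aCap := hf4.arr _ rfl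
  refine Tri.seq (66 * (G.H + G.n + s₂.reg rCnt + 2)) (100 * (I.n + I.m + 1)) ?_ (by omega)
  refine Tri.mono (dfs_spec (lb := 1) (by omega) (by omega) hs4.loaded rfl rfl rfl hnr4
    (fun j hj => by rw [hrt4 j hj]; exact (hd.ord_lt _ (by simp only [State.dfs]; omega)).1) hlb4)
    le_rfl fun s₅ _ _ h5 hf5 hb5 => ?_
  obtain ⟨hd', hsp', hi'⟩ := h5
  have hs5 := hs4.frame hf5 rfl
  have hblk4 : ∀ v : Fin I.n, s₁.arr aVis v = 0 ↔ s₄.arr aVis v = 0 := by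
    intro v
    rw [hblk, hlab4]
    split_ifs with h1 h2 <;> simp_all
  have hblk4' : ∀ v, v < G.n → (s₁.arr aVis v = 0 ↔ s₄.arr aVis v = 0) :=
    fun v hv => hblk4 ⟨v, hn ▸ hv⟩
  have hkos := DfsInv.kosaraju hd hsp hi (fun v hv _ => ⟨v, hn ▸ hv, hrt v (hn ▸ hv)⟩)
    hd' hsp' hi' hrt4 hblk4' ?_ ?_
  · obtain ⟨hk1, hk2, hk3⟩ := hkos
    have hvis : s₅.dfs.vis = s₅.arr aVis := rfl
    rw [hvis] at hk1 hk2 hk3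
    refine Tri.mono (Tri.fill 0 (fun i => if s₅.arr aVis (s₅.arr aSV i) < s₅.arr aVis i then 1
      else 0) (by decide) (by decide) (by decide) ?_ ?_ (B := (I.n + 1) * 20 + 2) ?_) (by omega)
      fun s₆ _ _ h6 => ?_
    · intro i s' hf hb hi hx
      simp [val, hx, hf.arr aVis rfl, hf.arr aSV rfl]
    · intro hb i _
      split
      · exact hb.pos
      · exact Nat.zero_le _
    · rw [hs5.n]; simp [cost]
    have hZ : I.vset (s₆.arr aL) =
        {v : Fin I.n | s₅.arr aVis (I.D.σV v) < s₅.arr aVis v} := by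
      ext v
      have := h6.1 v (by rw [hs5.n]; exact v.2)
      rw [zero_add] at this
      rw [mem_vset, this, hs5.sv]
      simp
    rw [hZ]
    have hold : ∀ v : Fin I.n, s₄.arr aVis v ≠ 0 → s₅.arr aVis v = s₄.arr aVis v :=
      fun v h => hd'.old v h
    have hcl : ∀ v : Fin I.n, v ∈ I.vset (s.arr aVis) → I.D.σV v ∉ I.vset (s.arr aVis) :=
      hc.min _ hc.avoids (hf.closed_conj hS hc.subset hc.avoids hc.closed)
    refine hf.isMaxCut hS hc.subset hc.avoids hc.closed hc.min (blk := s₁.arr aVis)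
      (big := I.n + 2) ?_ ?_ ?_ (by omega) ?_ ?_
    · intro v; rw [hblk]; simp
    · intro v hv
      have hv1 : s.arr aVis v ≠ 0 := mem_vset.1 hv
      have e : s₄.arr aVis v = I.n + 2 := by rw [hlab4, if_pos hv1]
      rw [hold v (by omega), e]
    · intro v hv
      have hv' : v ∉ I.vset (s.arr aVis) := fun h => hcl v h hv
      have hv1 : ¬ s.arr aVis v ≠ 0 := fun h => hv' (mem_vset.2 h)
      have hv2 : s.arr aVis (I.D.σV v) ≠ 0 := mem_vset.1 hv
      have e : s₄.arr aVis v = 1 := by rw [hlab4, if_neg hv1, if_pos hv2]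
      rw [hold v (by omega), e]
    · exact fun v w hb hvw => hk2 v w (hn.symm ▸ v.2) hb hvw
    · exact fun v w hbv hbw e => hk3 v w (hn.symm ▸ v.2) (hn.symm ▸ w.2) hbv hbw e
  · rintro v w hb hvw
    have hlt := hvw.lt
    obtain ⟨⟨h, hh, rfl, rfl⟩, -⟩ := hvw
    have hm := hf.paired.le h hh.1 hh.2.1
    refine ⟨⟨mate h, ⟨hm.1, hm.2, ?_⟩, hf.paired.src h hh.1 hh.2.1,
      hf.paired.tgt hh.1 hh.2.1⟩, (hblk4' _ hlt.1).1 hb⟩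
    rw [hcap4, hrev h hh.1 hh.2.1, hcap2]
    exact hh.2.2
  · rintro v w hb hvw
    have hlt := hvw.lt
    obtain ⟨⟨h, hh, rfl, rfl⟩, -⟩ := hvw
    have hm := hf.paired.le h hh.1 hh.2.1
    refine ⟨⟨mate h, ⟨hm.1, hm.2, ?_⟩, hf.paired.src h hh.1 hh.2.1,
      hf.paired.tgt hh.1 hh.2.1⟩, (hblk4' _ hlt.1).2 hb⟩
    rw [← hcap2, ← hrev _ hm.1 hm.2, hf.paired.invol h hh.1 hh.2.1, ← hcap4]
    exact hh.2.2

/-- Replace `aL` by a maximal consistent minimum cut between `aL` and its conjugate without the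
arcs in `aDel`, or find out that every cut is larger than `rBud`. -/
def analyse : Prog := initCap ;; maxFlow ;; cond (.reg rFail) skip maxCut

theorem analyse_spec (hs : Static I G mate s) (hM : 2 * I.n + 2 ≤ M)
    (hS : I.D.SelfConj (I.aset (s.arr aDel))) :
    Tri M analyse s (2000 * ((s.reg rBud + 2) * (I.n + I.m + 1))) fun s' =>
      (s'.reg rFail ≠ 0 ∧ ∀ X, I.vset (s.arr aL) ⊆ X → (∀ v ∈ I.vset (s.arr aL), I.D.σV v ∉ X) →
        s.reg rBud + 1 ≤ (I.D.out (I.aset (s.arr aDel)) X).card) ∨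
      (s'.reg rFail = 0 ∧ ∃ l ≤ s.reg rBud, I.D.IsMaxCut (I.aset (s.arr aDel))
        (I.vset (s.arr aL)) (I.vset (s'.arr aL)) l) := by
  have hle : 1 * (I.n + I.m + 1) ≤ (s.reg rBud + 2) * (I.n + I.m + 1) :=
    Nat.mul_le_mul_right _ (by omega)
  refine Tri.seq (30 * (I.m + 1)) (1900 * ((s.reg rBud + 2) * (I.n + I.m + 1))) ?_ (by omega)
  refine Tri.mono (initCap_spec hs) le_rfl fun s₁ _ _ h1 hf1 hb1 => ?_
  have hs1 := hs.frame hf1 rfl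
  have hL : s₁.arr aL = s.arr aL := hf1.arr _ rfl
  have hbud : s₁.reg rBud = s.reg rBud := hf1.reg _ rfl
  refine Tri.seq (500 * ((s.reg rBud + 2) * (I.n + I.m + 1)))
    (1300 * ((s.reg rBud + 2) * (I.n + I.m + 1))) ?_ (by omega)
  refine Tri.mono (maxFlow_spec hs1 (by omega) h1) (by rw [hbud]) fun s₂ _ _ h2 hf2 hb2 => ?_
  rw [hL, hbud] at h2
  have hs2 := hs1.frame hf2 rfl
  refine Tri.cond (1200 * ((s.reg rBud + 2) * (I.n + I.m + 1))) (by decide) ?_ ?_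
    (by simp [cost]; omega)
  · intro hne
    refine Tri.straight rfl (by simp [cst]; omega) fun _ => ⟨trivial, .inl ?_⟩
    exact h2.resolve_right fun h => hne h.1
  · intro h0
    obtain ⟨h3, h4, h5, h6, h7⟩ := h2.resolve_left fun h => h.1 h0
    refine Tri.mono (maxCut_spec hs2 hM hS h5 h6 h7) (by omega) fun s₃ _ hf3 h8 => .inr ⟨?_, ?_⟩
    · exact (hf3.reg rFail rfl).trans h3
    · exact ⟨_, h4, h8⟩

end WordRAM

/-! ### The pending nodes of the search tree -/

namespace MulticutInstance

open SkewSymmDigraph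

/-- The weight of a node of the search tree whose remaining budget is `K`, if `l` is a lower bound
for the minimum cut: at most `2 * weight d K l - 1` nodes of the search tree lie below it. -/
def weight (d K l : ℕ) : ℕ :=
  if l = 0 then 2 * (4 * d) ^ (K / 2) else 2 ^ (K + 1 - l) * d ^ (K / 2 - 1)

variable {d K l l' : ℕ}

theorem weight_pos (hd : 1 ≤ d) : 1 ≤ weight d K l := by
  rw [weight]; split <;> exact Nat.succ_le_of_lt (by positivity)

theorem weight_anti (hd : 1 ≤ d) (hK : Even K) (h : l ≤ l') : weight d K l' ≤ weight d K l := by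
  obtain ⟨k, rfl⟩ := hK
  have e : (k + k) / 2 = k := by omega
  rw [weight, weight, e]
  split_ifs with h1 h2 h2
  · exact le_rfl
  · omega
  · rw [mul_pow, ← mul_assoc]
    refine Nat.mul_le_mul ?_ (Nat.pow_le_pow_right hd (by omega))
    calc 2 ^ (k + k + 1 - l') ≤ 2 ^ (1 + 2 * k) := Nat.pow_le_pow_right (by norm_num) (by omega)
      _ = 2 * 4 ^ k := by rw [pow_add, pow_mul]; norm_num
  · exact Nat.mul_le_mul_right _ (Nat.pow_le_pow_right (by norm_num) (by omega))

/-- Keeping an arc that leaves the cut. -/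
theorem weight_succ (hl : 1 ≤ l) (hlK : l ≤ K) : 2 * weight d K (l + 1) ≤ weight d K l := by
  rw [weight, weight, if_neg (by omega), if_neg (by omega), ← mul_assoc, ← pow_succ']
  rw [show K + 1 - (l + 1) + 1 = K + 1 - l by omega]

/-- Deleting an arc that leaves the cut. -/
theorem weight_sub_two (hd : 1 ≤ d) (hK : Even K) (hl : 1 ≤ l) (hlK : l ≤ K) :
    2 * weight d (K - 2) (l - 1) ≤ weight d K l := by
  obtain ⟨k, rfl⟩ := hK
  rw [weight, weight, if_neg (by omega : ¬ l = 0)]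
  split_ifs with h
  · obtain rfl : l = 1 := by omega
    obtain ⟨k, rfl⟩ : ∃ k', k = k' + 1 := ⟨k - 1, by omega⟩
    rw [show (k + 1 + (k + 1) - 2) / 2 = k by omega,
      show (k + 1 + (k + 1)) / 2 - 1 = k by omega, mul_pow, ← mul_assoc, ← mul_assoc,
      show k + 1 + (k + 1) + 1 - 1 = 2 + 2 * k by omega, pow_add, pow_mul]
    norm_num
  · rw [← mul_assoc, ← pow_succ']
    exact Nat.mul_le_mul (Nat.pow_le_pow_right (by norm_num) (by omega))
      (Nat.pow_le_pow_right hd (by omega))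

/-- Deleting all arcs that leave the cut, and deciding one of `d` vertices in one of two ways. -/
theorem weight_sub (hd : 1 ≤ d) (hK : Even K) (hl : Even l) (hlK : l < K) :
    2 * d * weight d (K - l) 1 ≤ weight d K l := by
  obtain ⟨k, rfl⟩ := hK
  obtain ⟨j, rfl⟩ := hl
  obtain ⟨i, rfl⟩ : ∃ i, k = i + 1 + j := ⟨k - j - 1, by omega⟩
  have e : 2 * d * weight d (i + 1 + j + (i + 1 + j) - (j + j)) 1 = 2 ^ (2 * (i + 1) + 1) * d ^ (i + 1) := by
    rw [weight, if_neg (by norm_num)]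
    rw [show i + 1 + j + (i + 1 + j) - (j + j) + 1 - 1 = 2 * (i + 1) by omega,
      show (i + 1 + j + (i + 1 + j) - (j + j)) / 2 - 1 = i by omega]
    ring
  rw [e, weight]
  split_ifs with h
  · obtain rfl : j = 0 := by omega
    rw [show (i + 1 + 0 + (i + 1 + 0)) / 2 = i + 1 by omega, mul_pow, pow_succ, pow_mul]
    norm_num
    exact le_of_eq (by ring)
  · exact Nat.mul_le_mul (Nat.pow_le_pow_right (by norm_num) (by omega))
      (Nat.pow_le_pow_right hd (by omega))

/-- A node of the search tree: the set `L` of the vertices committed to the labelling, the set `S`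
of the deleted arcs, the number `bud` of arcs that may still be deleted, and a lower bound `lam`
for the cuts around `L`, which is not stored but is needed to bound the size of the tree. -/
structure Node (I : MulticutInstance) where
  L : Set (Fin I.n)
  S : Finset (Fin I.m)
  bud : ℕ
  lam : ℕ

variable {I : MulticutInstance}

/-- The properties of a node on which the search relies. -/
structure Node.Good (x : Node I) : Prop where
  conj : I.D.SelfConj x.S
  card : x.S.card + x.bud = 2 * I.k
  le : ∀ Y, x.L ⊆ Y → I.D.Consistent Y → x.lam ≤ (I.D.out x.S Y).card

theorem Node.Good.even {x : Node I} (h : x.Good) : Even x.bud := by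
  have h1 := h.conj.even_card
  have h2 := h.card
  rw [Nat.even_iff] at h1 ⊢
  omega

/-- An upper bound for the number of nodes of the search tree that lie below the nodes in `l`. -/
def potential (l : List (Node I)) : ℕ := (l.map fun x => 2 * weight I.d x.bud x.lam - 1).sum

@[simp] theorem potential_nil : potential ([] : List (Node I)) = 0 := rfl

@[simp] theorem potential_cons (x : Node I) (l : List (Node I)) :
    potential (x :: l) = 2 * weight I.d x.bud x.lam - 1 + potential l := by
  simp [potential]

end MulticutInstance

namespace WordRAM

open WordRAM.Expr WordRAM.Prog MulticutInstance SkewSymmDigraph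

variable {I : MulticutInstance} {G : AdjGraph} {mate : ℕ → ℕ} {M : ℕ} {s : State}

/-- The nodes in `l` are good, and they are stored one after the other, the first one on top. The
inequality keeps the stack of the pending nodes low: children have a smaller value of
`bud + 1 - lam` than their parent, and there are at most `2 * d` of them. -/
def Frontier (I : MulticutInstance) : List (Node I) → State → Prop
  | [], _ => True
  | x :: l, s => x.Good ∧
      l.length + 2 * I.d * (x.bud + 1 - x.lam) ≤ 2 * I.d * (2 * I.k + 1) ∧
      I.vset (fun v => s.arr aSvL (l.length * I.n + v)) = x.L ∧
      I.aset (fun a => s.arr aSvD (l.length * I.m + a)) = x.S ∧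
      s.arr aSvK l.length = x.bud ∧ Frontier I l s

theorem Frontier.congr {s' : State} {l : List (Node I)} (h : Frontier I l s)
    (h1 : ∀ i < l.length * I.n, s'.arr aSvL i = s.arr aSvL i)
    (h2 : ∀ i < l.length * I.m, s'.arr aSvD i = s.arr aSvD i)
    (h3 : ∀ i < l.length, s'.arr aSvK i = s.arr aSvK i) : Frontier I l s' := by
  induction l with
  | nil => trivial
  | cons x l ih =>
    obtain ⟨a1, a2, a3, a4, a5, a6⟩ := h
    simp only [List.length_cons, Nat.succ_mul] at h1 h2 h3
    refine ⟨a1, a2, ?_, ?_, by rw [h3 _ (by omega)]; exact a5,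
      ih a6 (fun i hi => h1 i (by omega)) (fun i hi => h2 i (by omega))
        fun i hi => h3 i (by omega)⟩
    · rw [← a3]; ext v
      rw [mem_vset, mem_vset, h1 _ (by have := v.2; omega)]
    · rw [← a4]; ext a
      rw [mem_aset, mem_aset, h2 _ (by have := a.2; omega)]

/-- The stack of the pending nodes consists of the nodes in `l`. -/
structure Stored (I : MulticutInstance) (l : List (Node I)) (s : State) : Prop where
  num : s.reg rNum = l.length
  offL : s.reg rOffL = l.length * I.n
  offD : s.reg rOffD = l.length * I.m
  frontier : Frontier I l s

/-- The program does not assign to the cells that hold the pending nodes. -/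
def Prog.keepsStack (p : Prog) : Bool :=
  [rNum, rOffL, rOffD].all (fun x => !p.wr x) && [aSvL, aSvD, aSvK].all (fun a => !p.wa a)

theorem Stored.frame {p : Prog} {s' : State} {l : List (Node I)} (h : Stored I l s)
    (hf : Frame p s s') (hp : p.keepsStack = true) : Stored I l s' := by
  simp only [Prog.keepsStack, List.all_cons, List.all_nil, Bool.and_true, Bool.and_eq_true,
    Bool.not_eq_true'] at hp
  obtain ⟨⟨h0, h1, h2⟩, a0, a1, a2⟩ := hp
  exact ⟨(hf.reg _ h0).trans h.num, (hf.reg _ h1).trans h.offL, (hf.reg _ h2).trans h.offD,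
    h.frontier.congr (fun _ _ => by rw [hf.arr _ a0]) (fun _ _ => by rw [hf.arr _ a1])
      fun _ _ => by rw [hf.arr _ a2]⟩

/-- Put the node given by `aL`, `aDel` and `rBud` on the stack of the pending nodes. -/
def pushNode : Prog :=
  Prog.for rX rN (put aSvL (add (.reg rOffL) (.reg rX)) (get aL (.reg rX))) ;;
    Prog.for rX rM (put aSvD (add (.reg rOffD) (.reg rX)) (get aDel (.reg rX))) ;;
    put aSvK (.reg rNum) (.reg rBud) ;;
    set rNum (add (.reg rNum) (const 1)) ;;
    set rOffL (add (.reg rOffL) (.reg rN)) ;;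
    set rOffD (add (.reg rOffD) (.reg rM))

/-- A number that bounds the indices of all cells that hold pending nodes. -/
def stackBound (I : MulticutInstance) : ℕ := (2 * I.d * (2 * I.k + 1) + 1) * (I.n + I.m + 1)

theorem pushNode_spec (hs : Static I G mate s) (hM : stackBound I ≤ M) {l : List (Node I)}
    (hl : Stored I l s) (x : Node I) (hx : x.Good)
    (hroom : l.length + 2 * I.d * (x.bud + 1 - x.lam) ≤ 2 * I.d * (2 * I.k + 1))
    (hL : I.vset (s.arr aL) = x.L) (hS : I.aset (s.arr aDel) = x.S) (hK : s.reg rBud = x.bud) :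
    Tri M pushNode s (60 * (I.n + I.m + 1)) (Stored I (x :: l)) := by
  have hlen : (l.length + 1) * (I.n + I.m + 1) ≤ M :=
    (Nat.mul_le_mul_right _ (by omega)).trans hM
  have hlen' : (l.length + 1) * (I.n + I.m + 1) =
    l.length * I.n + l.length * I.m + l.length + I.n + I.m + 1 := by ring
  refine Tri.seq (15 * (I.n + 1) + 2) (17 * (I.m + 1) + 20) ?_ (by omega)
  refine Tri.mono (Tri.fill (l.length * I.n) (s.arr aL) (by decide) (by decide) (by decide) ?_ ?_
    (B := 15 * (I.n + 1) + 2) ?_) le_rfl fun s₁ _ _ h1 hf1 hb1 => ?_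
  · intro i s' hf hb hi hx
    simp [val, hx, hf.arr aL rfl, hf.reg rOffL rfl, hl.offL]
  · exact fun hb i _ => hb.arr _ _
  · simp [cost, hs.n]; omega
  rw [hs.n] at h1
  refine Tri.seq (15 * (I.m + 1) + 2) 20 ?_ (by omega)
  refine Tri.mono (Tri.fill (l.length * I.m) (s.arr aDel) (by decide) (by decide) (by decide) ?_ ?_
    (B := 15 * (I.m + 1) + 2) ?_) le_rfl fun s₂ _ _ h2 hf2 hb2 => ?_
  · intro i s' hf hb hi hx
    simp [val, hx, hf.arr aDel rfl, hf1.arr aDel rfl, hf.reg rOffD rfl, hf1.reg rOffD rfl, hl.offD]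
  · exact fun hb i _ => by rw [← hf1.arr aDel rfl]; exact hb.arr _ _
  · simp [cost, hf1.reg rM rfl, hs.m]; omega
  rw [hf1.reg rM rfl, hs.m] at h2
  refine Tri.straight rfl (by decide) fun _ => ?_
  have e1 : s₂.reg rNum = l.length := ((hf2.reg rNum rfl).trans (hf1.reg rNum rfl)).trans hl.num
  have e2 : s₂.reg rOffL = l.length * I.n :=
    ((hf2.reg rOffL rfl).trans (hf1.reg rOffL rfl)).trans hl.offL
  have e3 : s₂.reg rOffD = l.length * I.m :=
    ((hf2.reg rOffD rfl).trans (hf1.reg rOffD rfl)).trans hl.offD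
  have e4 : s₂.reg rBud = x.bud := ((hf2.reg rBud rfl).trans (hf1.reg rBud rfl)).trans hK
  have e5 : s₂.reg rN = I.n := ((hf2.reg rN rfl).trans (hf1.reg rN rfl)).trans hs.n
  have e6 : s₂.reg rM = I.m := ((hf2.reg rM rfl).trans (hf1.reg rM rfl)).trans hs.m
  have e7 : s₂.arr aSvL = s₁.arr aSvL := hf2.arr aSvL rfl
  have e8 : s₁.arr aSvD = s.arr aSvD := hf1.arr aSvD rfl
  have e9 : s₂.arr aSvK = s.arr aSvK := (hf2.arr aSvK rfl).trans (hf1.arr aSvK rfl)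
  refine ⟨?_, ?_⟩
  · have := hb2.reg rBud
    simp [Safe, exec, val, e1, e2, e3, e4, e5, e6] at this ⊢
    omega
  · refine ⟨by simp [exec, val, e1], by simp [exec, val, e2, e5, Nat.succ_mul],
      by simp [exec, val, e3, e6, Nat.succ_mul], hx, hroom, ?_, ?_, ?_, ?_⟩
    · rw [← hL]; ext v
      simp [exec, val, e7, h1.1 v v.2]
    · rw [← hS]; ext a
      simp [exec, val, h2.1 a a.2]
    · simp [exec, val, e1, e4]
    · refine hl.frontier.congr (fun i hi => ?_) (fun i hi => ?_) fun i hi => ?_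
      · simp [exec, val, e7, h1.2 i (.inl hi)]
      · simp [exec, val, h2.2 i (.inl hi), e8]
      · simp [exec, val, e1, e9, Function.update_of_ne hi.ne]

/-- Take the top node from the stack of the pending nodes. -/
def popNode : Prog :=
  (set rNum (sub (.reg rNum) (const 1)) ;;
    set rOffL (sub (.reg rOffL) (.reg rN)) ;;
    set rOffD (sub (.reg rOffD) (.reg rM)) ;;
    set rBud (get aSvK (.reg rNum))) ;;
    Prog.for rX rN (put aL (.reg rX) (get aSvL (add (.reg rOffL) (.reg rX)))) ;;
    Prog.for rX rM (put aDel (.reg rX) (get aSvD (add (.reg rOffD) (.reg rX))))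

theorem popNode_spec (hs : Static I G mate s) {l : List (Node I)} {x : Node I}
    (hl : Stored I (x :: l) s) : Tri M popNode s (60 * (I.n + I.m + 1)) fun s' =>
      Stored I l s' ∧ I.vset (s'.arr aL) = x.L ∧ I.aset (s'.arr aDel) = x.S ∧
        s'.reg rBud = x.bud := by
  obtain ⟨h0, h1, h2, h3, h4, h5, h6, h7, h8⟩ := hl
  simp only [List.length_cons, Nat.succ_mul] at h0 h1 h2
  have en := hs.n
  have em := hs.m
  refine Tri.seq 20 (15 * (I.n + 1) + 15 * (I.m + 1) + 4) ?_ (by omega)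
  refine Tri.straight rfl (by decide) fun hb => ⟨?_, fun hf1 hb1 => ?_⟩
  · have a0 := hb.reg rNum
    have a1 := hb.reg rOffL
    have a2 := hb.reg rOffD
    have a3 := hb.arr aSvK l.length
    simp [Safe, exec, val, h0, h1, h2, en, em] at a0 a1 a2 a3 ⊢
    omega
  generalize hs1 : exec _ s = s₁ at hf1 hb1
  have f0 : s₁.reg rNum = l.length := by subst hs1; simp [exec, val, h0]
  have f1 : s₁.reg rOffL = l.length * I.n := by subst hs1; simp [exec, val, h1, en]
  have f2 : s₁.reg rOffD = l.length * I.m := by subst hs1; simp [exec, val, h2, em]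
  have f3 : s₁.reg rBud = x.bud := by subst hs1; simp [exec, val, h0, h7]
  refine Tri.seq (15 * (I.n + 1) + 2) (15 * (I.m + 1) + 2) ?_ (by omega)
  refine Tri.mono (Tri.fill 0 (fun i => s.arr aSvL (l.length * I.n + i)) (by decide) (by decide)
    (by decide) ?_ ?_ (B := 15 * (I.n + 1) + 2) ?_) le_rfl fun s₂ _ _ h2 hf2 hb2 => ?_
  · intro i s' hf hb hi hx
    simp [val, hx, hf.arr aSvL rfl, hf1.arr aSvL rfl, hf.reg rOffL rfl, f1]
  · exact fun hb i _ => by rw [← hf1.arr aSvL rfl]; exact hb.arr _ _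
  · simp [cost, hf1.reg rN rfl, en]; omega
  rw [hf1.reg rN rfl, en] at h2
  refine Tri.mono (Tri.fill 0 (fun i => s.arr aSvD (l.length * I.m + i)) (by decide) (by decide)
    (by decide) ?_ ?_ (B := 15 * (I.m + 1) + 2) ?_) le_rfl fun s₃ _ hf3 h3 => ?_
  · intro i s' hf hb hi hx
    simp [val, hx, hf.arr aSvD rfl, hf1.arr aSvD rfl, hf2.arr aSvD rfl, hf.reg rOffD rfl,
      hf2.reg rOffD rfl, f2]
  · exact fun hb i _ => by rw [← hf1.arr aSvD rfl, ← hf2.arr aSvD rfl]; exact hb.arr _ _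
  · simp [cost, hf1.reg rM rfl, hf2.reg rM rfl, em]; omega
  rw [hf2.reg rM rfl, hf1.reg rM rfl, em] at h3
  simp only [zero_add] at h2 h3
  refine ⟨⟨?_, ?_, ?_, h8.congr (fun i _ => ?_) (fun i _ => ?_) fun i _ => ?_⟩, ?_, ?_, ?_⟩
  · rw [hf3.reg rNum rfl, hf2.reg rNum rfl, f0]
  · rw [hf3.reg rOffL rfl, hf2.reg rOffL rfl, f1]
  · rw [hf3.reg rOffD rfl, hf2.reg rOffD rfl, f2]
  · rw [hf3.arr aSvL rfl, hf2.arr aSvL rfl, hf1.arr aSvL rfl]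
  · rw [hf3.arr aSvD rfl, hf2.arr aSvD rfl, hf1.arr aSvD rfl]
  · rw [hf3.arr aSvK rfl, hf2.arr aSvK rfl, hf1.arr aSvK rfl]
  · rw [← h5]; ext v
    rw [mem_vset, mem_vset, hf3.arr aL rfl, h2.1 v v.2]
  · rw [← h6]; ext a
    rw [mem_aset, mem_aset, h3.1 a a.2]
  · rw [hf3.reg rBud rfl, hf2.reg rBud rfl, f3]

end WordRAM

/-! ### Branching on the word RAM -/

namespace WordRAM

open WordRAM.Expr WordRAM.Prog MulticutInstance SkewSymmDigraph

variable {I : MulticutInstance} {G : AdjGraph} {mate : ℕ → ℕ} {M : ℕ} {s : State}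

/-- Look for an arc that leaves the set `aL` and whose head is undecided; `rArc` becomes `m` if there
is none. -/
def findArc : Prog :=
  set rArc (.reg rM) ;;
    Prog.for rX rM
      (cond (get aDel (.reg rX)) skip
        (cond (get aL (get aTl (.reg rX)))
          (cond (add (get aL (get aHd (.reg rX))) (get aL (get aSV (get aHd (.reg rX))))) skip
            (set rArc (.reg rX))) skip))

theorem findArc_spec (hs : Static I G mate s) :
    Tri M findArc s (60 * (I.m + 1)) fun s' =>
      (s'.reg rArc = I.m ∧ ∀ a ∈ I.D.out (I.aset (s.arr aDel)) (I.vset (s.arr aL)),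
        I.D.σV (I.D.head a) ∈ I.vset (s.arr aL)) ∨
      ∃ a ∈ I.D.out (I.aset (s.arr aDel)) (I.vset (s.arr aL)), s'.reg rArc = a ∧
        I.D.σV (I.D.head a) ∉ I.vset (s.arr aL) := by
  refine Tri.seq 2 (40 * (I.m + 1) + 2) ?_ (by omega)
  refine Tri.straight rfl le_rfl fun hb => ⟨by simp [Safe, val, hb.reg], fun hf0 hb0 => ?_⟩
  refine Tri.for (fun i s' =>
      (s'.reg rArc = I.m ∧ ∀ a ∈ I.D.out (I.aset (s.arr aDel)) (I.vset (s.arr aL)), (a : ℕ) < i →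
        I.D.σV (I.D.head a) ∈ I.vset (s.arr aL)) ∨
      ∃ a ∈ I.D.out (I.aset (s.arr aDel)) (I.vset (s.arr aL)), s'.reg rArc = a ∧
        I.D.σV (I.D.head a) ∉ I.vset (s.arr aL)) 32
    rfl rfl (by decide) (by simp [exec, val, hs.m]) ?_ ?_ ?_
  · rintro i s' hf hb1 hi hx hI
    rw [hf0.reg rM rfl, hs.m] at hi
    have hL : s'.arr aL = s.arr aL := (hf.arr aL rfl).trans (hf0.arr aL rfl)
    have hD : s'.arr aDel = s.arr aDel := (hf.arr aDel rfl).trans (hf0.arr aDel rfl)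
    have hT : s'.arr aTl i = I.D.tail ⟨i, hi⟩ := by
      rw [(hf.arr aTl rfl).trans (hf0.arr aTl rfl)]; exact hs.tl ⟨i, hi⟩
    have hH : s'.arr aHd i = I.D.head ⟨i, hi⟩ := by
      rw [(hf.arr aHd rfl).trans (hf0.arr aHd rfl)]; exact hs.hd ⟨i, hi⟩
    have hV : s'.arr aSV (I.D.head ⟨i, hi⟩) = I.D.σV (I.D.head ⟨i, hi⟩) := by
      rw [(hf.arr aSV rfl).trans (hf0.arr aSV rfl)]; exact hs.sv _
    refine Tri.straight rfl (by decide) fun _ => ?_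
    by_cases hgood : (⟨i, hi⟩ : Fin I.m) ∈ I.D.out (I.aset (s.arr aDel)) (I.vset (s.arr aL)) ∧
        I.D.σV (I.D.head ⟨i, hi⟩) ∉ I.vset (s.arr aL)
    · have hg := hgood
      simp only [mem_out, mem_aset, mem_vset, not_not] at hg
      obtain ⟨⟨g1, g2, g3⟩, g4⟩ := hg
      simp [exec, Safe, val, hx, hL, hD, hT, hH, hV, g1, g2, g3, g4]
      exact ⟨hx ▸ hb1.reg _, fun _ => .inr ⟨_, by simpa using hgood.1, rfl, g4⟩⟩
    · have hg := hgood
      simp only [mem_out, mem_aset, mem_vset, not_not] at hg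
      have hkeep : ((cond (get aDel (.reg rX)) skip
        (cond (get aL (get aTl (.reg rX)))
          (cond (add (get aL (get aHd (.reg rX))) (get aL (get aSV (get aHd (.reg rX))))) skip
            (set rArc (.reg rX))) skip)) : Prog).exec s' = s' := by
        simp only [exec, val, hx, hL, hD, hT, hH, hV]
        split_ifs with c1 c2 c3
        · rfl
        · exact absurd ⟨⟨c1, c2, by omega⟩, by omega⟩ hg
        · rfl
        · rfl
      refine ⟨?_, fun _ => ?_⟩
      · have := hb1.reg rX
        simp only [Safe, val]
        split_ifs <;> simp [this]
      · rw [hkeep]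
        refine hI.imp (fun h => ⟨by simpa using h.1, fun a ha hai => ?_⟩) (by simp)
        rcases Nat.lt_succ_iff_lt_or_eq.1 hai with hai | hai
        · exact h.2 a ha hai
        · obtain rfl : a = ⟨i, hi⟩ := Fin.ext hai
          by_contra h'
          exact hgood ⟨ha, h'⟩
  · rintro s' hf hb1 hI
    refine hI.imp (fun h => ⟨h.1, fun a ha => h.2 a ha ?_⟩) fun h => h
    rw [hf0.reg rM rfl, hs.m]; exact a.2
  · simp [exec, hs.m]; omega

/-- Delete all arcs that leave the set `aL`. -/
def forceArcs : Prog :=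
  Prog.for rX rM
    (cond (get aDel (.reg rX)) skip
      (cond (get aL (get aTl (.reg rX)))
        (cond (get aL (get aHd (.reg rX))) skip
          (put aDel (.reg rX) (const 1) ;; set rBud (sub (.reg rBud) (const 1)))) skip))

theorem forceArcs_spec (hs : Static I G mate s) :
    Tri M forceArcs s (60 * (I.m + 1)) fun s' =>
      I.aset (s'.arr aDel) =
        I.aset (s.arr aDel) ∪ I.D.out (I.aset (s.arr aDel)) (I.vset (s.arr aL)) ∧
      s'.reg rBud =
        s.reg rBud - (I.D.out (I.aset (s.arr aDel)) (I.vset (s.arr aL))).card := by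
  classical
  set F := I.D.out (I.aset (s.arr aDel)) (I.vset (s.arr aL)) with hF
  refine Tri.for (fun i s' =>
      (∀ a : Fin I.m, (a : ℕ) < i → (s'.arr aDel a ≠ 0 ↔ s.arr aDel a ≠ 0 ∨ a ∈ F)) ∧
      (∀ a : Fin I.m, i ≤ (a : ℕ) → s'.arr aDel a = s.arr aDel a) ∧
      s'.reg rBud = s.reg rBud - (F.filter fun a : Fin I.m => (a : ℕ) < i).card) 32
    rfl rfl (by decide) (by simp) ?_ ?_ ?_
  · rintro i s' hf hb1 hi hx ⟨h1, h2, h3⟩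
    rw [hs.m] at hi
    have hL : s'.arr aL = s.arr aL := hf.arr aL rfl
    have hD : s'.arr aDel i = s.arr aDel i := h2 ⟨i, hi⟩ le_rfl
    have hT : s'.arr aTl i = I.D.tail ⟨i, hi⟩ := by rw [hf.arr aTl rfl]; exact hs.tl ⟨i, hi⟩
    have hH : s'.arr aHd i = I.D.head ⟨i, hi⟩ := by rw [hf.arr aHd rfl]; exact hs.hd ⟨i, hi⟩
    refine Tri.straight rfl (by decide) fun _ => ?_
    have hmem : (⟨i, hi⟩ : Fin I.m) ∈ F ↔
        s.arr aDel i = 0 ∧ s.arr aL (I.D.tail ⟨i, hi⟩) ≠ 0 ∧ s.arr aL (I.D.head ⟨i, hi⟩) = 0 := by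
      simp [hF]
    by_cases hg : (⟨i, hi⟩ : Fin I.m) ∈ F
    · obtain ⟨g1, g2, g3⟩ := hmem.1 hg
      have hcard : (F.filter fun a : Fin I.m => (a : ℕ) < i + 1) =
          insert ⟨i, hi⟩ (F.filter fun a : Fin I.m => (a : ℕ) < i) := by
        ext a
        simp only [Finset.mem_filter, Finset.mem_insert, Fin.ext_iff]
        constructor
        · rintro ⟨h, h'⟩; by_cases e : (a : ℕ) = i
          · exact .inl e
          · exact .inr ⟨h, by omega⟩
        · rintro (h | ⟨h, h'⟩)
          · exact ⟨by rwa [show a = ⟨i, hi⟩ from Fin.ext h], by omega⟩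
          · exact ⟨h, by omega⟩
      rw [hcard, Finset.card_insert_of_notMem (by simp)]
      have hbb := hb1.reg rBud
      simp [exec, Safe, val, hx, hL, hD, hT, hH, g1, g2, g3, hb1.pos, h3] at hbb ⊢
      refine ⟨by omega, fun _ => ⟨fun a ha => ?_, fun a ha => ?_, by omega⟩⟩
      · by_cases e : (a : ℕ) = i
        · rw [e]; simp [show a = ⟨i, hi⟩ from Fin.ext e, hg]
        · rw [Function.update_of_ne e]; simpa using h1 a (by omega)
      · rw [Function.update_of_ne (by omega)]; exact h2 a (by omega)
    · have hcard : (F.filter fun a : Fin I.m => (a : ℕ) < i + 1) = F.filter fun a : Fin I.m => (a : ℕ) < i := by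
        ext a
        simp only [Finset.mem_filter]
        constructor
        · rintro ⟨h, h'⟩
          exact ⟨h, lt_of_le_of_ne (by omega) fun e => hg (by rwa [← show a = ⟨i, hi⟩ from Fin.ext e])⟩
        · rintro ⟨h, h'⟩
          exact ⟨h, by omega⟩
      rw [hcard]
      have hkeep : ((cond (get aDel (.reg rX)) skip
      (cond (get aL (get aTl (.reg rX)))
        (cond (get aL (get aHd (.reg rX))) skip
          (put aDel (.reg rX) (const 1) ;; set rBud (sub (.reg rBud) (const 1)))) skip)) :
            Prog).exec s' = s' := by
        simp only [exec, val, hx, hL, hD, hT, hH]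
        split_ifs with c1 c2 c3
        · rfl
        · exact absurd (hmem.2 ⟨c1, c2, c3⟩) hg
        all_goals rfl
      refine ⟨?_, fun _ => ?_⟩
      · have := hb1.reg rBud
        have := hb1.pos
        simp only [Safe, val]
        split_ifs <;> simp [exec] <;> omega
      · rw [hkeep]
        refine ⟨fun a ha => ?_, fun a ha => h2 a (by omega), by simpa using h3⟩
        by_cases e : (a : ℕ) = i
        · obtain rfl : a = ⟨i, hi⟩ := Fin.ext e
          simp [hD, hg]
        · exact h1 a (by omega)
  · rintro s' hf hb1 ⟨h1, h2, h3⟩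
    rw [hs.m] at h1 h3
    refine ⟨?_, ?_⟩
    · ext a
      rw [Finset.mem_union, mem_aset, mem_aset, h1 a a.2]
    · rw [h3, Finset.filter_true_of_mem fun a _ => a.2]
  · rw [hs.m]; omega

/-- Look for a set of the family without a decided member, and put the index of its first member
into register `rTmp`. -/
def findSet : Prog :=
  set rViol (const 0) ;;
    set rBase (const 0) ;;
    Prog.for rI rT
      (set rBad (const 1) ;;
        Prog.for rX rD
          (set rV (get aFam (add (.reg rBase) (.reg rX))) ;;
            cond (add (get aL (.reg rV)) (get aL (get aSV (.reg rV)))) (set rBad (const 0)) skip) ;;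
        cond (.reg rBad) (set rViol (const 1) ;; set rTmp (.reg rBase)) skip ;;
        set rBase (add (.reg rBase) (.reg rD)))

/-- A member of the `i`-th set of the family is decided by the set `X`. -/
def Decided (I : MulticutInstance) (X : Set (Fin I.n)) (i : Fin I.t) : Prop :=
  ∃ j, I.family i j ∈ X ∨ I.D.σV (I.family i j) ∈ X

theorem findSet_spec (hs : Static I G mate s) (hM : I.len + I.d ≤ M) (hd : 1 ≤ I.d) :
    Tri M findSet s (200 * (I.len + I.n + 1)) fun s' =>
      (s'.reg rViol = 0 ∧ ∀ i, Decided I (I.vset (s.arr aL)) i) ∨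
      (s'.reg rViol ≠ 0 ∧ ∃ i : Fin I.t, s'.reg rTmp = i * I.d ∧
        ¬ Decided I (I.vset (s.arr aL)) i) := by
  classical
  have hlen : I.len = I.t * I.d := Nat.mul_comm _ _
  have htlen : I.t ≤ I.len := by rw [hlen]; exact Nat.le_mul_of_pos_right _ hd
  have hdn : I.t ≠ 0 → I.d ≤ I.n := fun h => by
    simpa using Fintype.card_le_of_embedding (I.family ⟨0, Nat.pos_of_ne_zero h⟩)
  set e := min I.d I.n with he
  refine Tri.seq 2 (180 * (I.len + I.n + 1) + 10) ?_ (by omega)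
  refine Tri.straight rfl le_rfl fun hb => ⟨by simp [Safe, val], fun hf0 hb0 => ?_⟩
  refine Tri.seq 2 (180 * (I.len + I.n + 1) + 8) ?_ (by omega)
  refine Tri.straight rfl le_rfl fun hb => ⟨by simp [Safe, val], fun hf1 hb1 => ?_⟩
  generalize hs1 : exec _ (exec _ s) = s₁ at hf1 hb1
  have f0 : s₁.reg rViol = 0 := by subst hs1; simp [exec, val]
  have f1 : s₁.reg rBase = 0 := by subst hs1; simp [exec, val]
  have f2 : s₁.reg rT = I.t := (hf1.reg rT rfl).trans ((hf0.reg rT rfl).trans hs.t)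
  have hL1 : s₁.arr aL = s.arr aL := (hf1.arr aL rfl).trans (hf0.arr aL rfl)
  have hs1' := (hs.frame hf0 rfl).frame hf1 rfl
  refine Tri.for (fun i s' => s'.reg rBase = i * I.d ∧
      ((s'.reg rViol = 0 ∧ ∀ i' : Fin I.t, (i' : ℕ) < i → Decided I (I.vset (s.arr aL)) i') ∨
      (s'.reg rViol ≠ 0 ∧ ∃ i : Fin I.t, s'.reg rTmp = i * I.d ∧
        ¬ Decided I (I.vset (s.arr aL)) i))) (30 * (e + 1) + 40)
    rfl rfl (by decide) (by simp [f0, f1]) ?_ ?_ ?_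
  · rintro i s' hf hb hi hx ⟨hbase, hI⟩
    rw [f2] at hi
    have hde : e = I.d := min_eq_left (hdn (by omega))
    have hsi := hs1'.frame hf rfl
    have hLi : s'.arr aL = s.arr aL := (hf.arr aL rfl).trans hL1
    have hbd : (i + 1) * I.d ≤ I.len := by rw [hlen]; exact Nat.mul_le_mul_right _ hi
    rw [Nat.succ_mul] at hbd
    refine Tri.seq 2 (30 * (e + 1) + 38) ?_ (by omega)
    refine Tri.straight rfl le_rfl fun hb => ⟨by simp [Safe, val, hb.pos], fun hf2 hb2 => ?_⟩
    generalize hs2 : exec _ s' = s₂ at hf2 hb2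
    have g1 : s₂.reg rBad = 1 := by subst hs2; simp [exec, val]
    have hs2' := hsi.frame hf2 rfl
    have hL2 : s₂.arr aL = s.arr aL := (hf2.arr aL rfl).trans hLi
    have g2 : s₂.reg rBase = i * I.d := (hf2.reg rBase rfl).trans hbase
    refine Tri.seq (30 * (e + 1) + 2) 36 ?_ (by omega)
    refine Tri.mono (Tri.for (fun j s' =>
      if ∃ j' : Fin I.d, (j' : ℕ) < j ∧ (I.family ⟨i, hi⟩ j' ∈ I.vset (s.arr aL) ∨
        I.D.σV (I.family ⟨i, hi⟩ j') ∈ I.vset (s.arr aL)) then s'.reg rBad = 0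
        else s'.reg rBad = 1) 22 rfl rfl (by decide) (by simp [g1]) ?_
        (fun s' _ _ h => h) (B := 30 * (e + 1) + 2) (by rw [hs2'.d, hde]; omega)) le_rfl ?_
    · rintro j s₃ hf3 hb3 hj hxj hJ
      rw [hs2'.d] at hj
      have hs3' := hs2'.frame hf3 rfl
      have hL3 : s₃.arr aL = s.arr aL := (hf3.arr aL rfl).trans hL2
      have hB3 : s₃.reg rBase = i * I.d := (hf3.reg rBase rfl).trans g2
      have hF3 := hs3'.fam ⟨i, hi⟩ ⟨j, hj⟩
      have hV3 := hs3'.sv (I.family ⟨i, hi⟩ ⟨j, hj⟩)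
      simp only at hF3
      refine Tri.straight rfl (by decide) fun hb => ?_
      have hle : (I.family ⟨i, hi⟩ ⟨j, hj⟩ : ℕ) ≤ M := hF3 ▸ hb.arr _ _
      have hsplit : (∃ j' : Fin I.d, (j' : ℕ) < j + 1 ∧ (I.family ⟨i, hi⟩ j' ∈ I.vset (s.arr aL) ∨
        I.D.σV (I.family ⟨i, hi⟩ j') ∈ I.vset (s.arr aL))) ↔
        (∃ j' : Fin I.d, (j' : ℕ) < j ∧ (I.family ⟨i, hi⟩ j' ∈ I.vset (s.arr aL) ∨
        I.D.σV (I.family ⟨i, hi⟩ j') ∈ I.vset (s.arr aL))) ∨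
        (I.family ⟨i, hi⟩ ⟨j, hj⟩ ∈ I.vset (s.arr aL) ∨
        I.D.σV (I.family ⟨i, hi⟩ ⟨j, hj⟩) ∈ I.vset (s.arr aL)) := by
        constructor
        · rintro ⟨j', h1, h2⟩
          rcases Nat.lt_succ_iff_lt_or_eq.1 h1 with h1 | h1
          · exact .inl ⟨j', h1, h2⟩
          · obtain rfl : j' = ⟨j, hj⟩ := Fin.ext h1
            exact .inr h2
        · rintro (⟨j', h1, h2⟩ | h)
          · exact ⟨j', by omega, h2⟩
          · exact ⟨⟨j, hj⟩, by simp, h⟩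
      by_cases hdec : I.family ⟨i, hi⟩ ⟨j, hj⟩ ∈ I.vset (s.arr aL) ∨
        I.D.σV (I.family ⟨i, hi⟩ ⟨j, hj⟩) ∈ I.vset (s.arr aL)
      · have hdec' : ¬ (s.arr aL (I.family ⟨i, hi⟩ ⟨j, hj⟩) = 0 ∧
            s.arr aL (I.D.σV (I.family ⟨i, hi⟩ ⟨j, hj⟩)) = 0) := by
          simp only [mem_vset] at hdec; tauto
        rw [if_pos (hsplit.2 (.inr hdec))]
        simp only [exec, Safe, val, State.setReg_reg, State.setReg_arr, hxj, hB3, hF3, hV3, hL3,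
          Nat.add_eq_zero_iff, if_pos, if_neg hdec']
        simp [hle, hF3]
      · have hdec' : (s.arr aL (I.family ⟨i, hi⟩ ⟨j, hj⟩) = 0 ∧
            s.arr aL (I.D.σV (I.family ⟨i, hi⟩ ⟨j, hj⟩)) = 0) := by
          simp only [mem_vset] at hdec; tauto
        simp only [hsplit, or_iff_left hdec]
        simp only [exec, Safe, val, State.setReg_reg, State.setReg_arr, hxj, hB3, hF3, hV3, hL3,
          Nat.add_eq_zero_iff, if_pos, if_pos hdec']
        refine ⟨⟨hle, trivial⟩, fun _ => ?_⟩
        simpa using hJ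
    · intro s₃ hb3 hf3 h3 hf3' hb3'
      rw [hs2'.d] at h3
      have k1 : s₃.reg rBase = i * I.d := (hf3.reg rBase rfl).trans g2
      have k2 : s₃.reg rD = I.d := (hf3.reg rD rfl).trans hs2'.d
      have k3 : s₃.reg rViol = s'.reg rViol := (hf3.reg rViol rfl).trans (hf2.reg rViol rfl)
      have k4 : s₃.reg rTmp = s'.reg rTmp := (hf3.reg rTmp rfl).trans (hf2.reg rTmp rfl)
      refine Tri.straight rfl (by simp [cst, cost]) fun hb => ?_
      have hiff : (∃ j' : Fin I.d, (j' : ℕ) < I.d ∧ (I.family ⟨i, hi⟩ j' ∈ I.vset (s.arr aL) ∨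
        I.D.σV (I.family ⟨i, hi⟩ j') ∈ I.vset (s.arr aL))) ↔
          Decided I (I.vset (s.arr aL)) ⟨i, hi⟩ :=
        ⟨fun ⟨j, _, h⟩ => ⟨j, h⟩, fun ⟨j, h⟩ => ⟨j, j.2, h⟩⟩
      simp only [hiff] at h3
      by_cases hdec : Decided I (I.vset (s.arr aL)) ⟨i, hi⟩
      · rw [if_pos hdec] at h3
        simp [exec, Safe, val, h3, k1, k2, k3, k4]
        refine ⟨by omega, fun _ => ⟨by ring, hI.imp (fun h => ⟨h.1, fun i' hi' => ?_⟩) id⟩⟩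
        rcases Nat.lt_or_eq_of_le hi' with hi' | hi'
        · exact h.2 i' hi'
        · obtain rfl : i' = ⟨i, hi⟩ := Fin.ext hi'
          exact hdec
      · rw [if_neg hdec] at h3
        simp [exec, Safe, val, h3, k1, k2, k3, k4]
        exact ⟨by have := hb.pos; omega, fun _ => ⟨by ring, ⟨i, hi⟩, .inl rfl, hdec⟩⟩
  · rintro s' hf hb ⟨-, hI⟩
    exact hI.imp_left fun h => ⟨h.1, fun i => h.2 i (by rw [f2]; exact i.2)⟩
  · rw [f2]
    by_cases ht : I.t = 0
    · rw [ht]; have : e ≤ I.n := min_le_right _ _; omega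
    · have hde : e = I.d := min_eq_left (hdn ht)
      have := hdn ht
      have : (I.t + 1) * (30 * (e + 1) + 40 + 8) = 30 * I.len + 78 * I.t + 30 * I.d + 78 := by
        rw [hlen, hde]; ring
      omega

end WordRAM

/-! ### Processing a node of the search tree -/

namespace MulticutInstance

variable {I : MulticutInstance}

theorem vset_update_one (f : ℕ → ℕ) (v : Fin I.n) :
    I.vset (Function.update f v 1) = insert v (I.vset f) := by
  ext w
  by_cases h : w = v
  · subst h; simp
  · have : (w : ℕ) ≠ v := fun e => h (Fin.ext e)
    simp [h, this]

theorem vset_update_zero {f : ℕ → ℕ} {v : Fin I.n} {Z : Set (Fin I.n)} (hv : v ∉ Z)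
    (hf : I.vset f = insert v Z) : I.vset (Function.update f v 0) = Z := by
  ext w
  by_cases h : w = v
  · subst h; simp [hv]
  · have h' : (w : ℕ) ≠ v := fun e => h (Fin.ext e)
    have := Set.ext_iff.1 hf w
    simp only [mem_vset, Set.mem_insert_iff, h, false_or] at this
    simp [h', this]

theorem aset_update_one (f : ℕ → ℕ) (a : Fin I.m) :
    I.aset (Function.update f a 1) = insert a (I.aset f) := by
  ext b
  by_cases h : b = a
  · subst h; simp
  · have : (b : ℕ) ≠ a := fun e => h (Fin.ext e)
    simp [h, this]

end MulticutInstance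

namespace WordRAM

open WordRAM.Expr WordRAM.Prog MulticutInstance SkewSymmDigraph

/-- The program halts in a state that satisfies `Q B` for some upper bound `B` of the number of
steps. In contrast to `Tri`, the bound may depend on the outcome. -/
def TriB (M : ℕ) (p : Prog) (s : State) (Q : ℕ → State → Prop) : Prop :=
  TriT M p s fun T s' => ∃ B, T ≤ B ∧ Q B s'

variable {I : MulticutInstance} {G : AdjGraph} {mate : ℕ → ℕ} {M : ℕ} {s : State}

theorem TriB.of_tri {p : Prog} {B : ℕ} {Q' : State → Prop} {Q : ℕ → State → Prop}
    (h : Tri M p s B Q') (hQ : ∀ s', Bdd M s' → Frame p s s' → Q' s' → Q B s') : TriB M p s Q :=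
  TriT.mono h fun _ s' hb hf h' => ⟨B, h'.1, hQ s' hb hf h'.2⟩

theorem TriB.seq {p q : Prog} {Q : ℕ → State → Prop} {B₁ : ℕ}
    (h : Tri M p s B₁ fun s' => Frame p s s' → Bdd M s' → TriB M q s' fun B => Q (B₁ + B)) :
    TriB M (.seq p q) s Q :=
  TriT.seq (TriT.mono h fun _ _ hb hf h' =>
    TriT.mono (h'.2 hf hb) fun _ _ _ _ ⟨B, h1, h2⟩ => ⟨B₁ + B, by have := h'.1; omega, h2⟩)

theorem TriB.cond {e : Expr} {p q : Prog} {Q : ℕ → State → Prop} (he : e.wt ≤ 16)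
    (h1 : e.val s ≠ 0 → TriB M p s fun B => Q (e.cost + 1 + B))
    (h2 : e.val s = 0 → TriB M q s fun B => Q (e.cost + 1 + B)) : TriB M (.cond e p q) s Q :=
  TriT.cond he
    (fun h => TriT.mono (h1 h) fun _ _ _ _ ⟨_, a, b⟩ => ⟨_, Nat.add_le_add_left a _, b⟩)
    (fun h => TriT.mono (h2 h) fun _ _ _ _ ⟨_, a, b⟩ => ⟨_, Nat.add_le_add_left a _, b⟩)

/-- Put two nodes on the stack of the pending nodes: one in which the head of the arc `rArc` is
added to `aL`, and one in which this arc and its conjugate are deleted. -/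
def pushArc : Prog :=
  (set rW (get aHd (.reg rArc)) ;; put aL (.reg rW) (const 1)) ;;
    pushNode ;;
    (put aL (.reg rW) (const 0) ;;
      put aDel (.reg rArc) (const 1) ;;
      put aDel (get aSA (.reg rArc)) (const 1) ;;
      set rBud (sub (.reg rBud) (const 2))) ;;
    pushNode

theorem pushArc_spec (hs : Static I G mate s) (hd : 1 ≤ I.d) (hM : stackBound I ≤ M)
    {l : List (Node I)} (hl : Stored I l s) {S : Finset (Fin I.m)} {L Z : Set (Fin I.n)} {c : ℕ}
    (hZ : I.vset (s.arr aL) = Z) (hS : I.aset (s.arr aDel) = S) (hSc : I.D.SelfConj S)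
    (hbud : S.card + s.reg rBud = 2 * I.k) (hcut : I.D.IsMaxCut S L Z c) (hc : c ≤ s.reg rBud)
    (hroom : l.length + 2 * I.d * (s.reg rBud + 1 - c) ≤ 2 * I.d * (2 * I.k + 1))
    {a : Fin I.m} (ha : a ∈ I.D.out S Z) (haZ : I.D.σV (I.D.head a) ∉ Z) (hrA : s.reg rArc = a) :
    Tri M pushArc s (200 * (I.n + I.m + 1)) (Stored I
      (⟨Z, insert a (insert (I.D.σA a) S), s.reg rBud - 2, c - 1⟩ ::
        ⟨insert (I.D.head a) Z, S, s.reg rBud, c + 1⟩ :: l)) := by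
  have ha' := mem_out.1 ha
  have hc1 : 1 ≤ c := hcut.card ▸ Finset.card_pos.2 ⟨a, ha⟩
  have hev : Even (s.reg rBud) := by
    have h1 := hSc.even_card
    rw [Nat.even_iff] at h1 ⊢
    omega
  have hb2 : 2 ≤ s.reg rBud := by
    rw [Nat.even_iff] at hev; omega
  have hgood1 : (⟨insert (I.D.head a) Z, S, s.reg rBud, c + 1⟩ : Node I).Good :=
    ⟨hSc, hbud, fun Y hY hYc => hcut.lt_insert ha'.2.2 haZ hY hYc⟩
  have hcard : (insert a (insert (I.D.σA a) S)).card = S.card + 2 := by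
    rw [Finset.card_insert_of_notMem, Finset.card_insert_of_notMem]
    · rw [hSc.mem_iff]; exact ha'.1
    · rw [Finset.mem_insert, not_or]
      exact ⟨(I.D.σA_ne a).symm, ha'.1⟩
  have hgood2 : (⟨Z, insert a (insert (I.D.σA a) S), s.reg rBud - 2, c - 1⟩ : Node I).Good := by
    refine ⟨?_, ?_, fun Y hY hYc => ?_⟩
    · intro b hb
      simp only [Finset.mem_insert] at hb ⊢
      rcases hb with rfl | rfl | hb
      · exact .inr (.inl rfl)
      · exact .inl (I.D.σA_σA a)
      · exact .inr (.inr (hSc b hb))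
    · simp only [hcard]; omega
    · have := hcut.le_of_delete ha'.2.2 haZ hY hYc
      simp only; omega
  have hstep : 2 * I.d * (s.reg rBud - c) + 2 * I.d = 2 * I.d * (s.reg rBud + 1 - c) := by
    rw [← Nat.mul_succ, show (s.reg rBud - c).succ = s.reg rBud + 1 - c by omega]
  refine Tri.seq 10 (180 * (I.n + I.m + 1)) ?_ (by omega)
  refine Tri.straight rfl (by decide) fun hb => ⟨?_, fun hf1 hb1 => ?_⟩
  · simp [Safe, exec, val, hb.pos, hb.arr]
  generalize hs1 : exec _ s = s₁ at hf1 hb1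
  have e1 : s₁.reg rW = I.D.head a := by subst hs1; simp [exec, val, hrA, hs.hd]
  have e2 : s₁.arr aL = Function.update (s.arr aL) (I.D.head a) 1 := by
    subst hs1; simp [exec, val, hrA, hs.hd]
  have e2' : I.vset (s₁.arr aL) = insert (I.D.head a) Z := by rw [e2, vset_update_one, hZ]
  have hs1' := hs.frame hf1 rfl
  have f1 : s₁.reg rBud = s.reg rBud := hf1.reg rBud rfl
  refine Tri.seq (60 * (I.n + I.m + 1)) (90 * (I.n + I.m + 1)) ?_ (by omega)
  refine Tri.mono (pushNode_spec hs1' hM (hl.frame hf1 rfl) _ hgood1 ?_ e2' ?_ f1) le_rfl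
    fun s₂ _ _ h2 hf2 hb2 => ?_
  · simp only [Nat.add_sub_add_right]; omega
  · simp only; rw [hf1.arr aDel rfl, hS]
  have hs2' := hs1'.frame hf2 rfl
  refine Tri.seq 30 (60 * (I.n + I.m + 1)) ?_ (by omega)
  refine Tri.straight rfl (by decide) fun hb => ⟨?_, fun hf3 hb3 => ?_⟩
  · have := hb.reg rBud
    simp [Safe, exec, val, hb.pos]; omega
  generalize hs3 : exec _ s₂ = s₃ at hf3 hb3
  have g1 : s₂.reg rW = I.D.head a := (hf2.reg rW rfl).trans e1
  have g2 : s₂.reg rArc = a := (hf2.reg rArc rfl).trans ((hf1.reg rArc rfl).trans hrA)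
  have g3 : s₂.reg rBud = s.reg rBud := (hf2.reg rBud rfl).trans f1
  have g4 : s₂.arr aL = s₁.arr aL := hf2.arr aL rfl
  have g5 : s₂.arr aDel = s.arr aDel := (hf2.arr aDel rfl).trans (hf1.arr aDel rfl)
  have k1 : s₃.arr aL = Function.update (s₁.arr aL) (I.D.head a) 0 := by
    subst hs3; simp [exec, val, g1, g4]
  have k2 : s₃.arr aDel = Function.update (Function.update (s.arr aDel) a 1) (I.D.σA a) 1 := by
    subst hs3; simp [exec, val, g2, g5, hs2'.sa]
  have k3 : s₃.reg rBud = s.reg rBud - 2 := by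
    subst hs3; simp [exec, val, g3]
  refine Tri.mono (pushNode_spec (hs2'.frame hf3 rfl) hM (h2.frame hf3 rfl) _ hgood2 ?_ ?_ ?_ k3)
    le_rfl fun s₄ _ _ h4 => h4
  · simp only [List.length_cons]
    rw [show s.reg rBud - 2 + 1 - (c - 1) = s.reg rBud - c by omega]
    omega
  · rw [k1]; exact vset_update_zero ha'.2.2 e2'
  · rw [k2, aset_update_one, aset_update_one, hS, Finset.insert_comm]

/-- For each member of the set of the family whose first member has the index `rTmp`, put two nodes
on the stack of the pending nodes, in which the member or its conjugate is added to `aL`. -/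
def pushMembers : Prog :=
  Prog.for rI rD
    ((set rV (get aFam (add (.reg rTmp) (.reg rI))) ;; put aL (.reg rV) (const 1)) ;;
      pushNode ;;
      (put aL (.reg rV) (const 0) ;;
        set rV (get aSV (.reg rV)) ;;
        put aL (.reg rV) (const 1)) ;;
      pushNode ;;
      put aL (.reg rV) (const 0))

theorem pushMembers_spec (hs : Static I G mate s) (hd : 1 ≤ I.d) (hM : stackBound I ≤ M)
    {l : List (Node I)} (hl : Stored I l s) {S : Finset (Fin I.m)} {Z : Set (Fin I.n)}
    (hZ : I.vset (s.arr aL) = Z) (hS : I.aset (s.arr aDel) = S) (hSc : I.D.SelfConj S)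
    (hbud : S.card + s.reg rBud = 2 * I.k)
    (hpos : ∀ w, w ∉ Z → I.D.σV w ∉ Z → ∀ Y, insert w Z ⊆ Y → I.D.Consistent Y →
      1 ≤ (I.D.out S Y).card)
    (hroom : l.length + 2 * I.d * (s.reg rBud + 1) ≤ 2 * I.d * (2 * I.k + 1))
    {i : Fin I.t} (hi : s.reg rTmp = i * I.d) (hdec : ¬ Decided I Z i) :
    Tri M pushMembers s (400 * (I.d * (I.n + I.m + 1))) fun s' => ∃ l', Stored I l' s' ∧
      potential l' + 2 * I.d = potential l + 2 * (2 * I.d * weight I.d (s.reg rBud) 1) ∧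
      (∀ y ∈ l, y ∈ l') ∧ ∀ j, (∃ y ∈ l', y.S = S ∧ y.L = insert (I.family i j) Z) ∧
        ∃ y ∈ l', y.S = S ∧ y.L = insert (I.D.σV (I.family i j)) Z := by
  have hwt : 1 ≤ weight I.d (s.reg rBud) 1 := weight_pos hd
  have hund : ∀ j, I.family i j ∉ Z ∧ I.D.σV (I.family i j) ∉ Z := fun j => by
    constructor
    · exact fun h => hdec ⟨j, .inl h⟩
    · exact fun h => hdec ⟨j, .inr h⟩
  have hgood : ∀ w, w ∉ Z → I.D.σV w ∉ Z →
      (⟨insert w Z, S, s.reg rBud, 1⟩ : Node I).Good := fun w h1 h2 =>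
    ⟨hSc, hbud, fun Y hY hYc => hpos w h1 h2 Y hY hYc⟩
  rw [Nat.mul_succ] at hroom
  refine Tri.for (fun j s' => I.vset (s'.arr aL) = Z ∧ ∃ l', Stored I l' s' ∧
      l'.length = l.length + 2 * j ∧
      potential l' + 2 * j = potential l + 2 * (2 * j * weight I.d (s.reg rBud) 1) ∧
      (∀ y ∈ l, y ∈ l') ∧ ∀ j' : Fin I.d, (j' : ℕ) < j →
        (∃ y ∈ l', y.S = S ∧ y.L = insert (I.family i j') Z) ∧
        ∃ y ∈ l', y.S = S ∧ y.L = insert (I.D.σV (I.family i j')) Z)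
    (180 * (I.n + I.m + 1)) rfl rfl (by decide) ?_ ?_ ?_ ?_
  · refine ⟨hZ, l, ⟨hl.num, hl.offL, hl.offD,
      hl.frontier.congr (fun _ _ => rfl) (fun _ _ => rfl) fun _ _ => rfl⟩, by simp⟩
  · rintro j s' hf hb hj hx ⟨h1, l', h2, h3, h4, h5, h6⟩
    rw [hs.d] at hj
    have hs' := hs.frame hf rfl
    have hfam := hs'.fam i ⟨j, hj⟩
    have hw : s'.reg rTmp = i * I.d := (hf.reg rTmp rfl).trans hi
    set v := I.family i ⟨j, hj⟩ with hv
    obtain ⟨u1, u2⟩ := hund ⟨j, hj⟩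
    rw [← hv] at u1 u2
    have u1' : I.D.σV (I.D.σV v) ∉ Z := by rwa [I.D.σV_σV]
    simp only at hfam
    refine Tri.seq 15 (160 * (I.n + I.m + 1)) ?_ (by omega)
    refine Tri.straight rfl (by decide) fun hb => ⟨?_, fun hf1 hb1 => ?_⟩
    · simp [Safe, exec, val, hb.pos, hb.arr]
    generalize hs1 : exec _ s' = s₁ at hf1 hb1
    have e1 : s₁.reg rV = v := by subst hs1; simp [exec, val, hx, hw, hfam]
    have e2 : s₁.arr aL = Function.update (s'.arr aL) v 1 := by
      subst hs1; simp [exec, val, hx, hw, hfam]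
    have e2' : I.vset (s₁.arr aL) = insert v Z := by rw [e2, vset_update_one, h1]
    have e3 : s₁.reg rBud = s.reg rBud := (hf1.reg rBud rfl).trans (hf.reg rBud rfl)
    have e4 : I.aset (s₁.arr aDel) = S := by rw [hf1.arr aDel rfl, hf.arr aDel rfl, hS]
    have hs1' := hs'.frame hf1 rfl
    refine Tri.seq (60 * (I.n + I.m + 1)) (90 * (I.n + I.m + 1)) ?_ (by omega)
    refine Tri.mono (pushNode_spec hs1' hM (h2.frame hf1 rfl) _ (hgood v u1 u2) ?_ e2' e4 e3) le_rfl
      fun s₂ _ _ k2 hf2 hb2 => ?_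
    · simp only [Nat.add_sub_cancel]; omega
    have hs2' := hs1'.frame hf2 rfl
    have g1 : s₂.reg rV = v := (hf2.reg rV rfl).trans e1
    have g2 : s₂.arr aL = s₁.arr aL := hf2.arr aL rfl
    refine Tri.seq 15 (75 * (I.n + I.m + 1)) ?_ (by omega)
    refine Tri.straight rfl (by decide) fun hb => ⟨?_, fun hf3 hb3 => ?_⟩
    · simp [Safe, exec, val, hb.pos, hb.arr]
    generalize hs3 : exec _ s₂ = s₃ at hf3 hb3
    have k1 : s₃.reg rV = I.D.σV v := by subst hs3; simp [exec, val, g1, hs2'.sv]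
    have k3 : s₃.arr aL = Function.update (Function.update (s₁.arr aL) v 0) (I.D.σV v) 1 := by
      subst hs3; simp [exec, val, g1, g2, hs2'.sv]
    have k3' : I.vset (s₃.arr aL) = insert (I.D.σV v) Z := by
      rw [k3, vset_update_one, vset_update_zero u1 e2']
    have k4 : s₃.reg rBud = s.reg rBud := (hf3.reg rBud rfl).trans ((hf2.reg rBud rfl).trans e3)
    have k5 : I.aset (s₃.arr aDel) = S := by rw [hf3.arr aDel rfl, hf2.arr aDel rfl, e4]
    refine Tri.seq (60 * (I.n + I.m + 1)) (10 * (I.n + I.m + 1)) ?_ (by omega)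
    refine Tri.mono (pushNode_spec (hs2'.frame hf3 rfl) hM (k2.frame hf3 rfl) _ (hgood _ u2 u1') ?_
      k3' k5 k4) le_rfl fun s₄ _ _ k6 hf4 hb4 => ?_
    · simp only [Nat.add_sub_cancel, List.length_cons]; omega
    refine Tri.straight rfl (by simp [cst, cost]; omega) fun hb => ⟨by simp [Safe, val], fun _ => ?_⟩
    have m1 : s₄.reg rV = I.D.σV v := (hf4.reg rV rfl).trans k1
    have m2 : s₄.arr aL = s₃.arr aL := hf4.arr aL rfl
    refine ⟨?_, _, ⟨?_, ?_, ?_, k6.frontier.congr (fun _ _ => ?_) (fun _ _ => ?_) fun _ _ => ?_⟩,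
      ?_, ?_, ?_, ?_⟩
    · simp only [exec, val, m1, State.setReg_arr, State.setArr_arr, if_pos, m2]
      exact vset_update_zero u2 k3'
    · simpa [exec, val] using k6.num
    · simpa [exec, val] using k6.offL
    · simpa [exec, val] using k6.offD
    · simp [exec, val]
    · simp [exec, val]
    · simp [exec, val]
    · simp only [List.length_cons, h3]; ring
    · have : 2 * (2 * (j + 1) * weight I.d (s.reg rBud) 1) =
        2 * (2 * j * weight I.d (s.reg rBud) 1) + 4 * weight I.d (s.reg rBud) 1 := by ring
      simp only [potential_cons]
      omega
    · exact fun y hy => List.mem_cons_of_mem _ (List.mem_cons_of_mem _ (h5 y hy))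
    · intro j' hj'
      rcases Nat.lt_succ_iff_lt_or_eq.1 hj' with hj' | hj'
      · obtain ⟨⟨y, hy, hy'⟩, z, hz, hz'⟩ := h6 j' hj'
        exact ⟨⟨y, List.mem_cons_of_mem _ (List.mem_cons_of_mem _ hy), hy'⟩,
          z, List.mem_cons_of_mem _ (List.mem_cons_of_mem _ hz), hz'⟩
      · obtain rfl : j' = ⟨j, hj⟩ := Fin.ext hj'
        exact ⟨⟨_, List.mem_cons_of_mem _ List.mem_cons_self, rfl, rfl⟩,
          _, List.mem_cons_self, rfl, rfl⟩
  · rintro s' hf hb ⟨-, l', h2, h3, h4, h5, h6⟩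
    rw [hs.d] at h4 h6
    exact ⟨l', h2, h4, h5, fun j => h6 j j.2⟩
  · rw [hs.d]
    have e1 : 1 * (I.n + I.m + 1) ≤ I.d * (I.n + I.m + 1) := Nat.mul_le_mul_right _ hd
    have e2 : (I.d + 1) * (180 * (I.n + I.m + 1) + 8) =
      180 * (I.d * (I.n + I.m + 1)) + 8 * I.d + 180 * (I.n + I.m + 1) + 8 := by ring
    have e3 : I.d * 1 ≤ I.d * (I.n + I.m + 1) := Nat.mul_le_mul_left _ (by omega)
    omega

/-- Process the node given by `aL`, `aDel` and `rBud`: put its children on the stack of the pending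
nodes, or empty the stack and set `rAns` if `aDel` has become a multicut. -/
def processNode : Prog :=
  analyse ;;
    cond (.reg rFail) skip
      (findArc ;;
        cond (lt (.reg rArc) (.reg rM)) pushArc
          (forceArcs ;;
            findSet ;;
            cond (.reg rViol) (cond (.reg rBud) pushMembers skip)
              (set rAns (const 1) ;; set rNum (const 0))))

/-- The outcome of processing the node `x` while the nodes in `l` are pending, with `B` as an upper
bound for the running time: either `aDel` is a multicut and the search is over, or the nodes in
`l'` are pending now, and the potential has dropped by `b`, which pays for the running time. -/
def Outcome (I : MulticutInstance) (C : ℕ) (x : Node I) (l : List (Node I)) (B : ℕ)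
    (s : State) : Prop :=
  (s.reg rAns ≠ 0 ∧ s.reg rNum = 0 ∧ I.IsMulticut (I.aset (s.arr aDel)) ∧ B ≤ C) ∨
    (s.reg rAns = 0 ∧ ∃ l' b, Stored I l' s ∧ B ≤ C * b ∧ 1 ≤ b ∧
      potential l' + b ≤ potential (x :: l) ∧ (∀ y ∈ l, y ∈ l') ∧
      (I.Sol x.S x.L → ∃ y ∈ l', I.Sol y.S y.L))

theorem Outcome.of_not_sol {C B : ℕ} {x : Node I} {l : List (Node I)} (hd : 1 ≤ I.d)
    (h0 : s.reg rAns = 0) (hl : Stored I l s) (hB : B ≤ C) (h : ¬ I.Sol x.S x.L) :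
    Outcome I C x l B s := by
  have := weight_pos (K := x.bud) (l := x.lam) hd
  refine .inr ⟨h0, l, 1, hl, by omega, le_rfl, ?_, fun _ h => h, fun h' => absurd h' h⟩
  rw [potential_cons]; omega

/-- The potential drops by at least half the number of children, which pays for storing them. -/
theorem processNode_spec (hs : Static I G mate s) (hd : 1 ≤ I.d) (hM : stackBound I ≤ M)
    (hM' : 2 * I.n + 2 ≤ M) (hM'' : I.len + I.d ≤ M) {l : List (Node I)} {x : Node I}
    (hl : Stored I l s) (hx : x.Good)
    (hroom : l.length + 2 * I.d * (x.bud + 1 - x.lam) ≤ 2 * I.d * (2 * I.k + 1))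
    (hL : I.vset (s.arr aL) = x.L) (hS : I.aset (s.arr aDel) = x.S) (hK : s.reg rBud = x.bud)
    (h0 : s.reg rAns = 0) :
    TriB M processNode s
      (Outcome I (5000 * ((2 * I.k + 2) * (I.len + I.m + I.n + 1))) x l) := by
  classical
  set N := I.len + I.m + I.n + 1 with hN
  set U := (2 * I.k + 2) * N with hU
  have hNU : 2 * N ≤ U := Nat.mul_le_mul_right _ (by omega)
  have hle : (x.bud + 2) * (I.n + I.m + 1) ≤ U :=
    Nat.mul_le_mul (by have := hx.card; omega) (by omega)
  refine TriB.seq (B₁ := 2000 * U) (Tri.mono (analyse_spec hs hM' (hS ▸ hx.conj))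
    (by rw [hK]; omega) fun s₁ _ _ h1 hf1 hb1 => ?_)
  rw [hL, hS, hK] at h1
  have hs1 := hs.frame hf1 rfl
  have hl1 := hl.frame hf1 rfl
  have hD1 : I.aset (s₁.arr aDel) = x.S := by rw [hf1.arr aDel rfl, hS]
  have hK1 : s₁.reg rBud = x.bud := (hf1.reg rBud rfl).trans hK
  have h01 : s₁.reg rAns = 0 := (hf1.reg rAns rfl).trans h0
  refine TriB.cond (by decide) (fun hfail => ?_) fun hfail => ?_
  · obtain ⟨-, hbig⟩ := h1.resolve_right fun h => hfail h.1
    refine TriB.of_tri (Tri.straight (B := 1) (Q := fun s' => s' = s₁) rfl le_rfl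
      fun _ => ⟨trivial, rfl⟩) ?_
    rintro _ - - rfl
    refine Outcome.of_not_sol hd h01 hl1 (by simp only [cost]; omega) fun h => ?_
    obtain ⟨Y, hLY, hYc, hcard⟩ := h.exists_cut
    have := hbig Y hLY fun v hv => hYc v (hLY hv)
    have := hx.card
    omega
  obtain ⟨-, c, hc, hcut⟩ := h1.resolve_left fun h => h.1 hfail
  set Z := I.vset (s₁.arr aL) with hZ
  have hlam : x.lam ≤ c := hcut.card ▸ hx.le Z hcut.subset hcut.consistent
  have hanti : weight I.d x.bud c ≤ weight I.d x.bud x.lam := weight_anti hd hx.even hlam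
  have hroom' : l.length + 2 * I.d * (x.bud + 1 - c) ≤ 2 * I.d * (2 * I.k + 1) :=
    (Nat.add_le_add_left (Nat.mul_le_mul_left _ (by omega)) _).trans hroom
  refine TriB.seq (B₁ := 60 * N) (Tri.mono (findArc_spec hs1) (by omega)
    fun s₂ _ _ h2 hf2 hb2 => ?_)
  rw [hD1, ← hZ] at h2
  have hs2 := hs1.frame hf2 rfl
  have hl2 := hl1.frame hf2 rfl
  have hZ2 : I.vset (s₂.arr aL) = Z := by rw [hf2.arr aL rfl]
  have hD2 : I.aset (s₂.arr aDel) = x.S := by rw [hf2.arr aDel rfl, hD1]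
  have hK2 : s₂.reg rBud = x.bud := (hf2.reg rBud rfl).trans hK1
  have h02 : s₂.reg rAns = 0 := (hf2.reg rAns rfl).trans h01
  refine TriB.cond (by decide) (fun harc => ?_) fun harc => ?_
  · -- An arc that leaves the cut has an undecided head: keep it or delete it.
    have harc' : s₂.reg rArc < I.m := by
      by_contra h
      simp [val, hs2.m, h] at harc
    obtain ⟨a, ha, hra, haZ⟩ := h2.resolve_left fun h => by omega
    have hc1 : 1 ≤ c := hcut.card ▸ Finset.card_pos.2 ⟨a, ha⟩
    refine TriB.of_tri (pushArc_spec hs2 hd hM hl2 hZ2 hD2 hx.conj (by rw [hK2]; exact hx.card)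
      hcut (by rwa [hK2]) (by rwa [hK2]) ha haZ hra) fun s₃ _ hf3 h3 => .inr ⟨?_, _, 1, h3, ?_,
        le_rfl, ?_, ?_, fun hsol => ?_⟩
    · exact (hf3.reg rAns rfl).trans h02
    · simp only [cost]; omega
    · have w1 := weight_succ (d := I.d) hc1 hc
      have w2 := weight_sub_two hd hx.even hc1 hc
      have w3 := weight_pos (K := x.bud) (l := c + 1) hd
      have w4 := weight_pos (K := x.bud - 2) (l := c - 1) hd
      simp only [potential_cons, hK2]
      omega
    · exact fun y hy => List.mem_cons_of_mem _ (List.mem_cons_of_mem _ hy)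
    · rcases (hsol.persist hx.conj hcut).delete_or_keep (mem_out.1 ha).2.1 with h | h
      · exact ⟨_, List.mem_cons_self, h⟩
      · exact ⟨_, List.mem_cons_of_mem _ List.mem_cons_self, h⟩
  have harc' : ¬ s₂.reg rArc < I.m := by
    intro h
    simp [val, hs2.m, h] at harc
  obtain ⟨-, hforced⟩ := h2.resolve_right fun ⟨a, _, ha, _⟩ => harc' (ha ▸ a.2)
  -- Every arc that leaves the cut is forced into the multicut.
  refine TriB.seq (B₁ := 60 * N) (Tri.mono (forceArcs_spec hs2) (by omega)
    fun s₃ _ _ h3 hf3 hb3 => ?_)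
  rw [hD2, hZ2, hK2, hcut.card] at h3
  have hs3 := hs2.frame hf3 rfl
  have hl3 := hl2.frame hf3 rfl
  have hZ3 : I.vset (s₃.arr aL) = Z := by rw [hf3.arr aL rfl, hZ2]
  have h03 : s₃.reg rAns = 0 := (hf3.reg rAns rfl).trans h02
  obtain ⟨hD3, hK3⟩ := h3
  set S' := x.S ∪ I.D.out x.S Z with hS'
  have hoc : I.D.SelfConj (I.D.out x.S Z) := selfConj_out hx.conj hforced hcut.consistent
  have hSc : I.D.SelfConj S' := hx.conj.union hoc
  have hcard : S'.card + (x.bud - c) = 2 * I.k := by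
    rw [hS', Finset.card_union_of_disjoint
      (Finset.disjoint_right.2 fun a ha => (mem_out.1 ha).1), hcut.card]
    have := hx.card
    omega
  have hceven : Even c := hcut.card ▸ hoc.even_card
  have hsol' : I.Sol x.S x.L → I.Sol S' Z := fun h => (h.persist hx.conj hcut).forced hforced
  refine TriB.seq (B₁ := 200 * N) (Tri.mono (findSet_spec hs3 hM'' hd) (by omega)
    fun s₄ _ _ h4 hf4 hb4 => ?_)
  rw [hZ3] at h4
  have hs4 := hs3.frame hf4 rfl
  have hl4 := hl3.frame hf4 rfl
  have hZ4 : I.vset (s₄.arr aL) = Z := by rw [hf4.arr aL rfl, hZ3]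
  have hD4 : I.aset (s₄.arr aDel) = S' := by rw [hf4.arr aDel rfl, hD3]
  have hK4 : s₄.reg rBud = x.bud - c := (hf4.reg rBud rfl).trans hK3
  have h04 : s₄.reg rAns = 0 := (hf4.reg rAns rfl).trans h03
  have hpos : ∀ w, w ∉ Z → I.D.σV w ∉ Z → ∀ Y, insert w Z ⊆ Y → I.D.Consistent Y →
      1 ≤ (I.D.out S' Y).card := fun w h1 h2 Y hY hYc => hcut.pos_of_forced h1 h2 hY hYc
  refine TriB.cond (by decide) (fun hviol => ?_) fun hviol => ?_
  · replace h4 := h4.resolve_left fun h => hviol h.1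
    obtain ⟨-, i, htmp, hdec⟩ := h4
    refine TriB.cond (by decide) (fun hbud => ?_) fun hbud => ?_
    · have hbud' : c < x.bud := Nat.lt_of_sub_ne_zero (hK4 ▸ hbud)
      refine TriB.of_tri (pushMembers_spec hs4 hd hM hl4 hZ4 hD4 hSc (by rw [hK4]; exact hcard)
        hpos (by rwa [hK4, show x.bud - c + 1 = x.bud + 1 - c by omega]) htmp hdec)
        fun s₅ _ hf5 ⟨l', h5, h6, h7, h8⟩ => .inr ⟨?_, l', I.d, h5, ?_, hd, ?_, h7, fun hsol => ?_⟩
      · exact (hf5.reg rAns rfl).trans h04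
      · have e1 : I.d * (I.n + I.m + 1) ≤ I.d * U := Nat.mul_le_mul_left _ (by omega)
        have e2 : 1 * U ≤ I.d * U := Nat.mul_le_mul_right _ hd
        have e3 : 5000 * U * I.d = 5000 * (I.d * U) := by ring
        rw [e3]
        simp only [cost]; omega
      · have w1 := weight_sub hd hx.even hceven hbud'
        rw [hK4] at h6
        rw [potential_cons]
        omega
      · obtain ⟨j, hj | hj⟩ := (hsol' hsol).member i
        · obtain ⟨y, hy, e1, e2⟩ := (h8 j).1
          exact ⟨y, hy, by rwa [e1, e2]⟩
        · obtain ⟨y, hy, e1, e2⟩ := (h8 j).2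
          exact ⟨y, hy, by rwa [e1, e2]⟩
    · refine TriB.of_tri (Tri.straight (B := 1) (Q := fun s' => s' = s₄) rfl le_rfl
        fun _ => ⟨trivial, rfl⟩) ?_
      rintro s₅ - - h5
      rw [h5]
      refine Outcome.of_not_sol hd h04 hl4 (by simp only [cost]; omega) fun hsol => ?_
      have hbud' : s₄.reg rBud = 0 := hbud
      obtain ⟨j, hj⟩ := (hsol' hsol).member i
      have hn1 : I.family i j ∉ Z := fun h => hdec ⟨j, .inl h⟩
      have hn2 : I.D.σV (I.family i j) ∉ Z := fun h => hdec ⟨j, .inr h⟩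
      rcases hj with hj | hj <;> obtain ⟨Y, hY, hYc, hYk⟩ := hj.exists_cut
      · have := hpos _ hn1 hn2 Y hY hYc
        omega
      · have := hpos _ hn2 (by rwa [I.D.σV_σV]) Y hY hYc
        omega
  · obtain ⟨-, hall⟩ := h4.resolve_right fun h => h.1 hviol
    refine TriB.of_tri (Tri.straight (B := 4) (Q := fun s' => s'.reg rAns ≠ 0 ∧ s'.reg rNum = 0 ∧
      s'.arr aDel = s₄.arr aDel) rfl (by decide)
      fun hb => ⟨by simp [Safe, val, hb.pos], by simp [exec, val]⟩) ?_
    rintro s₅ - - ⟨h5, h6, h7⟩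
    refine .inl ⟨h5, h6, ?_, by simp only [cost]; omega⟩
    rw [h7, hD4]
    refine isMulticut_of_out_eq_empty hSc (by omega) hcut.consistent ?_ hall
    ext a
    simp only [hS', mem_out, Finset.mem_union, Finset.notMem_empty, iff_false]
    tauto

end WordRAM

/-! ### The program -/

namespace WordRAM

open WordRAM.Expr WordRAM.Prog MulticutInstance SkewSymmDigraph

variable {I : MulticutInstance} {M : ℕ} {s : State}

/-- Write down the two opposite arcs of each arc of the instance. -/
def buildArcs : Prog :=
  Prog.for rX rM
    (put aSrc (add (.reg rX) (const 1)) (get aTl (.reg rX)) ;;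
      put aSrc (add (add (.reg rM) (.reg rX)) (const 1)) (get aHd (.reg rX)) ;;
      put aTgt (add (.reg rX) (const 1)) (get aHd (.reg rX)) ;;
      put aTgt (add (add (.reg rM) (.reg rX)) (const 1)) (get aTl (.reg rX)) ;;
      put aMate (add (.reg rX) (const 1)) (add (add (.reg rM) (.reg rX)) (const 1)) ;;
      put aMate (add (add (.reg rM) (.reg rX)) (const 1)) (add (.reg rX) (const 1)))

/-- Build the adjacency lists. -/
def buildLists : Prog :=
  set rH (add (.reg rM) (.reg rM)) ;;
    Prog.for rX rH
      (put aNxt (add (.reg rX) (const 1)) (get aFst (get aSrc (add (.reg rX) (const 1)))) ;;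
        put aFst (get aSrc (add (.reg rX) (const 1))) (add (.reg rX) (const 1)))

theorem input_tl (a : Fin I.m) : I.input.arr aTl a = I.D.tail a := by
  simp [MulticutInstance.input]

theorem input_hd (a : Fin I.m) : I.input.arr aHd a = I.D.head a := by
  simp [MulticutInstance.input]

theorem input_fam (i : Fin I.t) (j : Fin I.d) :
    I.input.arr aFam (i * I.d + j) = I.family i j := by
  have hd : 0 < I.d := j.pos
  have h : (i : ℕ) * I.d + j < I.t * I.d :=
    calc (i : ℕ) * I.d + j < (i + 1) * I.d := by rw [Nat.succ_mul]; have := j.2; omega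
      _ ≤ I.t * I.d := Nat.mul_le_mul_right _ i.2
  have h1 : Fin.divNat (⟨i * I.d + j, h⟩ : Fin (I.t * I.d)) = i := by
    ext
    simp [Fin.divNat, Nat.add_div_of_dvd_right, hd]
  have h2 : Fin.modNat (⟨i * I.d + j, h⟩ : Fin (I.t * I.d)) = j := by
    ext
    simp [Fin.modNat, Nat.mod_eq_of_lt]
  simp only [MulticutInstance.input, dif_pos h, h1, h2]

theorem bdd_input (hM : I.size ≤ M) (hd : 1 ≤ I.d) : Bdd M I.input := by
  have hlen : I.len = I.d * I.t := rfl
  have ht : I.t ≤ I.len := Nat.le_mul_of_pos_left _ hd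
  unfold MulticutInstance.size at hM
  refine ⟨by omega, fun x => ?_, fun a i => ?_⟩
  · simp only [MulticutInstance.input]; split <;> omega
  · simp only [MulticutInstance.input]
    split
    all_goals first | (split <;> omega) | omega

theorem buildArcs_spec (hM : 2 * I.m + 1 ≤ M) :
    Tri M buildArcs I.input (80 * (I.m + 1)) fun s' => ∀ a : Fin I.m,
      (s'.arr aSrc (a + 1) = I.D.tail a ∧ s'.arr aSrc (I.m + a + 1) = I.D.head a) ∧
      (s'.arr aTgt (a + 1) = I.D.head a ∧ s'.arr aTgt (I.m + a + 1) = I.D.tail a) ∧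
      s'.arr aMate (a + 1) = I.m + a + 1 ∧ s'.arr aMate (I.m + a + 1) = a + 1 := by
  refine Tri.for (fun i s' => ∀ a : Fin I.m, (a : ℕ) < i →
      (s'.arr aSrc (a + 1) = I.D.tail a ∧ s'.arr aSrc (I.m + a + 1) = I.D.head a) ∧
      (s'.arr aTgt (a + 1) = I.D.head a ∧ s'.arr aTgt (I.m + a + 1) = I.D.tail a) ∧
      s'.arr aMate (a + 1) = I.m + a + 1 ∧ s'.arr aMate (I.m + a + 1) = a + 1)
    60 rfl rfl (by decide) (by simp) ?_ ?_ ?_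
  · intro i s' hf hb hi hx hI
    have hm : s'.reg rM = I.m := hf.reg rM rfl
    have hi' : i < I.m := hi
    have hT := input_tl ⟨i, hi'⟩
    have hH := input_hd ⟨i, hi'⟩
    rw [← hf.arr aTl rfl] at hT
    rw [← hf.arr aHd rfl] at hH
    simp only at hT hH
    refine Tri.straight rfl (by decide) fun _ => ⟨?_, fun _ a ha => ?_⟩
    · have b1 := hb.arr aTl i
      have b2 := hb.arr aHd i
      rw [hT] at b1
      rw [hH] at b2
      simp [Safe, exec, val, hx, hm, hT, hH]
      omega
    · have := a.2
      have n1 : ¬ (a : ℕ) + 1 = I.m + i + 1 := by omega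
      have n2 : ¬ I.m + (a : ℕ) = i := by omega
      have n3 : ¬ (a : ℕ) = I.m + i := by omega
      by_cases hai : (a : ℕ) = i
      · obtain rfl : a = ⟨i, hi'⟩ := Fin.ext hai
        simp [exec, val, hx, hm, hT, hH, Function.update_apply, n2, n3]
        exact ⟨fun h => absurd h (by omega), fun h => absurd h (by omega)⟩
      · have := hI a (by omega)
        simpa [exec, val, hx, hm, hT, hH, Function.update_apply, hai, n1, n2, n3] using this
  · exact fun s' _ _ h a => h a a.2
  · simp only [MulticutInstance.input]; omega

theorem buildLists_spec (hm : s.reg rM = I.m) (hM : 2 * I.m + 1 ≤ M)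
    (hsrc : ∀ h, 1 ≤ h → h ≤ 2 * I.m → s.arr aSrc h < I.n)
    (htgt : ∀ h, 1 ≤ h → h ≤ 2 * I.m → s.arr aTgt h < I.n) (h0 : ∀ v, s.arr aFst v = 0) :
    Tri M buildLists s (120 * (I.m + 1)) fun s' => ∃ G : AdjGraph, G.n = I.n ∧ G.H = 2 * I.m ∧
      Loaded G s' := by
  refine Tri.seq 4 (50 * (2 * I.m + 1)) ?_ (by omega)
  refine Tri.straight rfl (by decide) fun _ => ⟨by simp [Safe, val, hm]; omega, fun hf0 hb0 => ?_⟩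
  have hH : (exec (set rH (add (.reg rM) (.reg rM))) s).reg rH = 2 * I.m := by
    simp [exec, val, hm]; omega
  refine Tri.for (fun i s' =>
      (∀ v, s'.arr aFst v ≤ i ∧ (s'.arr aFst v ≠ 0 → s.arr aSrc (s'.arr aFst v) = v) ∧
        ∀ r, s'.arr aFst v < r → r ≤ i → s.arr aSrc r ≠ v) ∧
      ∀ h, 1 ≤ h → h ≤ i → s'.arr aNxt h < h ∧
        (s'.arr aNxt h ≠ 0 → s.arr aSrc (s'.arr aNxt h) = s.arr aSrc h) ∧
        ∀ r, s'.arr aNxt h < r → r < h → s.arr aSrc r ≠ s.arr aSrc h)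
    30 rfl rfl (by decide) ?_ ?_ ?_ ?_
  · refine ⟨fun v => ?_, fun h h1 h2 => by omega⟩
    have : s.arr aFst v = 0 := h0 v
    simp [exec, this]
    intro r h1 h2; omega
  · rintro i s' hf hb hi hx ⟨h1, h2⟩
    rw [hH] at hi
    have hS : s'.arr aSrc = s.arr aSrc := (hf.arr aSrc rfl).trans (hf0.arr aSrc rfl)
    refine Tri.straight rfl (by decide) fun _ => ⟨?_, fun _ => ⟨fun v => ?_, fun h hh1 hh2 => ?_⟩⟩
    · simp [Safe, exec, val, hx, hb.arr]; omega
    · obtain ⟨a1, a2, a3⟩ := h1 v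
      by_cases hv : v = s.arr aSrc (i + 1)
      · simp [exec, val, hx, hS, ← hv]
        intro r r1 r2; omega
      · simp [exec, val, hx, hS, Function.update_of_ne hv]
        refine ⟨by omega, a2, fun r r1 r2 e => ?_⟩
        rcases Nat.lt_or_eq_of_le r2 with r2 | rfl
        · exact a3 r r1 (by omega) e
        · exact hv e.symm
    · by_cases hh : h = i + 1
      · subst hh
        obtain ⟨a1, a2, a3⟩ := h1 (s.arr aSrc (i + 1))
        simp [exec, val, hx, hS]
        exact ⟨by omega, a2, fun r r1 r2 => a3 r r1 (by omega)⟩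
      · have := h2 h hh1 (by omega)
        simpa [exec, val, hx, hS, Function.update_of_ne hh] using this
  · rintro s' hf hb ⟨h1, h2⟩
    rw [hH] at h1 h2
    have hS : s'.arr aSrc = s.arr aSrc := (hf.arr aSrc rfl).trans (hf0.arr aSrc rfl)
    have hT : s'.arr aTgt = s.arr aTgt := (hf.arr aTgt rfl).trans (hf0.arr aTgt rfl)
    refine ⟨{ n := I.n, H := 2 * I.m, src := s'.arr aSrc, tgt := s'.arr aTgt,
              first := s'.arr aFst, nxt := s'.arr aNxt
              src_lt := hS ▸ hsrc, tgt_lt := hT ▸ htgt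
              first_le := fun v _ => (h1 v).1
              src_first := fun v _ => hS ▸ (h1 v).2.1
              first_max := fun v _ => hS ▸ (h1 v).2.2
              nxt_lt := fun h a b => (h2 h a b).1
              src_nxt := fun h a b => hS ▸ (h2 h a b).2.1
              nxt_max := fun h a b => hS ▸ (h2 h a b).2.2 }, rfl, rfl, rfl, rfl, rfl, rfl⟩
  · rw [hH]; omega

/-- Build the graph of the instance. -/
def build : Prog := buildArcs ;; buildLists

theorem build_spec (hM : 2 * I.m + 1 ≤ M) :
    Tri M build I.input (200 * (I.m + 1)) fun s' => ∃ G mate, Static I G mate s' := by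
  refine Tri.seq (80 * (I.m + 1)) (120 * (I.m + 1)) ?_ (by omega)
  refine Tri.mono (buildArcs_spec hM) le_rfl fun s₁ _ _ h1 hf1 hb1 => ?_
  have hcases : ∀ h, 1 ≤ h → h ≤ 2 * I.m → (∃ a : Fin I.m, h = a + 1) ∨
      ∃ a : Fin I.m, h = I.m + a + 1 := by
    intro h h1 h2
    by_cases h3 : h ≤ I.m
    · exact .inl ⟨⟨h - 1, by omega⟩, by simp; omega⟩
    · exact .inr ⟨⟨h - 1 - I.m, by omega⟩, by simp; omega⟩
  refine Tri.mono (buildLists_spec (hf1.reg rM rfl) hM ?_ ?_ fun v => by rw [hf1.arr aFst rfl]; rfl)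
    le_rfl fun s₂ _ hf2 ⟨G, hGn, hGH, hG⟩ => ⟨G, s₂.arr aMate, ?_⟩
  · intro h a b
    rcases hcases h a b with ⟨a, rfl⟩ | ⟨a, rfl⟩
    · rw [(h1 _).1.1]; exact Fin.is_lt _
    · rw [(h1 _).1.2]; exact Fin.is_lt _
  · intro h a b
    rcases hcases h a b with ⟨a, rfl⟩ | ⟨a, rfl⟩
    · rw [(h1 _).2.1.1]; exact Fin.is_lt _
    · rw [(h1 _).2.1.2]; exact Fin.is_lt _
  · have hreg : ∀ x, build.wr x = false → s₂.reg x = I.input.reg x := fun x hx => by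
      simp only [build, wr, Bool.or_eq_false_iff] at hx
      rw [hf2.reg x hx.2, hf1.reg x hx.1]
    have harr : ∀ a, build.wa a = false → s₂.arr a = I.input.arr a := fun a ha => by
      simp only [build, wa, Bool.or_eq_false_iff] at ha
      rw [hf2.arr a ha.2, hf1.arr a ha.1]
    have hS : G.src = s₁.arr aSrc := hG.src.symm.trans (hf2.arr aSrc rfl)
    have hT : G.tgt = s₁.arr aTgt := hG.tgt.symm.trans (hf2.arr aTgt rfl)
    have hMt : s₂.arr aMate = s₁.arr aMate := hf2.arr aMate rfl
    exact
      { n := hreg _ rfl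
        m := hreg _ rfl
        d := hreg _ rfl
        t := hreg _ rfl
        k := hreg _ rfl
        sv := fun v => by rw [harr aSV rfl]; simp [MulticutInstance.input]
        sa := fun a => by rw [harr aSA rfl]; simp [MulticutInstance.input]
        tl := fun a => by rw [harr aTl rfl]; exact input_tl a
        hd := fun a => by rw [harr aHd rfl]; exact input_hd a
        fam := fun i j => by rw [harr aFam rfl]; exact input_fam i j
        loaded := hG
        mate := rfl
        graph :=
          { n_eq := hGn
            H_eq := hGH
            src_lo := fun a => by rw [hS]; exact (h1 a).1.1
            src_hi := fun a => by rw [hS]; exact (h1 a).1.2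
            tgt_lo := fun a => by rw [hT]; exact (h1 a).2.1.1
            tgt_hi := fun a => by rw [hT]; exact (h1 a).2.1.2
            mate_lo := fun a => by rw [hMt]; exact (h1 a).2.2.1
            mate_hi := fun a => by rw [hMt]; exact (h1 a).2.2.2 } }

/-- Process the pending nodes until there are no more of them. -/
def searchTree : Prog := loop (.reg rNum) (popNode ;; processNode)

/-- The program for the multicut problem. -/
def multicutProg : Prog :=
  build ;; set rBud (add (.reg rK) (.reg rK)) ;; pushNode ;; searchTree

theorem searchTree_spec {G : AdjGraph} {mate : ℕ → ℕ} (hs : Static I G mate s) (hd : 1 ≤ I.d)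
    (hM : stackBound I ≤ M) (hM' : 2 * I.n + 2 ≤ M) (hM'' : I.len + I.d ≤ M) {l : List (Node I)}
    (hl : Stored I l s) (h0 : s.reg rAns = 0)
    (hsol : (∃ S, I.IsMulticut S) → ∃ x ∈ l, I.Sol x.S x.L) :
    Tri M searchTree s
      (6000 * ((2 * I.k + 2) * (I.len + I.m + I.n + 1)) * potential l + 2) I.Correct := by
  set N := I.len + I.m + I.n + 1 with hN
  set U := (2 * I.k + 2) * N with hU
  have hNU : 2 * N ≤ U := Nat.mul_le_mul_right _ (by omega)
  refine TriT.loop (fun r s' => (s'.reg rAns ≠ 0 ∧ s'.reg rNum = 0 ∧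
      I.IsMulticut (I.aset (s'.arr aDel))) ∨
      (s'.reg rAns = 0 ∧ ∃ l, Stored I l s' ∧ 6000 * U * potential l ≤ r ∧
        ((∃ S, I.IsMulticut S) → ∃ x ∈ l, I.Sol x.S x.L)))
    (by decide) _ (.inr ⟨h0, l, hl, le_rfl, hsol⟩) ?_ ?_
  · rintro r s₁ hf1 hb1 (⟨-, h1, -⟩ | ⟨h1, l, h2, h3, h4⟩) hne
    · exact absurd h1 hne
    have hs1 := hs.frame hf1 rfl
    match l, h2, h3, h4 with
    | [], h2, _, _ => exact absurd h2.num hne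
    | x :: l, h2, h3, h4 =>
      obtain ⟨hx, hroom, -⟩ := h2.frontier
      refine TriT.seq (TriT.mono (popNode_spec hs1 h2) fun T₁ s₂ _ hf2 ⟨hT₁, h5, h6, h7, h8⟩ => ?_)
      refine TriT.mono (processNode_spec (hs1.frame hf2 rfl) hd hM hM' hM'' h5 hx hroom h6 h7 h8
        ((hf2.reg rAns rfl).trans h1)) fun T₂ s₃ _ _ ⟨B, hT₂, hout⟩ => ?_
      rw [← hN, ← hU] at hout
      have hw := weight_pos (K := x.bud) (l := x.lam) hd
      simp only [cost]
      rcases hout with ⟨a1, a2, a3, a4⟩ | ⟨a1, l', b, a2, a3, a4, a5, a6, a7⟩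
      · refine ⟨0, ?_, .inl ⟨a1, a2, a3⟩⟩
        have : 6000 * U * 1 ≤ 6000 * U * potential (x :: l) :=
          Nat.mul_le_mul_left _ (by rw [potential_cons]; omega)
        omega
      · refine ⟨6000 * U * potential l', ?_, .inr ⟨a1, l', a2, le_rfl, fun hS => ?_⟩⟩
        · have e1 := Nat.mul_le_mul_left (6000 * U) a5
          have e2 : 1 * U ≤ b * U := Nat.mul_le_mul_right _ a4
          have e3 : 6000 * U * (potential l' + b) = 6000 * U * potential l' + 6000 * (b * U) := by
            ring
          have e4 : 5000 * U * b = 5000 * (b * U) := by ring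
          omega
        · obtain ⟨y, hy, hy'⟩ := h4 hS
          rcases List.mem_cons.1 hy with rfl | hy
          · exact a7 hy'
          · exact ⟨y, a6 y hy, hy'⟩
  · rintro r s₁ hf1 hb1 (⟨h1, -, h2⟩ | ⟨h1, l, h2, -, h4⟩) hz
    · exact ⟨fun _ => h2, fun h => absurd h h1⟩
    · refine ⟨fun h => absurd h1 h, fun _ hS => ?_⟩
      obtain ⟨x, hx, -⟩ := h4 hS
      have : l.length = 0 := h2.num.symm.trans hz
      rw [List.length_eq_zero_iff.1 this] at hx
      simp at hx

theorem multicutProg_spec (hd : 1 ≤ I.d) (hM : stackBound I ≤ M) (hM' : 2 * I.n + 2 ≤ M)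
    (hM'' : I.len + I.d ≤ M) (hMm : 2 * I.m + 1 ≤ M) (hMk : 2 * I.k ≤ M) :
    Tri M multicutProg I.input
      (100000 * ((4 * I.d) ^ I.k * max I.k 1 ^ 4 * (I.len + I.m + I.n + 1))) I.Correct := by
  set N := I.len + I.m + I.n + 1 with hN
  set U := (2 * I.k + 2) * N with hU
  have hU' : U ≤ 4 * (max I.k 1 ^ 4 * N) := by
    have h1 : I.k ≤ max I.k 1 := le_max_left _ _
    have h2 : 1 ≤ max I.k 1 := le_max_right _ _
    have h3 : max I.k 1 ≤ max I.k 1 ^ 4 := Nat.le_self_pow (by norm_num) _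
    rw [← mul_assoc]
    exact Nat.mul_le_mul_right _ (by omega)
  have hP : 1 ≤ (4 * I.d) ^ I.k := Nat.one_le_pow _ _ (by omega)
  have hPU := Nat.mul_le_mul_left ((4 * I.d) ^ I.k) hU'
  have hPU1 : 1 * U ≤ (4 * I.d) ^ I.k * U := Nat.mul_le_mul_right _ hP
  have hNU : 2 * N ≤ U := Nat.mul_le_mul_right _ (by omega)
  refine Tri.seq (200 * (I.m + 1)) (24000 * ((4 * I.d) ^ I.k * U) + 70 * N) ?_ (by
    rw [mul_assoc ((4 * I.d) ^ I.k)]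
    have : (4 * I.d) ^ I.k * (4 * (max I.k 1 ^ 4 * N)) =
      4 * ((4 * I.d) ^ I.k * (max I.k 1 ^ 4 * N)) := by ring
    omega)
  refine Tri.mono (build_spec hMm) le_rfl fun s₁ _ _ ⟨G, mate, hs1⟩ hf1 hb1 => ?_
  refine Tri.seq 4 (24000 * ((4 * I.d) ^ I.k * U) + 60 * N + 2) ?_ (by omega)
  refine Tri.straight rfl (by decide) fun _ =>
    ⟨by simp [Safe, val, hs1.k]; omega, fun hf2 hb2 => ?_⟩
  generalize he : exec _ s₁ = s₂ at hf2 hb2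
  have hs2 := hs1.frame hf2 rfl
  have hbud : s₂.reg rBud = 2 * I.k := by subst he; simp [exec, val, hs1.k]; omega
  have hl2 : Stored I [] s₂ := by
    refine ⟨?_, ?_, ?_, trivial⟩
    · exact (hf2.reg rNum rfl).trans (hf1.reg rNum rfl)
    · rw [List.length_nil, Nat.zero_mul]
      exact (hf2.reg rOffL rfl).trans (hf1.reg rOffL rfl)
    · rw [List.length_nil, Nat.zero_mul]
      exact (hf2.reg rOffD rfl).trans (hf1.reg rOffD rfl)
  have hL : I.vset (s₂.arr aL) = ∅ := by
    rw [hf2.arr aL rfl, hf1.arr aL rfl]; ext v; simp [MulticutInstance.input]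
  have hD : I.aset (s₂.arr aDel) = ∅ := by
    rw [hf2.arr aDel rfl, hf1.arr aDel rfl]; ext a; simp [MulticutInstance.input]
  have hA : s₂.reg rAns = 0 := (hf2.reg rAns rfl).trans (hf1.reg rAns rfl)
  refine Tri.seq (60 * N) (24000 * ((4 * I.d) ^ I.k * U) + 2) ?_ (by omega)
  refine Tri.mono (pushNode_spec hs2 hM hl2 ⟨∅, ∅, 2 * I.k, 0⟩
    ⟨by simp [SelfConj], by simp, by simp⟩ (by simp) hL hD hbud) (by omega)
    fun s₃ _ _ h3 hf3 hb3 => ?_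
  refine Tri.mono (searchTree_spec (hs2.frame hf3 rfl) hd hM hM' hM'' h3
    ((hf3.reg rAns rfl).trans hA) fun ⟨S, hS⟩ => ⟨_, List.mem_singleton_self _,
      sol_of_isMulticut hS⟩) ?_ fun _ _ _ h => h
  have hw : potential [(⟨∅, ∅, 2 * I.k, 0⟩ : Node I)] ≤ 4 * (4 * I.d) ^ I.k := by
    simp only [potential_cons, potential_nil, weight, if_pos]
    rw [Nat.mul_div_cancel_left _ (by norm_num)]
    omega
  have := Nat.mul_le_mul_left (6000 * U) hw
  have e : 6000 * U * (4 * (4 * I.d) ^ I.k) = 24000 * ((4 * I.d) ^ I.k * U) := by ring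
  rw [← hN, ← hU]
  omega

end WordRAM

open WordRAM MulticutInstance in
/-- Words that can hold the tenth power of the size of the instance are long enough. -/
theorem exists_bounds {I : MulticutInstance} (hd : 1 ≤ I.d) : I.size ≤ I.size ^ 6 ∧
    stackBound I ≤ I.size ^ 6 ∧ 2 * I.n + 2 ≤ I.size ^ 6 ∧ I.len + I.d ≤ I.size ^ 6 ∧
    2 * I.m + 1 ≤ I.size ^ 6 ∧ 2 * I.k ≤ I.size ^ 6 ∧ 16 * I.size ^ 6 ≤ I.size ^ 10 := by
  have hz : I.size = I.n + I.m + I.len + I.d + I.k + 2 := rfl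
  generalize I.size = z at hz
  have h2 : 2 ≤ z := by omega
  have h1 : z * 2 ≤ z ^ 6 := by
    calc z * 2 ≤ z * z ^ 5 := Nat.mul_le_mul_left _ (h2.trans (Nat.le_self_pow (by norm_num) _))
      _ = z ^ 6 := by ring
  refine ⟨by omega, ?_, by omega, by omega, by omega, by omega, ?_⟩
  · calc stackBound I = (2 * I.d * (2 * I.k + 1) + 1) * (I.n + I.m + 1) := rfl
      _ ≤ (2 * z * (2 * z) + z * z) * z := by
        refine Nat.mul_le_mul (Nat.add_le_add (Nat.mul_le_mul (by omega) (by omega)) ?_) (by omega)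
        exact Nat.one_le_iff_ne_zero.2 (by positivity)
      _ = 5 * z ^ 3 := by ring
      _ ≤ 2 ^ 3 * z ^ 3 := Nat.mul_le_mul_right _ (by norm_num)
      _ ≤ z ^ 3 * z ^ 3 := Nat.mul_le_mul_right _ (Nat.pow_le_pow_left h2 3)
      _ = z ^ 6 := by ring
  · calc 16 * z ^ 6 = 2 ^ 4 * z ^ 6 := by norm_num
      _ ≤ z ^ 4 * z ^ 6 := Nat.mul_le_mul_right _ (Nat.pow_le_pow_left h2 4)
      _ = z ^ 10 := by ring

theorem theorem1 :
    ∃ (P : WordRAM.Prog) (C c : ℕ), ∀ I : MulticutInstance, 1 ≤ I.d →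
      ∃ (T : ℕ) (s : WordRAM.State),
        WordRAM.Run (I.size ^ c) P I.input T s ∧
        I.Correct s ∧
        T ≤ C * ((4 * I.d) ^ I.k * (max I.k 1) ^ 4 * (I.len + I.m + I.n + 1)) := by
  refine ⟨WordRAM.multicutProg, 100000, 10, fun I hd => ?_⟩
  obtain ⟨h1, h2, h3, h4, h5, h6, h7⟩ := exists_bounds hd
  obtain ⟨T, s, hrun, -, hT, hs⟩ := WordRAM.multicutProg_spec hd h2 h3 h4 h5 h6
    (WordRAM.bdd_input h1 hd) _ h7
  exact ⟨T, s, hrun, hs, hT⟩
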